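/- **Conventions.** A filtered spectrum is a functor $X:\mathbb Z^{op}\to \mathcal Sp$, $n\mapsto X^n$. Put $\pi_{x,y}X=\pi_x(X^{x+y})$; the transition maps induce $\tau:\pi_{x,y}X\to\pi_{x,y-1}X$. For $k\ge 0$ let $X/\tau^k$ be the filtered spectrum with $n$-th term $\mathrm{cofib}(X^{n+k}\to X^n)$, let $a\mapsto[a]$ be the projection $\pi_{x,y}X\to\pi_{x,y}(X/\tau)$, and let $\delta:\pi_{x,y}(X/\tau)\to\pi_{x-1,y+2}X$ be the boundary map. Let $\tau^{-1}X=\mathrm{colim}_n X^{-n}$. We call $X$ *complete* if $\lim_n X^n=0$, and *strongly complete* if moreover $\varprojlim^1_k\pi_{x,y}(X/\tau^k)=0$ for all $x,y$ (so that $\pi_{x,y}X\cong\varprojlim_k(\pi_{x,y}X)/\tau^k$). The $\tau$-Bockstein spectral sequence of $X$ has, for $r\ge2$, $E_r^{x,y}=Z_r/B_r$ with $Z_r=\{a\in\pi_{x,y}(X/\tau):\delta a\in\tau^{r-2}\pi_{x-1,y+r}X\}$ and $B_r=\{[c]: c\in\pi_{x,y}X,\ \tau^{r-2}c=0\}$;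 the differential $d_r:E_r^{x,y}\to E_r^{x-1,y+r}$ sends the class of $a$ to the class of $[c]$, where $\delta a=\tau^{r-2}c$. A class of $E_r$ is called a *permanent cycle* if it has a representative $a$ with $\delta a=0$. Fix a real number $\alpha>-1$. The linear t-structure for the line $y=\alpha x$ on filtered spectra has as connective objects those $X$ for which every $X^n$ is $\lceil n/(\alpha+1)\rceil$-connective (equivalently, $\pi_{x,y}X=0$ for $y>\alpha x$). A map $f:X\to Y$ exhibits $X$ as the connective cover $\tau_{\ge0}^{y=\alpha x}Y$ if $X$ is connective and the cofibre of $f$ lies in $\tau_{\le-1}$, i.e. $\pi_k(\mathrm{cofib}(f)^n)=0$ for $k\ge\lceil n/(\alpha+1)\rceil$. A nonzero differential $d_r(a)=b\ne0$ with $a$ in bidegree $(x,y)$ is *line-crossing* if $y\le\alpha x$ and $y+r>\alpha(x-1)$. A class $b\in\pi_{x,y}Y$ *drops to the line* if $y>\alpha x$, $[b]\neq0$ and $\tau^lb\ne0$, where $l=y-\lfloor\alpha x\rfloor$; a *dropped lift* of such a $b$ is a class $a\in\pi_{x,\lfloor\alpha x\rfloor}X$ with $f(a)=\tau^lb$. **Theorem.**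 Let $f:X\to Y$ be a map of filtered spectra. Then $f$ exhibits $X$ as $\tau_{\ge 0}^{y=\alpha x}Y$ if and only if the following conditions hold. 1. $X$ is strongly complete. 2. $X/\tau$ is connective in the linear t-structure for $y=\alpha x$. 3. $\tau^{-1}f:\tau^{-1}X\to\tau^{-1}Y$ is an equivalence. 4. For all $r\ge2$ the map $(*)\ E_r(X)\to E_r(Y)$ satisfies: (a) it is an isomorphism in bidegrees $(x,y)$ with $y+r\le\alpha(x-1)$; if $y+r>\alpha(x-1)$ and $y\le\alpha x$, its image in bidegree $(x,y)$ consists precisely of the permanent cycles; (b) it is injective in bidegree $(x,y)$ unless $y=\lfloor\alpha x\rfloor$. Conditions (1)–(4) also imply that $f$ exhibits $X$ as $\tau_{\ge0}^{y=\alpha x}Y$ if in (4a) "the permanent cycles" is replaced by "the classes $b$ that do not support a line-crossing differential $d_s(b)$, $s\ge r$". Suppose now that $Y$ is strongly complete and that $f$ exhibits $X$ as $\tau_{\ge0}^{y=\alpha x}Y$. Then (4) also holds with this replacement in (4a), and: 5. If $b\in\pi_{x,y}Y$ drops to the line, then $b$ has a unique dropped lift $a\in\pi_{x,y-l}X$,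 and $\tau^ka=0\iff\tau^{k+l}b=0$ for all $k\ge0$. 6. For $r\ge2$, the nonzero elements of the kernel of $(*)$ in bidegree $(x,\lfloor\alpha x\rfloor)$ are precisely the classes in $E_r(X)$ of $[a]$, for $a$ a dropped lift of a class $b\in\pi_{x,y}Y$ (for some $y$) with $\tau^{l+r-2}b\ne0$. 7. Let $b\in\pi_{x,y}Y$ drop to the line with dropped lift $a$, and let $r>1$ be minimal with $\tau^{l+r-1}b=0$. Then there is a class $z\in E_r(Y)$ in bidegree $(x+1,\lfloor\alpha x\rfloor-r)$ which survives to $E_{l+r}(Y)$ with $d_{l+r}(z)=[b]$ there; if $[b]$ is nonzero in $E_{l+r}(Y)$, this is a line-crossing differential. The class $z$ has a unique lift $\tilde z\in E_r(X)$ along $(*)$, and $d_r(\tilde z)=[a]\neq0$. Conversely, let $d_r(\tilde z)=[a]\ne0$ be a differential in $E_r(X)$, $r\geq 2$, with $a$ a dropped lift of $b$. Then $r$ is minimal among the integers $r>1$ with $\tau^{l+r-1}b=0$, the class $f(\tilde z)$ survives to $E_{l+r}(Y)$, and $d_{l+r}(f(\tilde z))=[b]$. Moreover there is a class $b'\in\pi_{x,y'}Y$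 that drops to the line, with dropped lift $a'$ and $l'=y'-\lfloor\alpha x\rfloor$, such that $[a']=[a]$ in $E_r(X)$, $r$ is minimal among the integers $r>1$ with $\tau^{l'+r-1}b'=0$, and $d_{l'+r}(f(\tilde z))=[b']\ne0$ is a line-crossing differential in the spectral sequence of $Y$. 8. Let $d_r(\tilde z)=v\neq0$ be a differential in the spectral sequence of $X$, $r\ge2$. Either $f(v)\ne0$ in $E_r(Y)$, so that it lifts the nonzero differential $d_r(f(\tilde z))=f(v)$ of $Y$, or $v=[a]$ for a dropped lift $a$ of a class $b$ such that $r>1$ is minimal with $\tau^{l+r-1}b=0$ and $d_{l+r}(f(\tilde z))=[b]$ is a (nonzero) line-crossing differential in the spectral sequence of $Y$, i.e. the differential is of the form described in (7). -/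

import Mathlib

/-!
# Filtered spectra, linear t-structures and the τ-Bockstein spectral sequence

The ∞-category of spectra is modelled by `Ω`-spectra: sequences of pointed topological spaces
`E n`, `n : ℤ`, with weak homotopy equivalences `E n → Ω E (n + 1)`.  A filtered spectrum is a
functor from `ℤᵒᵖ` to `Ω`-spectra, and a map of filtered spectra is a natural transformation
(every object and every map of the ∞-category `Fun(ℤᵒᵖ, Sp)` is represented in this way).
-/

open CategoryTheory Opposite
open scoped unitInterval

universe u

noncomputable section

namespace LinearT

/-! ### Pointed spaces -/

/-- Pointed topological spaces. -/
structure PtdSpace where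
  /-- The underlying type. -/
  carrier : Type u
  /-- The topology. -/
  [top : TopologicalSpace carrier]
  /-- The base point. -/
  pt : carrier

attribute [instance] PtdSpace.top

instance : CoeSort PtdSpace.{u} (Type u) := ⟨PtdSpace.carrier⟩

/-- Pointed continuous maps. -/
@[ext]
structure PMap (P Q : PtdSpace.{u}) where
  /-- The underlying continuous map. -/
  toMap : C(P, Q)
  map_pt : toMap P.pt = Q.pt

instance (P Q : PtdSpace.{u}) : CoeFun (PMap P Q) (fun _ => P → Q) := ⟨fun f => f.toMap⟩

theorem PMap.ext_apply {P Q : PtdSpace.{u}} {f g : PMap P Q} (h : ∀ p, f p = g p) : f = g :=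
  PMap.ext (ContinuousMap.ext h)

theorem PMap.continuous {P Q : PtdSpace.{u}} (f : PMap P Q) : Continuous f := f.toMap.continuous

/-- The identity map. -/
def PMap.id (P : PtdSpace.{u}) : PMap P P := ⟨ContinuousMap.id P, rfl⟩

/-- `g.comp f` is `g ∘ f`. -/
def PMap.comp {P Q R : PtdSpace.{u}} (g : PMap Q R) (f : PMap P Q) : PMap P R :=
  ⟨g.toMap.comp f.toMap, by
    simp only [ContinuousMap.comp_apply, f.map_pt, g.map_pt]⟩

/-! ### Homotopy groups of spaces -/

/-- The map on homotopy groups induced by a continuous map `f` with `f x = y`. -/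
def homotopyMap (N : Type) {X Y : Type u} [TopologicalSpace X] [TopologicalSpace Y]
    (f : C(X, Y)) {x : X} {y : Y} (h : f x = y) : HomotopyGroup N X x → HomotopyGroup N Y y :=
  Quotient.map
    (fun p : GenLoop N X x => (⟨f.comp p.1, fun t ht => by
      rw [ContinuousMap.comp_apply, p.2 t ht, h]⟩ : GenLoop N Y y))
    (fun _ _ H => ContinuousMap.HomotopicRel.comp_continuousMap H f)

/-- Weak homotopy equivalences between nonempty spaces: bijections on `π₀` and on all homotopy
groups, for all base points. -/
def IsWeakEquiv {P Q : PtdSpace.{u}} (f : PMap P Q) : Prop :=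
  ∀ (n : ℕ) (x : P), Function.Bijective
    (homotopyMap (Fin n) f.toMap (rfl : f.toMap x = f.toMap x))

/-- `π₂` of a pointed space, written additively. -/
abbrev PiTwo (P : PtdSpace.{u}) : Type u := Additive (HomotopyGroup (Fin 2) P P.pt)

/-- The homomorphism induced by a pointed map on `π₂`. -/
def piTwoMap {P Q : PtdSpace.{u}} (f : PMap P Q) : PiTwo P →+ PiTwo Q where
  toFun a := Additive.ofMul (homotopyMap (Fin 2) f.toMap f.map_pt a.toMul)
  map_zero' := by
    change Additive.ofMul (homotopyMap (Fin 2) f.toMap f.map_pt 1) = 0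
    rw [HomotopyGroup.one_def]
    refine congrArg Additive.ofMul ?_
    rw [HomotopyGroup.one_def]
    refine congrArg (Quotient.mk _) ?_
    ext t
    exact f.map_pt
  map_add' a b := by
    refine Quotient.inductionOn₂ (s₁ := GenLoop.Homotopic.setoid (Fin 2) P.pt)
      (s₂ := GenLoop.Homotopic.setoid (Fin 2) P.pt) a b fun p q => ?_
    have h1 := HomotopyGroup.mul_spec (i := (0 : Fin 2)) (p := p) (q := q)
    refine (congrArg (fun c => Additive.ofMul (homotopyMap (Fin 2) f.toMap f.map_pt c)) h1).trans ?_
    refine Eq.trans ?_ (HomotopyGroup.mul_spec (i := (0 : Fin 2))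
      (p := (⟨f.toMap.comp p.1, fun t ht => by
        rw [ContinuousMap.comp_apply, p.2 t ht, f.map_pt]⟩ : GenLoop (Fin 2) Q Q.pt))
      (q := ⟨f.toMap.comp q.1, fun t ht => by
        rw [ContinuousMap.comp_apply, q.2 t ht, f.map_pt]⟩)).symm
    refine congrArg (Quotient.mk _) ?_
    ext t
    simp only [GenLoop.transAt, GenLoop.coe_copy, GenLoop.mk_apply, ContinuousMap.comp_apply]
    change f.toMap (if _ then _ else _) = _
    split_ifs <;> rfl

theorem piTwoMap_comp {P Q R : PtdSpace.{u}} (g : PMap Q R) (f : PMap P Q) (a : PiTwo P) :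
    piTwoMap (g.comp f) a = piTwoMap g (piTwoMap f a) :=
  Quotient.inductionOn (s := GenLoop.Homotopic.setoid (Fin 2) P.pt) a fun _ => rfl

/-! ### Loop spaces and homotopy fibres -/

/-- The loop space of a pointed space. -/
def loop (P : PtdSpace.{u}) : PtdSpace.{u} where
  carrier := LoopSpace P P.pt
  pt := Path.refl P.pt

/-- A point of the loop space as a path. -/
def asPath {P : PtdSpace.{u}} (γ : loop P) : Path P.pt P.pt := γ

theorem continuous_asPath {P : PtdSpace.{u}} {Z : Type*} [TopologicalSpace Z]
    {g : Z → loop P} {t : Z → I} (hg : Continuous g) (ht : Continuous t) :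
    Continuous fun z => asPath (g z) (t z) :=
  (Path.continuous_uncurry_iff.2 hg : Continuous fun p : Z × I => asPath (g p.1) p.2).comp
    (continuous_id.prodMk ht)

/-- The map induced on loop spaces. -/
def loopMap {P Q : PtdSpace.{u}} (f : PMap P Q) : PMap (loop P) (loop Q) where
  toMap :=
    { toFun := fun γ : Path P.pt P.pt =>
        ({ toFun := fun t => f (γ t)
           continuous_toFun := f.continuous.comp γ.continuous
           source' := by rw [γ.source, f.map_pt]
           target' := by rw [γ.target, f.map_pt] } : Path Q.pt Q.pt)
      continuous_toFun := Path.continuous_uncurry_iff.1 <|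
        f.continuous.comp (Path.continuous_uncurry_iff.2 continuous_id) }
  map_pt := by
    refine Path.ext ?_
    funext t
    exact f.map_pt

/-- The homotopy fibre of `f : P → Q`: points `p` of `P` with a path in `Q` from the base point
to `f p`. -/
def fib {P Q : PtdSpace.{u}} (f : PMap P Q) : PtdSpace.{u} where
  carrier := {w : P × C(I, Q) // w.2 0 = Q.pt ∧ w.2 1 = f w.1}
  pt := ⟨(P.pt, ContinuousMap.const I Q.pt), rfl, f.map_pt.symm⟩

/-- The projection of the homotopy fibre of `P → Q` to `P`. -/
def fibProj {P Q : PtdSpace.{u}} (f : PMap P Q) : PMap (fib f) P where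
  toMap := ⟨fun w => w.1.1, continuous_fst.comp continuous_subtype_val⟩
  map_pt := rfl

/-- The inclusion of `Ω Q` into the homotopy fibre of `P → Q`. -/
def fibIncl {P Q : PtdSpace.{u}} (f : PMap P Q) : PMap (loop Q) (fib f) where
  toMap :=
    { toFun := fun γ : Path Q.pt Q.pt =>
        ⟨(P.pt, γ.toContinuousMap), γ.source, γ.target.trans f.map_pt.symm⟩
      continuous_toFun := Continuous.subtype_mk
        (continuous_const.prodMk continuous_induced_dom) _ }
  map_pt := rfl

/-- The map of homotopy fibres induced by a commutative square. -/
def fibMap {P Q P' Q' : PtdSpace.{u}} {f : PMap P Q} {f' : PMap P' Q'}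
    (a : PMap P P') (b : PMap Q Q') (h : ∀ p, b (f p) = f' (a p)) : PMap (fib f) (fib f') where
  toMap :=
    { toFun := fun w => ⟨(a w.1.1, b.toMap.comp w.1.2), by
        rw [ContinuousMap.comp_apply, w.2.1, b.map_pt], by
        rw [ContinuousMap.comp_apply, w.2.2]; exact h _⟩
      continuous_toFun := Continuous.subtype_mk
        ((a.continuous.comp (continuous_fst.comp continuous_subtype_val)).prodMk
          ((ContinuousMap.continuous_postcomp b.toMap).comp
            (continuous_snd.comp continuous_subtype_val))) _ }
  map_pt := by
    refine Subtype.ext (Prod.ext a.map_pt ?_)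
    ext t
    exact b.map_pt

/-- The canonical map from the homotopy fibre of `Ω f` to the loop space of the homotopy fibre of
`f`, which interchanges the two path coordinates. -/
def fibLoop {P Q : PtdSpace.{u}} (f : PMap P Q) : PMap (fib (loopMap f)) (loop (fib f)) where
  toMap :=
    { toFun := fun w =>
        ({ toFun := fun t => ⟨(asPath w.1.1 t,
              ⟨fun s => asPath (w.1.2 s) t,
                continuous_asPath (w.1.2.continuous) continuous_const⟩), by
              change asPath (w.1.2 0) t = Q.pt
              rw [w.2.1]; rfl, by
              change asPath (w.1.2 1) t = _
              rw [w.2.2]; rfl⟩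
           continuous_toFun := by
             refine Continuous.subtype_mk (Continuous.prodMk (asPath w.1.1).continuous
               (ContinuousMap.continuous_of_continuous_uncurry _ ?_)) _
             exact continuous_asPath (w.1.2.continuous.comp continuous_snd) continuous_fst
           source' := by
             refine Subtype.ext (Prod.ext (Path.source _) ?_)
             ext s
             exact Path.source _
           target' := by
             refine Subtype.ext (Prod.ext (Path.target _) ?_)
             ext s
             exact Path.target _ } : Path (fib f).pt (fib f).pt)
      continuous_toFun := by
        refine Path.continuous_uncurry_iff.1 (Continuous.subtype_mk (Continuous.prodMk
          (continuous_asPath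
            ((continuous_fst.comp continuous_subtype_val).comp continuous_fst) continuous_snd)
          (ContinuousMap.continuous_of_continuous_uncurry _ ?_)) _)
        exact continuous_asPath (ContinuousEval.continuous_eval.comp
          (((continuous_snd.comp continuous_subtype_val).comp
            (continuous_fst.comp continuous_fst)).prodMk continuous_snd))
          (continuous_snd.comp continuous_fst) }
  map_pt := by
    refine Path.ext ?_
    funext t
    rfl

/-! ### Homotopy limits of towers and mapping telescopes -/

/-- The homotopy limit of a tower `⋯ → P 2 → P 1 → P 0`: sequences of points `w n` of `P n` with
paths from `w n` to the image of `w (n + 1)`. -/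
def holimSpace (P : ℕ → PtdSpace.{u}) (p : ∀ n, PMap (P (n + 1)) (P n)) : PtdSpace.{u} where
  carrier := {w : (∀ n, P n) × (∀ n, C(I, P n)) //
    ∀ n, w.2 n 0 = w.1 n ∧ w.2 n 1 = p n (w.1 (n + 1))}
  pt := ⟨(fun n => (P n).pt, fun n => ContinuousMap.const I (P n).pt),
    fun n => ⟨rfl, (p n).map_pt.symm⟩⟩

/-- Functoriality of the homotopy limit. -/
def holimSpaceMap {P Q : ℕ → PtdSpace.{u}} {p : ∀ n, PMap (P (n + 1)) (P n)}
    {q : ∀ n, PMap (Q (n + 1)) (Q n)} (a : ∀ n, PMap (P n) (Q n))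
    (h : ∀ n z, a n (p n z) = q n (a (n + 1) z)) : PMap (holimSpace P p) (holimSpace Q q) where
  toMap :=
    { toFun := fun w => ⟨(fun n => a n (w.1.1 n), fun n => (a n).toMap.comp (w.1.2 n)),
        fun n => ⟨by rw [ContinuousMap.comp_apply, (w.2 n).1],
          by rw [ContinuousMap.comp_apply, (w.2 n).2]; exact h n _⟩⟩
      continuous_toFun := Continuous.subtype_mk (Continuous.prodMk
        (continuous_pi fun n => (a n).continuous.comp
          ((continuous_apply n).comp (continuous_fst.comp continuous_subtype_val)))
        (continuous_pi fun n => (ContinuousMap.continuous_postcomp (a n).toMap).comp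
          ((continuous_apply n).comp (continuous_snd.comp continuous_subtype_val)))) _ }
  map_pt := by
    refine Subtype.ext (Prod.ext ?_ ?_)
    · funext n
      exact (a n).map_pt
    · funext n
      ext t
      exact (a n).map_pt

/-- The canonical map from the homotopy limit of loop spaces to the loop space of the homotopy
limit. -/
def holimSpaceLoop (P : ℕ → PtdSpace.{u}) (p : ∀ n, PMap (P (n + 1)) (P n)) :
    PMap (holimSpace (fun n => loop (P n)) (fun n => loopMap (p n))) (loop (holimSpace P p)) where
  toMap :=
    { toFun := fun w =>
        ({ toFun := fun t => ⟨(fun n => asPath (w.1.1 n) t,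
              fun n => ⟨fun s => asPath (w.1.2 n s) t,
                continuous_asPath (w.1.2 n).continuous continuous_const⟩), fun n => ⟨by
              change asPath (w.1.2 n 0) t = _
              rw [(w.2 n).1], by
              change asPath (w.1.2 n 1) t = _
              rw [(w.2 n).2]; rfl⟩⟩
           continuous_toFun := by
             refine Continuous.subtype_mk (Continuous.prodMk
               (continuous_pi fun n => (asPath (w.1.1 n)).continuous)
               (continuous_pi fun n => ContinuousMap.continuous_of_continuous_uncurry _ ?_)) _
             exact continuous_asPath ((w.1.2 n).continuous.comp continuous_snd) continuous_fst
           source' := by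
             refine Subtype.ext (Prod.ext (funext fun n => Path.source _) (funext fun n => ?_))
             ext s
             exact Path.source _
           target' := by
             refine Subtype.ext (Prod.ext (funext fun n => Path.target _) (funext fun n => ?_))
             ext s
             exact Path.target _ } : Path (holimSpace P p).pt (holimSpace P p).pt)
      continuous_toFun := by
        refine Path.continuous_uncurry_iff.1 (Continuous.subtype_mk (Continuous.prodMk
          (continuous_pi fun n => continuous_asPath
            ((continuous_apply n).comp
              ((continuous_fst.comp continuous_subtype_val).comp continuous_fst)) continuous_snd)
          (continuous_pi fun n => ContinuousMap.continuous_of_continuous_uncurry _ ?_)) _)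
        exact continuous_asPath (ContinuousEval.continuous_eval.comp
          (((continuous_apply n).comp ((continuous_snd.comp continuous_subtype_val).comp
            (continuous_fst.comp continuous_fst))).prodMk continuous_snd))
          (continuous_snd.comp continuous_fst) }
  map_pt := by
    refine Path.ext ?_
    funext t
    rfl

/-- The gluing relation of the mapping telescope: `(n, z, 1)` is identified with
`(n + 1, p z, 0)`. -/
inductive TelRel (P : ℕ → PtdSpace.{u}) (p : ∀ n, PMap (P n) (P (n + 1))) :
    (Σ n, P n × I) → (Σ n, P n × I) → Prop
  | glue (n : ℕ) (z : P n) : TelRel P p ⟨n, z, 1⟩ ⟨n + 1, p n z, 0⟩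

/-- The mapping telescope, i.e. the homotopy colimit, of a sequence `P 0 → P 1 → P 2 → ⋯`. -/
abbrev Telescope (P : ℕ → PtdSpace.{u}) (p : ∀ n, PMap (P n) (P (n + 1))) : Type u :=
  Quot (TelRel P p)

/-- Functoriality of the mapping telescope. -/
def telescopeMap {P Q : ℕ → PtdSpace.{u}} {p : ∀ n, PMap (P n) (P (n + 1))}
    {q : ∀ n, PMap (Q n) (Q (n + 1))} (a : ∀ n, PMap (P n) (Q n))
    (h : ∀ n z, a (n + 1) (p n z) = q n (a n z)) : C(Telescope P p, Telescope Q q) where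
  toFun := Quot.map (fun w => ⟨w.1, a w.1 w.2.1, w.2.2⟩) (by
    rintro _ _ ⟨n, z⟩
    change TelRel Q q ⟨n, a n z, 1⟩ ⟨n + 1, a (n + 1) (p n z), 0⟩
    rw [h]
    exact TelRel.glue n (a n z))
  continuous_toFun := by
    refine continuous_quot_lift _ (continuous_quot_mk.comp (continuous_sigma fun n => ?_))
    exact continuous_sigmaMk.comp (((a n).continuous.comp continuous_fst).prodMk continuous_snd)

/-- The map induced on sets of path components. -/
def pathComponentsMap {X Y : Type u} [TopologicalSpace X] [TopologicalSpace Y] (f : C(X, Y)) :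
    ZerothHomotopy X → ZerothHomotopy Y :=
  Quotient.map f (fun _ _ h => h.map f.continuous)

/-! ### Spectra -/

/-- Sequences of pointed spaces with structure maps `E n → Ω E (n + 1)`. -/
structure PreSpec where
  /-- The `n`-th space. -/
  level : ℤ → PtdSpace.{u}
  /-- The adjoint structure maps. -/
  str : ∀ n, PMap (level n) (loop (level (n + 1)))

namespace PreSpec

/-- The condition of being an `Ω`-spectrum. -/
def IsOmega (E : PreSpec.{u}) : Prop := ∀ n, IsWeakEquiv (E.str n)

/-- Maps strictly compatible with the structure maps. -/
@[ext]
structure Hom (E F : PreSpec.{u}) where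
  /-- The map on `n`-th spaces. -/
  app : ∀ n, PMap (E.level n) (F.level n)
  comm : ∀ n, (F.str n).comp (app n) = (loopMap (app (n + 1))).comp (E.str n)

instance : Category PreSpec.{u} where
  Hom := Hom
  id E := ⟨fun n => PMap.id _, fun n => rfl⟩
  comp {E F G} f g := ⟨fun n => (g.app n).comp (f.app n), fun n => by
    have h1 := f.comm n
    have h2 := g.comm n
    calc (G.str n).comp ((g.app n).comp (f.app n))
        = ((G.str n).comp (g.app n)).comp (f.app n) := rfl
      _ = (loopMap (g.app (n + 1))).comp ((F.str n).comp (f.app n)) := by rw [h2]; rfl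
      _ = _ := by rw [h1]; rfl⟩

theorem comm_apply {E F : PreSpec.{u}} (f : E ⟶ F) (n : ℤ) (z : E.level n) :
    F.str n (f.app n z) = loopMap (f.app (n + 1)) (E.str n z) :=
  congrArg (fun g : PMap (E.level n) (loop (F.level (n + 1))) => g z) (f.comm n)

theorem hom_ext {E F : PreSpec.{u}} {f g : E ⟶ F} (h : ∀ n z, f.app n z = g.app n z) : f = g :=
  Hom.ext (funext fun n => PMap.ext_apply (h n))

/-- The homotopy group `π_k E` of an `Ω`-spectrum, for `k : ℤ`.  It is `π_{j + k}(E j)` for any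
`j` with `j + k ≥ 0`; we take `j = 2 - k`. -/
abbrev pi (E : PreSpec.{u}) (k : ℤ) : Type u := PiTwo (E.level (2 - k))

/-- The homomorphism induced on homotopy groups. -/
def piMap {E F : PreSpec.{u}} (f : E ⟶ F) (k : ℤ) : E.pi k →+ F.pi k := piTwoMap (f.app (2 - k))

theorem piMap_comp {E F G : PreSpec.{u}} (f : E ⟶ F) (g : F ⟶ G) (k : ℤ) (a : E.pi k) :
    piMap (f ≫ g) k a = piMap g k (piMap f k a) := piTwoMap_comp _ _ a

/-- The identification of `E m` and `E m'` for equal integers `m` and `m'`. -/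
def levelCast (E : PreSpec.{u}) {m m' : ℤ} (h : m = m') : PMap (E.level m) (E.level m') := by
  subst h
  exact PMap.id _

theorem levelCast_natural {E F : PreSpec.{u}} (f : E ⟶ F) {m m' : ℤ} (h : m = m') :
    (F.levelCast h).comp (f.app m) = (f.app m').comp (E.levelCast h) := by
  subst h
  rfl

/-- The cofibre of a map of spectra, constructed as the suspension of the homotopy fibre: its
`n`-th space is the homotopy fibre of the map of `(n + 1)`-st spaces.  It is an `Ω`-spectrum
if `E` and `F` are. -/
def cofib {E F : PreSpec.{u}} (f : E ⟶ F) : PreSpec.{u} where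
  level n := fib (f.app (n + 1))
  str n := (fibLoop (f.app (n + 1 + 1))).comp
    (fibMap (E.str (n + 1)) (F.str (n + 1)) (comm_apply f (n + 1)))

/-- The map of cofibres induced by a commutative square. -/
def cofibMap {E F E' F' : PreSpec.{u}} {f : E ⟶ F} {f' : E' ⟶ F'} (a : E ⟶ E') (b : F ⟶ F')
    (h : f ≫ b = a ≫ f') : cofib f ⟶ cofib f' where
  app n := fibMap (a.app (n + 1)) (b.app (n + 1)) (fun z =>
    congrArg (fun g : E ⟶ F' => g.app (n + 1) z) h)
  comm n := by
    refine PMap.ext_apply fun w => ?_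
    refine Path.ext ?_
    funext t
    refine Subtype.ext (Prod.ext ?_ ?_)
    · exact congrArg (fun γ => asPath γ t) (comm_apply a (n + 1) w.1.1)
    · ext s
      exact congrArg (fun γ => asPath γ t) (comm_apply b (n + 1) (w.1.2 s))

/-- The map `π_k F → π_k (cofib f)`. -/
def toCofib {E F : PreSpec.{u}} (f : E ⟶ F) (k : ℤ) : F.pi k →+ (cofib f).pi k :=
  piTwoMap ((fibIncl (f.app (2 - k + 1))).comp (F.str (2 - k)))

theorem toCofib_natural {E F E' F' : PreSpec.{u}} {f : E ⟶ F} {f' : E' ⟶ F'} (a : E ⟶ E')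
    (b : F ⟶ F') (h : f ≫ b = a ≫ f') (k : ℤ) (z : F.pi k) :
    piMap (cofibMap a b h) k (toCofib f k z) = toCofib f' k (piMap b k z) := by
  refine (piTwoMap_comp _ _ z).symm.trans (Eq.trans ?_ (piTwoMap_comp _ _ z))
  refine congrArg (fun g => piTwoMap g z) (PMap.ext_apply fun w => ?_)
  refine Subtype.ext (Prod.ext (a.app _).map_pt ?_)
  ext t
  exact congrArg (fun γ => asPath γ t) (comm_apply b (2 - k) w).symm

/-- The boundary map `π_k (cofib f) → π_{k'} E`, where `k' = k - 1`. -/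
def boundary {E F : PreSpec.{u}} (f : E ⟶ F) {k k' : ℤ} (hk : k' + 1 = k) :
    (cofib f).pi k →+ E.pi k' :=
  piTwoMap ((E.levelCast (by omega : 2 - k + 1 = 2 - k')).comp (fibProj (f.app (2 - k + 1))))

theorem boundary_natural {E F E' F' : PreSpec.{u}} {f : E ⟶ F} {f' : E' ⟶ F'} (a : E ⟶ E')
    (b : F ⟶ F') (h : f ≫ b = a ≫ f') {k k' : ℤ} (hk : k' + 1 = k) (z : (cofib f).pi k) :
    piMap a k' (boundary f hk z) = boundary f' hk (piMap (cofibMap a b h) k z) := by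
  refine (piTwoMap_comp _ _ z).symm.trans (Eq.trans ?_ (piTwoMap_comp _ _ z))
  refine congrArg (fun g => piTwoMap g z) (PMap.ext_apply fun w => ?_)
  exact (congrArg (fun g : PMap (E.level (2 - k + 1)) (E'.level (2 - k')) => g w.1.1)
    (levelCast_natural a (by omega : 2 - k + 1 = 2 - k'))).symm

/-- The homotopy limit of a tower of spectra, formed levelwise. -/
def holim (E : ℕ → PreSpec.{u}) (p : ∀ n, E (n + 1) ⟶ E n) : PreSpec.{u} where
  level m := holimSpace (fun n => (E n).level m) (fun n => (p n).app m)
  str m := (holimSpaceLoop (fun n => (E n).level (m + 1)) (fun n => (p n).app (m + 1))).comp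
    (holimSpaceMap (fun n => (E n).str m) (fun n z => comm_apply (p n) m z))

end PreSpec

open PreSpec

/-! ### Filtered spectra -/

/-- Filtered objects `⋯ → X 1 → X 0 → X (-1) → ⋯`. -/
abbrev Fil : Type (u + 1) := ℤᵒᵖ ⥤ PreSpec.{u}

namespace Fil

/-- A filtered spectrum is a diagram of `Ω`-spectra. -/
def IsSpectrum (X : Fil.{u}) : Prop := ∀ n : ℤ, (X.obj (op n)).IsOmega

/-- The transition map `X n → X m` for `m ≤ n`. -/
abbrev trans (X : Fil.{u}) {m n : ℤ} (h : m ≤ n) : X.obj (op n) ⟶ X.obj (op m) :=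
  X.map (homOfLE h).op

/-- The cofibre of a map of filtered spectra, formed pointwise. -/
def cofib {X Y : Fil.{u}} (f : X ⟶ Y) : Fil.{u} where
  obj n := PreSpec.cofib (f.app n)
  map g := cofibMap (X.map g) (Y.map g) (f.naturality g).symm
  map_id n := by
    refine hom_ext fun m w => Subtype.ext (Prod.ext ?_ ?_)
    · change (X.map (𝟙 n)).app (m + 1) w.1.1 = _
      rw [X.map_id]; rfl
    · change ((Y.map (𝟙 n)).app (m + 1)).toMap.comp w.1.2 = _
      rw [Y.map_id]; rfl
  map_comp g g' := by
    refine hom_ext fun m w => Subtype.ext (Prod.ext ?_ ?_)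
    · change (X.map (g ≫ g')).app (m + 1) w.1.1 = _
      rw [X.map_comp]; rfl
    · change ((Y.map (g ≫ g')).app (m + 1)).toMap.comp w.1.2 = _
      rw [Y.map_comp]; rfl

/-- The shifted filtered spectrum `n ↦ X (n + r)`, the source of the map `τ ^ r` to `X`. -/
def shift (X : Fil.{u}) (r : ℕ) : Fil.{u} :=
  (Monotone.functor (f := fun n : ℤ => n + r) (fun _ _ h => by simpa using h)).op ⋙ X

/-- The map `τ ^ r`, given by the transition maps `X (n + r) → X n`. -/
def tauPow (X : Fil.{u}) (r : ℕ) : shift X r ⟶ X where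
  app n := X.trans (by omega : n.unop ≤ n.unop + r)
  naturality _ _ g := by
    change X.map _ ≫ X.map _ = X.map _ ≫ X.map _
    rw [← X.map_comp, ← X.map_comp]
    rfl

/-- The filtered spectrum `X / τ ^ r`, whose `n`-th term is the cofibre of `X (n + r) → X n`. -/
def modTau (X : Fil.{u}) (r : ℕ) : Fil.{u} := cofib (tauPow X r)

/-- The projection `X / τ ^ (r + 1) → X / τ ^ r`, at filtration `n`. -/
def modTauProj (X : Fil.{u}) (r : ℕ) (n : ℤ) :
    (modTau X (r + 1)).obj (op n) ⟶ (modTau X r).obj (op n) :=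
  cofibMap (X.trans (by push_cast; omega : n + (r : ℤ) ≤ n + ((r + 1 : ℕ) : ℤ))) (𝟙 _) (by
    change X.map _ ≫ 𝟙 _ = X.map _ ≫ X.map _
    rw [← X.map_comp, Category.comp_id]
    rfl)

/-- The map `X / τ ^ r → Y / τ ^ r` induced by `f : X → Y`, at filtration `n`. -/
def modTauMap {X Y : Fil.{u}} (f : X ⟶ Y) (r : ℕ) (n : ℤ) :
    (modTau X r).obj (op n) ⟶ (modTau Y r).obj (op n) :=
  cofibMap (f.app (op (n + r))) (f.app (op n)) (f.naturality _)

/-- The bigraded homotopy groups `π_{x,y} X = π_x (X (x + y))`. -/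
abbrev bi (X : Fil.{u}) (x y : ℤ) : Type u := (X.obj (op (x + y))).pi x

/-- The map `π_{x,y} X → π_{x,y} Y` induced by `f : X → Y`. -/
def biMap {X Y : Fil.{u}} (f : X ⟶ Y) (x y : ℤ) : bi X x y →+ bi Y x y :=
  piMap (f.app (op (x + y))) x

/-- For `y' ≤ y`, multiplication by `τ ^ (y - y')`, from `π_{x,y} X` to `π_{x,y'} X`.  (The value
for `y' > y` is irrelevant.) -/
def tau (X : Fil.{u}) (x y y' : ℤ) : bi X x y →+ bi X x y' :=
  if h : y' ≤ y then piMap (X.trans (by omega : x + y' ≤ x + y)) x else 0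

theorem tau_natural {X Y : Fil.{u}} (f : X ⟶ Y) (x y y' : ℤ) (a : bi X x y) :
    biMap f x y' (tau X x y y' a) = tau Y x y y' (biMap f x y a) := by
  unfold tau
  split_ifs
  · refine (piMap_comp _ _ _ a).symm.trans (Eq.trans ?_ (piMap_comp _ _ _ a))
    exact congrArg (fun g => piMap g x a) (f.naturality _)
  · exact map_zero _

/-- `π_{x,y} (X / τ)`, which is the `E₂`-page of the `τ`-Bockstein spectral sequence. -/
abbrev gr (X : Fil.{u}) (x y : ℤ) : Type u := bi (modTau X 1) x y

/-- The map `π_{x,y} (X / τ) → π_{x,y} (Y / τ)`. -/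
def grMap {X Y : Fil.{u}} (f : X ⟶ Y) (x y : ℤ) : gr X x y →+ gr Y x y :=
  piMap (modTauMap f 1 (x + y)) x

/-- The mod `τ` projection `a ↦ [a]`, from `π_{x,y} X` to `π_{x,y} (X / τ)`. -/
def red (X : Fil.{u}) (x y : ℤ) : bi X x y →+ gr X x y :=
  toCofib ((tauPow X 1).app (op (x + y))) x

theorem red_natural {X Y : Fil.{u}} (f : X ⟶ Y) (x y : ℤ) (a : bi X x y) :
    grMap f x y (red X x y a) = red Y x y (biMap f x y a) :=
  toCofib_natural _ _ _ _ _

/-- The boundary map `δ` from `π_{x,y} (X / τ)` to `π_{x',y'} X`, with `x' = x - 1` and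
`y' = y + 2`. -/
def delta (X : Fil.{u}) {x y x' y' : ℤ} (hx : x' + 1 = x) (hy : y' = y + 2) :
    gr X x y →+ bi X x' y' :=
  (piMap (X.trans (by push_cast; omega : x' + y' ≤ x + y + ((1 : ℕ) : ℤ))) x').comp
    (boundary ((tauPow X 1).app (op (x + y))) hx)

theorem delta_natural {X Y : Fil.{u}} (f : X ⟶ Y) {x y x' y' : ℤ} (hx : x' + 1 = x)
    (hy : y' = y + 2) (a : gr X x y) :
    biMap f x' y' (delta X hx hy a) = delta Y hx hy (grMap f x y a) := by
  refine Eq.trans ?_ (congrArg (piMap (Y.trans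
    (by push_cast; omega : x' + y' ≤ x + y + ((1 : ℕ) : ℤ))) x')
    (boundary_natural (f.app (op (x + y + ((1 : ℕ) : ℤ)))) (f.app (op (x + y)))
      (f.naturality _) hx a))
  refine (piMap_comp _ _ _ _).symm.trans (Eq.trans ?_ (piMap_comp _ _ _ _))
  exact congrArg (fun g => piMap g x' _) (f.naturality _)

/-! ### Completeness and inversion of `τ` -/

/-- `X` is complete if `lim X n`, the homotopy limit for `n → ∞`, is zero.  (It is computed along
the cofinal subset of natural numbers.) -/
def IsComplete (X : Fil.{u}) : Prop :=
  ∀ k : ℤ, Subsingleton ((holim (fun n : ℕ => X.obj (op (n : ℤ)))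
    (fun n => X.trans (by push_cast; omega : (n : ℤ) ≤ ((n + 1 : ℕ) : ℤ)))).pi k)

/-- The vanishing of `lim¹` of a tower of abelian groups, i.e. of the cokernel of
`(v n) ↦ (v n - p (v (n + 1)))` on the product. -/
def LimOneVanishes (A : ℕ → Type u) [∀ n, AddCommGroup (A n)] (p : ∀ n, A (n + 1) →+ A n) :
    Prop :=
  Function.Surjective fun (v : ∀ n, A n) (n : ℕ) => v n - p n (v (n + 1))

/-- `X` is strongly complete if it is complete and `lim¹` of the groups `π_{x,y} (X / τ ^ r)`,
`r → ∞`, vanishes for all `x` and `y`. -/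
def IsStronglyComplete (X : Fil.{u}) : Prop :=
  IsComplete X ∧ ∀ x y : ℤ, LimOneVanishes (fun r : ℕ => bi (modTau X r) x y)
    (fun r => piMap (modTauProj X r (x + y)) x)

/-- The `m`-th space of `τ⁻¹ X = colim X (-n)`, `n → ∞`: the mapping telescope of the `m`-th
spaces. -/
abbrev TauInv (X : Fil.{u}) (m : ℤ) : Type u :=
  Telescope (fun n : ℕ => (X.obj (op (-(n : ℤ)))).level m)
    (fun n => (X.trans (by push_cast; omega : -((n + 1 : ℕ) : ℤ) ≤ -(n : ℤ))).app m)

/-- The map of `m`-th spaces `τ⁻¹ X → τ⁻¹ Y`. -/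
def tauInvMap {X Y : Fil.{u}} (f : X ⟶ Y) (m : ℤ) : C(TauInv X m, TauInv Y m) :=
  telescopeMap (fun n : ℕ => (f.app (op (-(n : ℤ)))).app m) (fun n z =>
    congrArg (fun g : X.obj (op (-(n : ℤ))) ⟶ Y.obj (op (-((n + 1 : ℕ) : ℤ))) => g.app m z)
      (f.naturality _))

/-- `τ⁻¹ f` is an equivalence of spectra, i.e. induces isomorphisms on all homotopy groups.
Mapping telescopes of `Ω`-spectra are `Ω`-spectra, so that `π_k (τ⁻¹ X)` is the set of path
components of the `(-k)`-th space. -/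
def TauInvEquiv {X Y : Fil.{u}} (f : X ⟶ Y) : Prop :=
  ∀ m : ℤ, Function.Bijective (pathComponentsMap (tauInvMap f m))

/-! ### The linear t-structure -/

/-- Connective objects of the linear t-structure for the line `y = α x`: the `n`-th term lies in
the connective part of the t-structure on spectra generated by the sphere of dimension
`⌈n / (α + 1)⌉`. -/
def IsConnective (α : ℝ) (X : Fil.{u}) : Prop :=
  ∀ n k : ℤ, k < ⌈(n : ℝ) / (α + 1)⌉ → Subsingleton ((X.obj (op n)).pi k)

/-- Objects of `τ_{≤ -1}` of the linear t-structure for the line `y = α x`: the `n`-th term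
receives only zero maps from spheres of dimension at least `⌈n / (α + 1)⌉`. -/
def IsCoconnective (α : ℝ) (X : Fil.{u}) : Prop :=
  ∀ n k : ℤ, ⌈(n : ℝ) / (α + 1)⌉ ≤ k → Subsingleton ((X.obj (op n)).pi k)

/-- `f : X → Y` exhibits `X` as the connective cover of `Y` in the linear t-structure for
`y = α x`: in the cofibre sequence `X → Y → C` the object `X` is connective and `C` lies in
`τ_{≤ -1}`. -/
def ExhibitsCover (α : ℝ) {X Y : Fil.{u}} (f : X ⟶ Y) : Prop :=
  IsConnective α X ∧ IsCoconnective α (cofib f)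

/-! ### The `τ`-Bockstein spectral sequence -/

/-- The cycles `Z_r`, `r ≥ 2`: classes `a` in `π_{x,y} (X / τ)` with `δ a` divisible by
`τ ^ (r - 2)`. -/
def cycles (X : Fil.{u}) (r x y : ℤ) : AddSubgroup (gr X x y) :=
  (tau X (x - 1) (y + r) (y + 2)).range.comap (delta X (sub_add_cancel x 1) rfl)

/-- The boundaries `B_r`, `r ≥ 2`: the classes `[c]` with `c` in `π_{x,y} X` and
`τ ^ (r - 2) c = 0`. -/
def boundaries (X : Fil.{u}) (r x y : ℤ) : AddSubgroup (gr X x y) :=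
  (tau X x y (y - (r - 2))).ker.map (red X x y)

/-- The group `E_r` in bidegree `(x, y)`, for `r ≥ 2`. -/
abbrev Page (X : Fil.{u}) (r x y : ℤ) : Type u :=
  cycles X r x y ⧸ (boundaries X r x y).addSubgroupOf (cycles X r x y)

theorem grMap_mem_cycles {X Y : Fil.{u}} (f : X ⟶ Y) (r x y : ℤ) {a : gr X x y}
    (ha : a ∈ cycles X r x y) : grMap f x y a ∈ cycles Y r x y := by
  obtain ⟨c, hc⟩ := ha
  exact ⟨biMap f _ _ c, by rw [← tau_natural, hc, delta_natural]⟩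

theorem grMap_mem_boundaries {X Y : Fil.{u}} (f : X ⟶ Y) (r x y : ℤ) {a : gr X x y}
    (ha : a ∈ boundaries X r x y) : grMap f x y a ∈ boundaries Y r x y := by
  obtain ⟨c, hc, rfl⟩ := ha
  refine ⟨biMap f x y c, ?_, (red_natural f x y c).symm⟩
  rw [SetLike.mem_coe, AddMonoidHom.mem_ker, ← tau_natural, AddMonoidHom.mem_ker.1 hc, map_zero]

/-- The map `E_r(X) → E_r(Y)` induced by `f : X → Y`. -/
def pageMap {X Y : Fil.{u}} (f : X ⟶ Y) (r x y : ℤ) : Page X r x y →+ Page Y r x y :=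
  QuotientAddGroup.map _ _
    (((grMap f x y).comp (cycles X r x y).subtype).codRestrict (cycles Y r x y)
      fun a => grMap_mem_cycles f r x y a.2)
    fun _ ha => grMap_mem_boundaries f r x y ha

/-- The class `a` in `π_{x,y} (X / τ)` survives to `E_r` and represents `e` there. -/
def Represents {X : Fil.{u}} {r x y : ℤ} (a : gr X x y) (e : Page X r x y) : Prop :=
  ∃ h : a ∈ cycles X r x y, (QuotientAddGroup.mk ⟨a, h⟩ : Page X r x y) = e

/-- The class `e` in `E_r` survives to `E_s` and becomes `e'` there. -/
def SurvivesTo {X : Fil.{u}} {r s x y : ℤ} (e : Page X r x y) (e' : Page X s x y) : Prop :=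
  ∃ a : gr X x y, Represents a e ∧ Represents a e'

/-- `d_r z = w`: there are a representative `a` of `z` and a class `c` with
`δ a = τ ^ (r - 2) c` such that `[c]` represents `w`.  The bidegree of `w` is that of `z` plus
`(-1, r)`. -/
def IsDiff {X : Fil.{u}} {r x y x' y' : ℤ} (z : Page X r x y) (w : Page X r x' y') : Prop :=
  ∃ (hx : x' + 1 = x) (_ : y' = y + r) (a : gr X x y) (c : bi X x' y'),
    Represents a z ∧ delta X hx rfl a = tau X x' y' (y + 2) c ∧ Represents (red X x' y' c) w

/-- `d_r z = w` is a line-crossing differential for `y = α x`. -/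
def IsLineCrossing (α : ℝ) {X : Fil.{u}} {r x y x' y' : ℤ} (z : Page X r x y)
    (w : Page X r x' y') : Prop :=
  IsDiff z w ∧ w ≠ 0 ∧ (y : ℝ) ≤ α * x ∧ α * (x - 1) < y + r

/-- The class `e` of `E_r` supports a line-crossing differential `d_s`, for some `s ≥ r`. -/
def SupportsLineCrossing (α : ℝ) {X : Fil.{u}} {r x y : ℤ} (e : Page X r x y) : Prop :=
  ∃ (s : ℤ) (e' : Page X s x y) (w : Page X s (x - 1) (y + s)),
    r ≤ s ∧ SurvivesTo e e' ∧ IsLineCrossing α e' w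

/-- The class `e` of `E_r` is a permanent cycle in the strong sense that it has a representative
in the kernel of `δ`, i.e. one that lifts to `π_{x,y} X`. -/
def IsPermanentCycle {X : Fil.{u}} {r x y : ℤ} (e : Page X r x y) : Prop :=
  ∃ a : gr X x y, Represents a e ∧ delta X (sub_add_cancel x 1) rfl a = 0

/-- The conditions on the maps of `E_r`-pages, `r ≥ 2`; here `S` is the predicate that singles out
the image in the bidegrees `(x, y)` with `y ≤ α x` and `y + r > α (x - 1)`. -/
structure PageConditions (α : ℝ) {X Y : Fil.{u}} (f : X ⟶ Y)
    (S : ∀ {r x y : ℤ}, Page Y r x y → Prop) : Prop where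
  bijective : ∀ r x y : ℤ, 2 ≤ r → (y + r : ℝ) ≤ α * (x - 1) →
    Function.Bijective (pageMap f r x y)
  image : ∀ r x y : ℤ, 2 ≤ r → α * (x - 1) < y + r → (y : ℝ) ≤ α * x →
    ∀ e : Page Y r x y, (∃ e₀ : Page X r x y, pageMap f r x y e₀ = e) ↔ S e
  injective : ∀ r x y : ℤ, 2 ≤ r → y ≠ ⌊α * x⌋ → Function.Injective (pageMap f r x y)

/-! ### Dropped lifts -/

/-- `b` in `π_{x,y} Y` drops to the line `y = α x`: it lies above the line, `[b] ≠ 0`, and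
`τ ^ l b ≠ 0`, where `l = y - ⌊α x⌋`. -/
def Drops (α : ℝ) {Y : Fil.{u}} {x y : ℤ} (b : bi Y x y) : Prop :=
  α * x < y ∧ red Y x y b ≠ 0 ∧ tau Y x y ⌊α * x⌋ b ≠ 0

/-- `b` in `π_{x,y} Y` drops to the line, and `a` in `π_{x,y₀} X`, `y₀ = ⌊α x⌋`, is a dropped lift
of `b`, i.e. a lift of `τ ^ l b` along `f`. -/
def IsDroppedLift (α : ℝ) {X Y : Fil.{u}} (f : X ⟶ Y) {x y y₀ : ℤ} (b : bi Y x y)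
    (a : bi X x y₀) : Prop :=
  Drops α b ∧ y₀ = ⌊α * x⌋ ∧ biMap f x y₀ a = tau Y x y y₀ b

/-- `r > 1` is minimal with `τ ^ (l + r - 1) b = 0`, where `l = y - ⌊α x⌋`. -/
def IsTorsionOrder (α : ℝ) {Y : Fil.{u}} {x y : ℤ} (b : bi Y x y) (r : ℤ) : Prop :=
  1 < r ∧ tau Y x y (⌊α * x⌋ - (r - 1)) b = 0 ∧
    ∀ s : ℤ, 1 < s → s < r → tau Y x y (⌊α * x⌋ - (s - 1)) b ≠ 0

/-- In the spectral sequence of `Y`, the class `z` of `E_r` survives to `E_{l + r}`, where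
`l = y - ⌊α x⌋`, and `d_{l + r} z = [b]`; if `[b]` is nonzero in `E_{l + r}`, this is a
line-crossing differential. -/
def HitsDropping (α : ℝ) {Y : Fil.{u}} {r x₁ y₁ x y : ℤ} (z : Page Y r x₁ y₁) (b : bi Y x y) :
    Prop :=
  ∃ (z' : Page Y (y - ⌊α * x⌋ + r) x₁ y₁) (w : Page Y (y - ⌊α * x⌋ + r) x y),
    SurvivesTo z z' ∧ Represents (red Y x y b) w ∧ IsDiff z' w ∧
      (w ≠ 0 → IsLineCrossing α z' w)

/-- A differential `d_r zt = v` in the spectral sequence of `X` which comes from a line-crossing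
differential in that of `Y`: there are a class `b` that drops to the line, with dropped lift `a`,
such that `r > 1` is minimal with `τ ^ (l + r - 1) b = 0`, the class `v` is represented by `[a]`,
and `d_{l + r} (f zt) = [b]` is a (nonzero) line-crossing differential. -/
def IsDroppedDiff (α : ℝ) {X Y : Fil.{u}} (f : X ⟶ Y) {r x₁ y₁ x y₀ : ℤ} (zt : Page X r x₁ y₁)
    (v : Page X r x y₀) : Prop :=
  IsDiff zt v ∧ ∃ (y : ℤ) (b : bi Y x y) (a : bi X x y₀),
    IsDroppedLift α f b a ∧ IsTorsionOrder α b r ∧ Represents (red X x y₀ a) v ∧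
    ∃ (z' : Page Y (y - ⌊α * x⌋ + r) x₁ y₁) (w : Page Y (y - ⌊α * x⌋ + r) x y),
      SurvivesTo (pageMap f r x₁ y₁ zt) z' ∧ Represents (red Y x y b) w ∧ IsLineCrossing α z' w

end Fil

end LinearT

end

open CategoryTheory LinearT LinearT.Fil

/-!
Long exact sequences turn the connectivity conditions into conditions on homotopy groups: `f`
exhibits `X` as the connective cover of `Y` exactly when `π_{x,y} X` vanishes above the line and `f`
is bijective on `π_{x,y}` on and below it. Given this, the comparison of the spectral sequences is a
chase in the long exact sequence of `τ`, `[·]` and `δ`. Injectivity can fail only on the line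
itself, because there `f a` may be divisible by `τ` without `a` being so.

Conversely, the `τ⁻¹`-equivalence shows that every `τ`-power multiple of a class `b` of `Y` that
goes far enough down lifts to `X`. If `f a = τ b` strictly below the line, then `[a] = 0` since `f`
is injective on `E_2`, so `a = τ a'`; the difference `b - f a'` is in the image of `δ`, hence lifts
as well. So `f` is surjective on and below the line. An element of its kernel is `τ`-torsion, and by
injectivity on the pages it can be divided by `τ` up to the line; the differential that kills it
lies in the region where the pages agree, so it vanishes. Above the line `X/τ` vanishes, so every
class of `X` there is infinitely divisible by `τ`, and completeness makes it zero.

If `b` drops to the line by `τ ^ l`, then `τ ^ l b = f a` for a unique `a`. A relation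
`δ z = τ ^ (r - 2) a`, that is, a differential `d_r z = [a]` of `X`, maps to
`δ (f z) = τ ^ (l + r - 2) b`, that is, to a differential `d_{l + r} (f z) = [b]` of `Y`, which
crosses the line.
-/

noncomputable section

namespace LinearT

section GenLoop

variable {N : Type*}

theorem genLoop_homotopic_iff {X : Type u} [TopologicalSpace X] {x : X} {f g : GenLoop N X x} :
    GenLoop.Homotopic f g ↔ ∃ H : C(I × (N → I), X), (∀ t, H (0, t) = f t) ∧
      (∀ t, H (1, t) = g t) ∧ ∀ s, ∀ t ∈ Cube.boundary N, H (s, t) = x := by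
  constructor
  · rintro ⟨H⟩
    exact ⟨H.toContinuousMap, H.apply_zero, H.apply_one,
      fun s t ht => (H.eq_fst s ht).trans (f.2 t ht)⟩
  · rintro ⟨H, h0, h1, hb⟩
    exact ⟨{ toContinuousMap := H
             map_zero_left := h0
             map_one_left := h1
             prop' := fun s t ht => (hb s t ht).trans (f.2 t ht).symm }⟩

/-- The image of a generalized loop under a pointed map. -/
def PMap.genLoop {P Q : PtdSpace.{u}} (f : PMap P Q) (g : GenLoop N P P.pt) : GenLoop N Q Q.pt :=
  ⟨f.toMap.comp g.1, fun t ht => by rw [ContinuousMap.comp_apply, g.2 t ht, f.map_pt]⟩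

variable {P Q : PtdSpace.{u}}

/-- The class in `π₂` of a generalized loop. -/
def PiTwo.mk (g : GenLoop (Fin 2) P P.pt) : PiTwo P :=
  Additive.ofMul (Quotient.mk (GenLoop.Homotopic.setoid (Fin 2) P.pt) g)

theorem PiTwo.mk_surjective (a : PiTwo P) : ∃ g, PiTwo.mk g = a :=
  Quotient.exists_rep (s := GenLoop.Homotopic.setoid (Fin 2) P.pt) a

theorem PiTwo.mk_eq_mk {g g' : GenLoop (Fin 2) P P.pt} :
    PiTwo.mk g = PiTwo.mk g' ↔ GenLoop.Homotopic g g' :=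
  Quotient.eq (r := GenLoop.Homotopic.setoid (Fin 2) P.pt)

theorem PiTwo.mk_eq_zero {g : GenLoop (Fin 2) P P.pt} :
    PiTwo.mk g = 0 ↔ GenLoop.Homotopic g GenLoop.const :=
  PiTwo.mk_eq_mk (g' := GenLoop.const)

theorem piTwoMap_mk (f : PMap P Q) (g : GenLoop (Fin 2) P P.pt) :
    piTwoMap f (PiTwo.mk g) = PiTwo.mk (f.genLoop g) := rfl

theorem piTwoMap_id (a : PiTwo P) : piTwoMap (PMap.id P) a = a := by
  obtain ⟨g, rfl⟩ := PiTwo.mk_surjective a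
  rfl

theorem IsWeakEquiv.homotopyMap_bijective {f : PMap P Q} (hf : IsWeakEquiv f) (n : ℕ) {x : P}
    {y : Q} (h : f.toMap x = y) : Function.Bijective (homotopyMap (Fin n) f.toMap h) := by
  subst h
  exact hf n x

theorem IsWeakEquiv.piTwoMap_bijective {f : PMap P Q} (hf : IsWeakEquiv f) :
    Function.Bijective (piTwoMap f) :=
  hf.homotopyMap_bijective 2 f.map_pt

end GenLoop

/-! ### The fibre sequence of a map of spaces -/

section Fibre

variable {P Q : PtdSpace.{u}} {Z : Type*} [TopologicalSpace Z]

/-- The map to a homotopy fibre with given components: maps `Z → fib f` correspond to pairs of a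
map `Z → P` and a homotopy `Z × I → Q` from the base point to its image. -/
def fibLift (f : PMap P Q) (g : C(Z, P)) (c : C(Z × I, Q)) (h0 : ∀ z, c (z, 0) = Q.pt)
    (h1 : ∀ z, c (z, 1) = f (g z)) : C(Z, fib f) where
  toFun z := ⟨(g z, c.curry z), h0 z, h1 z⟩
  continuous_toFun := Continuous.subtype_mk (g.continuous.prodMk c.curry.continuous) _

/-- The homotopy in the base that underlies a map to a homotopy fibre. -/
def fibTrack {f : PMap P Q} (w : C(Z, fib f)) : C(Z × I, Q) where
  toFun p := (w p.1).1.2 p.2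
  continuous_toFun := ContinuousEval.continuous_eval.comp
    (((continuous_snd.comp continuous_subtype_val).comp (w.continuous.comp continuous_fst)).prodMk
      continuous_snd)

theorem fibTrack_zero {f : PMap P Q} (w : C(Z, fib f)) (z : Z) : fibTrack w (z, 0) = Q.pt :=
  (w z).2.1

theorem fibTrack_one {f : PMap P Q} (w : C(Z, fib f)) (z : Z) :
    fibTrack w (z, 1) = f (fibProj f (w z)) :=
  (w z).2.2

theorem fib_ext {f : PMap P Q} {w w' : fib f} (proj : fibProj f w = fibProj f w')
    (track : ∀ s, w.1.2 s = w'.1.2 s) : w = w' :=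
  Subtype.ext (Prod.ext proj (ContinuousMap.ext track))

/-- The map to a loop space adjoint to a homotopy from the base point to itself. -/
def loopLift (c : C(Z × I, P)) (h0 : ∀ z, c (z, 0) = P.pt) (h1 : ∀ z, c (z, 1) = P.pt) :
    C(Z, loop P) where
  toFun z := (⟨c.curry z, h0 z, h1 z⟩ : Path P.pt P.pt)
  continuous_toFun := Path.continuous_uncurry_iff.1 c.continuous

/-- The homotopy adjoint to a map to a loop space. -/
def loopTrack (w : C(Z, loop P)) : C(Z × I, P) :=
  ⟨fun p => asPath (w p.1) p.2,
    continuous_asPath (w.continuous.comp continuous_fst) continuous_snd⟩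

theorem loopTrack_zero (w : C(Z, loop P)) (z : Z) : loopTrack w (z, 0) = P.pt :=
  (asPath (w z)).source

theorem loopTrack_one (w : C(Z, loop P)) (z : Z) : loopTrack w (z, 1) = P.pt :=
  (asPath (w z)).target

theorem loop_ext {γ γ' : loop P} (h : ∀ s, asPath γ s = asPath γ' s) : γ = γ' :=
  Path.ext (funext h)

section Concat

variable {X : Type*} [TopologicalSpace X]

/-- The concatenation of two homotopies, with time running through `[0, 1]` and then through
`[1, 2]`; it is constant outside `[0, 2]`. -/
def concat (a b : C(Z × I, X)) (h : ∀ z, a (z, 1) = b (z, 0)) : C(Z × ℝ, X) where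
  toFun p := if p.2 ≤ 1 then a (p.1, Set.projIcc 0 1 zero_le_one p.2)
    else b (p.1, Set.projIcc 0 1 zero_le_one (p.2 - 1))
  continuous_toFun := by
    refine Continuous.if_le ?_ ?_ continuous_snd continuous_const ?_
    · exact a.continuous.comp
        (continuous_fst.prodMk (continuous_projIcc.comp continuous_snd))
    · exact b.continuous.comp
        (continuous_fst.prodMk (continuous_projIcc.comp (continuous_snd.sub continuous_const)))
    · rintro ⟨z, v⟩ (rfl : v = 1)
      simp only [sub_self, Set.projIcc_left, Set.projIcc_right]
      exact h z

variable {a b : C(Z × I, X)} {h : ∀ z, a (z, 1) = b (z, 0)}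

theorem concat_coe (z : Z) (s : I) : concat a b h (z, s) = a (z, s) := by
  simp only [concat, ContinuousMap.coe_mk, if_pos s.2.2, Set.projIcc_val]

theorem concat_one_add (z : Z) (s : I) : concat a b h (z, 1 + s) = b (z, s) := by
  rcases eq_or_ne s 0 with rfl | hs
  · simpa only [Set.Icc.coe_zero, add_zero, Set.Icc.coe_one, h] using
      concat_coe (h := h) z 1
  · have hs' : ¬ (1 + (s : ℝ) ≤ 1) :=
      not_le.2 (lt_add_of_pos_right 1 (unitInterval.pos_iff_ne_zero.2 hs))
    simp only [concat, ContinuousMap.coe_mk, if_neg hs', add_sub_cancel_left, Set.projIcc_val]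

theorem concat_eq_of_forall {x : X} {z : Z} (ha : ∀ s, a (z, s) = x) (hb : ∀ s, b (z, s) = x)
    (v : ℝ) : concat a b h (z, v) = x := by
  simp only [concat, ContinuousMap.coe_mk, ha, hb, ite_self]

end Concat

variable {N : Type*} (f : PMap P Q)

theorem exists_genLoop_fibProj_eq {g : GenLoop N P P.pt}
    (h : GenLoop.Homotopic (f.genLoop g) GenLoop.const) :
    ∃ w : GenLoop N (fib f) (fib f).pt, (fibProj f).genLoop w = g := by
  obtain ⟨H, h0, h1, hb⟩ := genLoop_homotopic_iff.1 h.symm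
  exact ⟨⟨fibLift f g.1 ⟨fun p => H (p.2, p.1), by fun_prop⟩ h0 h1,
    fun t ht => fib_ext (g.2 t ht) fun s => hb s t ht⟩, rfl⟩

theorem genLoop_fibProj_homotopic_const (w : GenLoop N (fib f) (fib f).pt) :
    GenLoop.Homotopic (f.genLoop ((fibProj f).genLoop w)) GenLoop.const :=
  GenLoop.Homotopic.symm <| genLoop_homotopic_iff.2
    ⟨⟨fun p => fibTrack w.1 (p.2, p.1), by fun_prop⟩, fibTrack_zero w.1, fibTrack_one w.1,
      fun s t ht => congrArg (fun v : fib f => v.1.2 s) (w.2 t ht)⟩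

/-- A null homotopy of the component of `w` in `P` closes up the paths of `w` to loops, and
reparametrizing the resulting paths of length `1 + u` deforms `w` to these loops. -/
theorem exists_genLoop_fibIncl_homotopic {w : GenLoop N (fib f) (fib f).pt}
    (h : GenLoop.Homotopic ((fibProj f).genLoop w) GenLoop.const) :
    ∃ c, GenLoop.Homotopic ((fibIncl f).genLoop c) w := by
  obtain ⟨H, h0, h1, hb⟩ := genLoop_homotopic_iff.1 h
  let D : C((N → I) × ℝ, Q) := concat (fibTrack w.1)
    ⟨fun p => f (H (p.2, p.1)), f.continuous.comp (by fun_prop)⟩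
    fun t => (fibTrack_one w.1 t).trans (congrArg f (h0 t).symm)
  have D_coe (t : N → I) (s : I) : D (t, s) = fibTrack w.1 (t, s) := concat_coe t s
  have D_zero (t : N → I) : D (t, 0) = Q.pt := (D_coe t 0).trans (fibTrack_zero w.1 t)
  have D_one_add (t : N → I) (s : I) : D (t, 1 + s) = f (H (s, t)) := concat_one_add t s
  have D_two (t : N → I) : D (t, 1 + 1) = Q.pt :=
    (D_one_add t 1).trans ((congrArg f (h1 t)).trans f.map_pt)
  have D_boundary (t : N → I) (ht : t ∈ Cube.boundary N) (v : ℝ) : D (t, v) = Q.pt :=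
    concat_eq_of_forall (fun s => congrArg (fun v : fib f => v.1.2 s) (w.2 t ht))
      (fun s => (congrArg f (hb s t ht)).trans f.map_pt) v
  let c : GenLoop N (loop Q) (loop Q).pt :=
    ⟨loopLift ⟨fun p => D (p.1, p.2 * (1 + 1)), by fun_prop⟩
      (fun t => by simpa using D_zero t)
      (fun t => by simpa only [ContinuousMap.coe_mk, Set.Icc.coe_one, one_mul] using D_two t),
      fun t ht => loop_ext fun s => D_boundary t ht _⟩
  refine ⟨c, GenLoop.Homotopic.symm <| genLoop_homotopic_iff.2
    ⟨fibLift f H ⟨fun p => D (p.1.2, p.2 * (1 + p.1.1)), by fun_prop⟩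
      (fun p => by simpa using D_zero p.2) (fun p => by simpa using D_one_add p.2 p.1),
      fun t => fib_ext (h0 t) fun s => Eq.trans (congrArg D ?_) (D_coe t s),
      fun t => fib_ext (h1 t) fun s => rfl,
      fun u t ht => fib_ext (hb u t ht) fun s => D_boundary t ht _⟩⟩
  simp

/-- The two sides of the square swept out by a null homotopy in the fibre are compared through its
diagonal. -/
theorem exists_genLoop_loopMap_homotopic {c : GenLoop N (loop Q) (loop Q).pt}
    (h : GenLoop.Homotopic ((fibIncl f).genLoop c) GenLoop.const) :
    ∃ a, GenLoop.Homotopic ((loopMap f).genLoop a) c := by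
  obtain ⟨W, W0, W1, hb⟩ := genLoop_homotopic_iff.1 h.symm
  let C : C((I × (N → I)) × I, Q) := fibTrack W
  have C_bot (u : I) (t : N → I) : C ((u, t), 0) = Q.pt := fibTrack_zero W (u, t)
  have C_top (u : I) (t : N → I) : C ((u, t), 1) = f (fibProj f (W (u, t))) :=
    fibTrack_one W (u, t)
  have C_right (t : N → I) (s : I) : C ((1, t), s) = asPath (c t) s :=
    congrArg (fun v : fib f => v.1.2 s) (W1 t)
  have C_corner (t : N → I) : C ((1, t), 1) = Q.pt := (C_right t 1).trans (asPath (c t)).target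
  have C_boundary (u : I) (t : N → I) (ht : t ∈ Cube.boundary N) (s : I) :
      C ((u, t), s) = Q.pt := congrArg (fun v : fib f => v.1.2 s) (hb u t ht)
  let a : GenLoop N (loop P) (loop P).pt :=
    ⟨loopLift ⟨fun p => fibProj f (W (p.2, p.1)), (fibProj f).continuous.comp (by fun_prop)⟩
      (fun t => congrArg (fibProj f) (W0 t)) (fun t => congrArg (fibProj f) (W1 t)),
      fun t ht => loop_ext fun s => congrArg (fibProj f) (hb s t ht)⟩
  let diagonal : GenLoop N (loop Q) (loop Q).pt :=
    ⟨loopLift ⟨fun p => C ((p.2, p.1), p.2), by fun_prop⟩ (C_bot 0) C_corner,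
      fun t ht => loop_ext fun s => C_boundary s t ht s⟩
  have right : GenLoop.Homotopic diagonal c := genLoop_homotopic_iff.2
    ⟨loopLift ⟨fun p => C ((max p.1.1 p.2, p.1.2), p.2), by fun_prop⟩ (fun p => C_bot _ _)
      (fun p => (congrArg (fun v => C ((v, p.2), 1)) (max_eq_right p.1.2.2)).trans (C_corner p.2)),
      fun t => loop_ext fun s => congrArg (fun v => C ((v, t), s)) (max_eq_right s.2.1),
      fun t => loop_ext fun s =>
        (congrArg (fun v => C ((v, t), s)) (max_eq_left s.2.2)).trans (C_right t s),
      fun u t ht => loop_ext fun s => C_boundary _ t ht s⟩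
  have top : GenLoop.Homotopic diagonal ((loopMap f).genLoop a) := genLoop_homotopic_iff.2
    ⟨loopLift ⟨fun p => C ((p.2, p.1.2), max p.1.1 p.2), by fun_prop⟩
      (fun p => congrArg (fun v : fib f => v.1.2 _) (W0 p.2))
      (fun p => (congrArg (fun v => C ((1, p.2), v)) (max_eq_right p.1.2.2)).trans (C_corner p.2)),
      fun t => loop_ext fun s => congrArg (fun v => C ((s, t), v)) (max_eq_right s.2.1),
      fun t => loop_ext fun s =>
        (congrArg (fun v => C ((s, t), v)) (max_eq_left s.2.2)).trans (C_top s t),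
      fun u t ht => loop_ext fun s => C_boundary s t ht _⟩
  exact ⟨a, top.symm.trans right⟩

theorem genLoop_fibIncl_loopMap_homotopic_const (a : GenLoop N (loop P) (loop P).pt) :
    GenLoop.Homotopic ((fibIncl f).genLoop ((loopMap f).genLoop a)) GenLoop.const := by
  have a_boundary (t : N → I) (ht : t ∈ Cube.boundary N) (s : I) :
      loopTrack a.1 (t, s) = P.pt := congrArg (fun γ : loop P => asPath γ s) (a.2 t ht)
  have a_zero (t : N → I) : f (loopTrack a.1 (t, 0)) = Q.pt :=
    (congrArg f (loopTrack_zero a.1 t)).trans f.map_pt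
  exact GenLoop.Homotopic.symm <| genLoop_homotopic_iff.2
    ⟨fibLift f ⟨fun p => loopTrack a.1 (p.2, p.1), by fun_prop⟩
      ⟨fun p => f (loopTrack a.1 (p.1.2, p.1.1 * p.2)), f.continuous.comp (by fun_prop)⟩
      (fun p => by simpa using a_zero p.2) (fun p => by simp),
      fun t => fib_ext (loopTrack_zero a.1 t) fun s =>
        (congrArg (fun v => f (loopTrack a.1 (t, v))) (zero_mul s)).trans (a_zero t),
      fun t => fib_ext (loopTrack_one a.1 t) fun s =>
        congrArg (fun v => f (loopTrack a.1 (t, v))) (one_mul s),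
      fun u t ht => fib_ext (a_boundary t ht u)
        fun s => (congrArg f (a_boundary t ht _)).trans f.map_pt⟩

theorem piTwoMap_eq_zero_iff_exists_fibProj (a : PiTwo P) :
    piTwoMap f a = 0 ↔ ∃ w, piTwoMap (fibProj f) w = a := by
  constructor
  · obtain ⟨g, rfl⟩ := PiTwo.mk_surjective a
    intro h
    obtain ⟨w, rfl⟩ := exists_genLoop_fibProj_eq f (PiTwo.mk_eq_zero.1 h)
    exact ⟨PiTwo.mk w, rfl⟩
  · rintro ⟨w, rfl⟩
    obtain ⟨w, rfl⟩ := PiTwo.mk_surjective w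
    exact PiTwo.mk_eq_zero.2 (genLoop_fibProj_homotopic_const f w)

theorem piTwoMap_fibProj_eq_zero_iff_exists_fibIncl (w : PiTwo (fib f)) :
    piTwoMap (fibProj f) w = 0 ↔ ∃ c, piTwoMap (fibIncl f) c = w := by
  constructor
  · obtain ⟨w, rfl⟩ := PiTwo.mk_surjective w
    intro h
    obtain ⟨c, hc⟩ := exists_genLoop_fibIncl_homotopic f (PiTwo.mk_eq_zero.1 h)
    exact ⟨PiTwo.mk c, PiTwo.mk_eq_mk.2 hc⟩
  · rintro ⟨c, rfl⟩
    obtain ⟨c, rfl⟩ := PiTwo.mk_surjective c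
    exact congrArg PiTwo.mk (GenLoop.ext _ _ fun _ => rfl)

theorem piTwoMap_fibIncl_eq_zero_iff_exists_loopMap (c : PiTwo (loop Q)) :
    piTwoMap (fibIncl f) c = 0 ↔ ∃ a, piTwoMap (loopMap f) a = c := by
  constructor
  · obtain ⟨c, rfl⟩ := PiTwo.mk_surjective c
    intro h
    obtain ⟨a, ha⟩ := exists_genLoop_loopMap_homotopic f (PiTwo.mk_eq_zero.1 h)
    exact ⟨PiTwo.mk a, PiTwo.mk_eq_mk.2 ha⟩
  · rintro ⟨a, rfl⟩
    obtain ⟨a, rfl⟩ := PiTwo.mk_surjective a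
    exact PiTwo.mk_eq_zero.2 (genLoop_fibIncl_loopMap_homotopic_const f a)

end Fibre

/-! ### The long exact sequence of a cofibre -/

namespace PreSpec

theorem piMap_id (E : PreSpec.{u}) (k : ℤ) (a : E.pi k) : piMap (𝟙 E) k a = a :=
  piTwoMap_id a

theorem piTwoMap_levelCast_bijective (E : PreSpec.{u}) {m m' : ℤ} (h : m = m') :
    Function.Bijective (piTwoMap (E.levelCast h)) := by
  subst h
  refine ⟨fun a b hab => ?_, fun a => ⟨a, piTwoMap_id a⟩⟩
  rwa [show E.levelCast rfl = PMap.id _ from rfl, piTwoMap_id, piTwoMap_id] at hab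

theorem toCofib_eq_zero_iff {E F : PreSpec.{u}} (f : E ⟶ F) (hE : E.IsOmega) (hF : F.IsOmega)
    (k : ℤ) (z : F.pi k) : toCofib f k z = 0 ↔ ∃ a, piMap f k a = z := by
  have h0 : toCofib f k z = piTwoMap (fibIncl (f.app (2 - k + 1))) (piTwoMap (F.str (2 - k)) z) :=
    piTwoMap_comp _ _ z
  rw [h0]
  refine (piTwoMap_fibIncl_eq_zero_iff_exists_loopMap _ _).trans ?_
  have key : ∀ a : E.pi k, piTwoMap (F.str (2 - k)) (piMap f k a) =
      piTwoMap (loopMap (f.app (2 - k + 1))) (piTwoMap (E.str (2 - k)) a) := fun a => by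
    rw [piMap, ← piTwoMap_comp, f.comm, piTwoMap_comp]
  constructor
  · rintro ⟨c, hc⟩
    obtain ⟨a, rfl⟩ := (hE (2 - k)).piTwoMap_bijective.2 c
    exact ⟨a, (hF (2 - k)).piTwoMap_bijective.1 ((key a).trans hc)⟩
  · rintro ⟨a, rfl⟩
    exact ⟨_, (key a).symm⟩

theorem boundary_eq_zero_iff {E F : PreSpec.{u}} (f : E ⟶ F) (hF : F.IsOmega) {k k' : ℤ}
    (hk : k' + 1 = k) (w : (cofib f).pi k) : boundary f hk w = 0 ↔ ∃ z, toCofib f k z = w := by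
  have h : 2 - k + 1 = 2 - k' := by omega
  have h0 : boundary f hk w =
      piTwoMap (E.levelCast h) (piTwoMap (fibProj (f.app (2 - k + 1))) w) := piTwoMap_comp _ _ w
  rw [h0, map_eq_zero_iff _ (piTwoMap_levelCast_bijective E _).1]
  refine (piTwoMap_fibProj_eq_zero_iff_exists_fibIncl (f.app (2 - k + 1)) w).trans ?_
  constructor
  · rintro ⟨c, hc⟩
    obtain ⟨z, rfl⟩ := (hF (2 - k)).piTwoMap_bijective.2 c
    exact ⟨z, (piTwoMap_comp _ _ _).trans hc⟩
  · rintro ⟨z, hz⟩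
    exact ⟨_, (piTwoMap_comp _ _ _).symm.trans hz⟩

theorem piMap_eq_zero_iff {E F : PreSpec.{u}} (f : E ⟶ F) {k k' : ℤ} (hk : k' + 1 = k)
    (a : E.pi k') : piMap f k' a = 0 ↔ ∃ w : (cofib f).pi k, boundary f hk w = a := by
  have h : 2 - k + 1 = 2 - k' := by omega
  obtain ⟨a, rfl⟩ := (piTwoMap_levelCast_bijective E h).2 a
  have key : piMap f k' (piTwoMap (E.levelCast h) a) =
      piTwoMap (F.levelCast h) (piTwoMap (f.app (2 - k + 1)) a) := by
    rw [piMap, ← piTwoMap_comp, ← levelCast_natural, piTwoMap_comp]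
  rw [key, map_eq_zero_iff _ (piTwoMap_levelCast_bijective F h).1,
    piTwoMap_eq_zero_iff_exists_fibProj]
  constructor
  · rintro ⟨w, rfl⟩
    exact ⟨w, piTwoMap_comp _ _ w⟩
  · rintro ⟨w, hw⟩
    exact ⟨w, (piTwoMap_levelCast_bijective E h).1 ((piTwoMap_comp _ _ w).symm.trans hw)⟩

end PreSpec

/-! ### Path components of mapping telescopes -/

section Joined

variable {X : Type*} [TopologicalSpace X]

theorem zerothHomotopy_mk_eq {x y : X} :
    Quotient.mk (pathSetoid X) x = Quotient.mk (pathSetoid X) y ↔ Joined x y := Quotient.eq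

theorem of_joined_of_forall_joinedIn {S : X → Prop}
    (hS : ∀ x, ∃ U, IsOpen U ∧ x ∈ U ∧ ∀ y z, JoinedIn U y z → S y → S z) {x y : X}
    (h : Joined x y) : S x → S y := by
  obtain ⟨γ⟩ := h
  have : LocallyPathConnectedSpace I := (convex_Icc (0 : ℝ) 1).locallyPathConnectedSpace
  have locallyConstant : IsLocallyConstant fun s : I => S (γ s) := by
    refine (IsLocallyConstant.iff_eventually_eq _).2 fun s₀ => ?_
    obtain ⟨U, hU, hs₀, hSU⟩ := hS (γ s₀)
    obtain ⟨W, ⟨hW, hWc⟩, hWU⟩ := (path_connected_basis s₀).mem_iff.1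
      ((hU.preimage γ.continuous).mem_nhds hs₀)
    filter_upwards [hW] with s hs
    have hj : JoinedIn U (γ s₀) (γ s) :=
      ((hWc.joinedIn s₀ (mem_of_mem_nhds hW) s hs).map γ.continuous).mono
        (Set.image_subset_iff.2 hWU)
    exact propext ⟨hSU _ _ hj.symm, hSU _ _ hj⟩
  simpa only [γ.source, γ.target, eq_iff_iff] using
    (locallyConstant.apply_eq_of_preconnectedSpace 0 1).mp

end Joined

section Telescope

variable {P : ℕ → PtdSpace.{u}} {p : ∀ n, PMap (P n) (P (n + 1))}

/-- The composite `P n → P N` of the maps of a sequence. -/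
def telIter (p : ∀ n, PMap (P n) (P (n + 1))) {n N : ℕ} (h : n ≤ N) (z : P n) : P N :=
  Nat.leRecOn (C := fun n => P n) h (fun {k} z => p k z) z

theorem telIter_self {n : ℕ} (z : P n) : telIter p le_rfl z = z :=
  Nat.leRecOn_self (C := fun n => (P n).carrier) z

theorem telIter_succ {n N : ℕ} (h : n ≤ N) (z : P n) :
    telIter p (Nat.le_succ_of_le h) z = p N (telIter p h z) :=
  Nat.leRecOn_succ (C := fun n => (P n).carrier) h z

theorem telIter_trans {n N M : ℕ} (h : n ≤ N) (h' : N ≤ M) (z : P n) :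
    telIter p h' (telIter p h z) = telIter p (h.trans h') z :=
  (Nat.leRecOn_trans (C := fun n => (P n).carrier) h h' z).symm

theorem telIter_map {n N : ℕ} (h : n + 1 ≤ N) (z : P n) :
    telIter p h (p n z) = telIter p (Nat.le_of_succ_le h) z := by
  rw [← telIter_trans (Nat.le_succ n) h, telIter_succ le_rfl, telIter_self]

theorem continuous_telIter {n N : ℕ} (h : n ≤ N) : Continuous (telIter p h) := by
  induction N, h using Nat.le_induction with
  | base => exact continuous_id.congr fun z => (telIter_self z).symm
  | succ N h ih => exact ((p N).continuous.comp ih).congr fun z => (telIter_succ h z).symm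

/-- The class of a point in the mapping telescope. -/
def telMk (p : ∀ n, PMap (P n) (P (n + 1))) (n : ℕ) (z : P n) (t : I) : Telescope P p :=
  Quot.mk _ ⟨n, z, t⟩

theorem continuous_telMk (n : ℕ) : Continuous fun w : P n × I => telMk p n w.1 w.2 :=
  continuous_quot_mk.comp (@continuous_sigmaMk ℕ (fun n => (P n).carrier × I) _ n)

theorem telMk_one (n : ℕ) (z : P n) : telMk p n z 1 = telMk p (n + 1) (p n z) 0 :=
  Quot.sound (TelRel.glue n z)

theorem joined_telMk_zero (n : ℕ) (z : P n) (t : I) :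
    Joined (telMk p n z 0) (telMk p n z t) :=
  ⟨{ toFun := fun s => telMk p n z (s * t)
     continuous_toFun := (continuous_telMk n).comp
      (by fun_prop : Continuous fun s : I => (z, s * t))
     source' := by simp
     target' := by simp }⟩

theorem joined_telMk {n : ℕ} {z z' : P n} (h : Joined z z') :
    Joined (telMk p n z 0) (telMk p n z' 0) :=
  h.map ((continuous_telMk n).comp (by fun_prop : Continuous fun z : P n => (z, (0 : I))))

theorem joined_telIter {n N : ℕ} (h : n ≤ N) (z : P n) :
    Joined (telMk p n z 0) (telMk p N (telIter p h z) 0) := by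
  induction N, h using Nat.le_induction with
  | base => rw [telIter_self]
  | succ N h ih =>
    refine ih.trans ?_
    rw [telIter_succ h, ← telMk_one]
    exact joined_telMk_zero _ _ _

open Classical in
/-- The retraction of a neighbourhood of the image of `P n` in the telescope to `P n`, extended
by the base point. -/
def telRetract (p : ∀ n, PMap (P n) (P (n + 1))) (n : ℕ) : Telescope P p → P n :=
  Quot.lift (fun w : Σ k, P k × I =>
    if h : w.1 = n then (if w.2.2 = 1 then (P n).pt else h ▸ w.2.1)
    else if h : w.1 + 1 = n then (if w.2.2 = 0 then (P n).pt else h ▸ p w.1 w.2.1)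
    else (P n).pt) (by
    rintro _ _ ⟨k, z⟩
    by_cases h : k + 1 = n
    · subst h
      simp
    · by_cases h1 : k = n
      · subst h1
        simp
      · simp [h, h1])

/-- The neighbourhood of the image of `P n` in the telescope on which the retraction to `P n`
is continuous. -/
def telNhd (p : ∀ n, PMap (P n) (P (n + 1))) (n : ℕ) : Set (Telescope P p) :=
  {q | Quot.lift (fun w : Σ k, P k × I => (w.1 = n ∧ w.2.2 ≠ 1) ∨ (w.1 + 1 = n ∧ w.2.2 ≠ 0)) (by
    rintro _ _ ⟨k, z⟩
    refine propext ?_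
    by_cases h : k + 1 = n <;> simp [h]) q}

theorem telMk_mem_telNhd {n k : ℕ} {z : P k} {t : I} :
    telMk p k z t ∈ telNhd p n ↔ (k = n ∧ t ≠ 1) ∨ (k + 1 = n ∧ t ≠ 0) := Iff.rfl

theorem telRetract_telMk_self {n : ℕ} {z : P n} {t : I} (ht : t ≠ 1) :
    telRetract p n (telMk p n z t) = z := by
  simp [telRetract, telMk, ht]

theorem telRetract_telMk_succ {n : ℕ} {z : P n} {t : I} (ht : t ≠ 0) :
    telRetract p (n + 1) (telMk p n z t) = p n z := by
  simp [telRetract, telMk, ht]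

theorem isOpen_telescope_iff {U : Set (Telescope P p)} :
    IsOpen U ↔ ∀ k, IsOpen {w : P k × I | telMk p k w.1 w.2 ∈ U} :=
  isOpen_coinduced.trans isOpen_sigma_iff

theorem isOpen_telNhd_inter (n : ℕ) {V : Set (P n)} (hV : IsOpen V) :
    IsOpen (telNhd p n ∩ telRetract p n ⁻¹' V) := by
  rw [isOpen_telescope_iff]
  intro k
  by_cases h : k = n
  · subst h
    have : {w : P k × I | telMk p k w.1 w.2 ∈ telNhd p k ∩ telRetract p k ⁻¹' V} =
        V ×ˢ ({1}ᶜ : Set I) := by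
      ext ⟨z, t⟩
      by_cases ht : t = 1
      · simp [telMk_mem_telNhd, ht]
      · simp [telMk_mem_telNhd, ht, telRetract_telMk_self]
    rw [this]
    exact hV.prod isOpen_compl_singleton
  · by_cases h' : k + 1 = n
    · subst h'
      have : {w : P k × I | telMk p k w.1 w.2 ∈ telNhd p (k + 1) ∩ telRetract p (k + 1) ⁻¹' V} =
          (p k ⁻¹' V) ×ˢ ({0}ᶜ : Set I) := by
        ext ⟨z, t⟩
        by_cases ht : t = 0
        · simp [telMk_mem_telNhd, ht]
        · simp [telMk_mem_telNhd, ht, telRetract_telMk_succ]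
      rw [this]
      exact (hV.preimage (p k).continuous).prod isOpen_compl_singleton
    · simp [telMk_mem_telNhd, h, h']

theorem isOpen_telNhd (n : ℕ) : IsOpen (telNhd p n) := by
  simpa using isOpen_telNhd_inter (p := p) n isOpen_univ

theorem continuousOn_telRetract (n : ℕ) : ContinuousOn (telRetract p n) (telNhd p n) :=
  (continuousOn_open_iff (isOpen_telNhd n)).2 fun _ hV => isOpen_telNhd_inter n hV

theorem exists_mem_telNhd (q : Telescope P p) : ∃ n, q ∈ telNhd p n := by
  obtain ⟨⟨k, z, t⟩, rfl⟩ := Quot.exists_rep q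
  by_cases ht : t = 1
  · exact ⟨k + 1, Or.inr ⟨rfl, by simp [ht]⟩⟩
  · exact ⟨k, Or.inl ⟨rfl, ht⟩⟩

/-- A point of the telescope becomes joined to a given point `z'` of `P m` after passing to a
later stage. -/
def TelJoined (p : ∀ n, PMap (P n) (P (n + 1))) (m : ℕ) (z' : P m) : Telescope P p → Prop :=
  Quot.lift (fun w : Σ k, P k × I => ∃ (N : ℕ) (h : w.1 ≤ N) (h' : m ≤ N),
    Joined (telIter p h w.2.1) (telIter p h' z')) (by
    rintro _ _ ⟨k, z⟩
    refine propext ⟨?_, ?_⟩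
    · rintro ⟨N, h, h', H⟩
      refine ⟨N + 1, Nat.succ_le_succ h, Nat.le_succ_of_le h', ?_⟩
      rw [telIter_map, telIter_succ h, telIter_succ h']
      exact H.map (p N).continuous
    · rintro ⟨N, h, h', H⟩
      refine ⟨N, Nat.le_of_succ_le h, h', ?_⟩
      rwa [telIter_map] at H)

theorem TelJoined.of_joined {m : ℕ} {z' : P m} {n : ℕ} {z₁ z₂ : P n} {t₁ t₂ : I}
    (h : Joined z₁ z₂) (H : TelJoined p m z' (telMk p n z₁ t₁)) :
    TelJoined p m z' (telMk p n z₂ t₂) := by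
  obtain ⟨N, h₁, h₂, H⟩ := H
  exact ⟨N, h₁, h₂, (h.symm.map (continuous_telIter h₁)).trans H⟩

theorem telJoined_retract {m : ℕ} {z' : P m} {n : ℕ} {q : Telescope P p} (hq : q ∈ telNhd p n) :
    TelJoined p m z' q ↔ TelJoined p m z' (telMk p n (telRetract p n q) 0) := by
  obtain ⟨⟨k, z, t⟩, rfl⟩ := Quot.exists_rep q
  change telMk p k z t ∈ _ at hq
  change TelJoined p m z' (telMk p k z t) ↔
    TelJoined p m z' (telMk p n (telRetract p n (telMk p k z t)) 0)
  obtain ⟨rfl, ht⟩ | ⟨rfl, ht⟩ := telMk_mem_telNhd.1 hq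
  · rw [telRetract_telMk_self ht]
    exact ⟨TelJoined.of_joined (Joined.refl _), TelJoined.of_joined (Joined.refl _)⟩
  · rw [telRetract_telMk_succ ht, ← telMk_one]
    exact ⟨TelJoined.of_joined (Joined.refl _), TelJoined.of_joined (Joined.refl _)⟩

theorem TelJoined.of_joinedIn_telNhd {m : ℕ} {z' : P m} {n : ℕ} {q q' : Telescope P p}
    (h : JoinedIn (telNhd p n) q q') (H : TelJoined p m z' q) : TelJoined p m z' q' :=
  (telJoined_retract h.target_mem).2 <| TelJoined.of_joined
    (h.map_continuousOn (continuousOn_telRetract n)).joined ((telJoined_retract h.source_mem).1 H)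

theorem TelJoined.of_joined_telescope {m : ℕ} {z' : P m} {q q' : Telescope P p}
    (h : Joined q q') (H : TelJoined p m z' q) : TelJoined p m z' q' :=
  of_joined_of_forall_joinedIn (fun q => (exists_mem_telNhd q).elim fun n hn =>
    ⟨telNhd p n, isOpen_telNhd n, hn, fun _ _ => TelJoined.of_joinedIn_telNhd⟩) h H

theorem exists_joined_of_joined_telMk {n m : ℕ} {z : P n} {z' : P m}
    (h : Joined (telMk p n z 0) (telMk p m z' 0)) :
    ∃ (N : ℕ) (h : n ≤ N) (h' : m ≤ N), Joined (telIter p h z) (telIter p h' z') :=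
  TelJoined.of_joined_telescope (z' := z') h.symm ⟨m, le_rfl, le_rfl, Joined.refl _⟩

variable {Q : ℕ → PtdSpace.{u}} {q : ∀ n, PMap (Q n) (Q (n + 1))} (a : ∀ n, PMap (P n) (Q n))

theorem telIter_natural (h : ∀ n z, a (n + 1) (p n z) = q n (a n z)) {n N : ℕ} (hn : n ≤ N)
    (z : P n) : a N (telIter p hn z) = telIter q hn (a n z) := by
  induction N, hn using Nat.le_induction with
  | base => rw [telIter_self, telIter_self]
  | succ N hn ih => rw [telIter_succ hn, telIter_succ hn, h, ih]

theorem surjective_pathComponentsMap_iff (h : ∀ n z, a (n + 1) (p n z) = q n (a n z)) :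
    Function.Surjective (pathComponentsMap (telescopeMap a h)) ↔
      ∀ n (z : Q n), ∃ (N : ℕ) (hn : n ≤ N) (x : P N), Joined (a N x) (telIter q hn z) := by
  constructor
  · intro hs n z
    obtain ⟨e, he⟩ := hs (Quotient.mk _ (telMk q n z 0))
    obtain ⟨w, rfl⟩ := Quotient.exists_rep e
    obtain ⟨⟨k, x, t⟩, rfl⟩ := Quot.exists_rep w
    have hj : Joined (telMk q k (a k x) t) (telMk q n z 0) := zerothHomotopy_mk_eq.1 he
    obtain ⟨N, h₁, h₂, H⟩ := exists_joined_of_joined_telMk ((joined_telMk_zero _ _ t).trans hj)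
    refine ⟨N, h₂, telIter p h₁ x, ?_⟩
    rwa [telIter_natural a h]
  · intro hs e
    obtain ⟨w, rfl⟩ := Quotient.exists_rep e
    obtain ⟨⟨k, z, t⟩, rfl⟩ := Quot.exists_rep w
    obtain ⟨N, hn, x, hx⟩ := hs k z
    refine ⟨Quotient.mk _ (telMk p N x 0), zerothHomotopy_mk_eq.2 ?_⟩
    change Joined (telMk q N (a N x) 0) (telMk q k z t)
    exact (joined_telMk hx).trans ((joined_telIter hn z).symm.trans (joined_telMk_zero k z t))

theorem injective_pathComponentsMap_iff (h : ∀ n z, a (n + 1) (p n z) = q n (a n z)) :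
    Function.Injective (pathComponentsMap (telescopeMap a h)) ↔
      ∀ n (x x' : P n), Joined (a n x) (a n x') →
        ∃ (N : ℕ) (hn : n ≤ N), Joined (telIter p hn x) (telIter p hn x') := by
  constructor
  · intro hi n x x' hj
    have : Quotient.mk (pathSetoid _) (telMk p n x 0) = Quotient.mk _ (telMk p n x' 0) :=
      hi (zerothHomotopy_mk_eq.2 (joined_telMk hj))
    obtain ⟨N, hN, _, H⟩ := exists_joined_of_joined_telMk (zerothHomotopy_mk_eq.1 this)
    exact ⟨N, hN, H⟩
  · intro hi e e' he
    obtain ⟨w, rfl⟩ := Quotient.exists_rep e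
    obtain ⟨w', rfl⟩ := Quotient.exists_rep e'
    obtain ⟨⟨k, x, t⟩, rfl⟩ := Quot.exists_rep w
    obtain ⟨⟨k', x', t'⟩, rfl⟩ := Quot.exists_rep w'
    have hj : Joined (telMk q k (a k x) t) (telMk q k' (a k' x') t') := zerothHomotopy_mk_eq.1 he
    obtain ⟨N, h₁, h₂, H⟩ := exists_joined_of_joined_telMk
      ((joined_telMk_zero _ _ t).trans (hj.trans (joined_telMk_zero _ _ t').symm))
    rw [← telIter_natural a h, ← telIter_natural a h] at H
    obtain ⟨M, hM, H⟩ := hi N _ _ H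
    refine zerothHomotopy_mk_eq.2 ?_
    change Joined (telMk p k x t) (telMk p k' x' t')
    refine (joined_telMk_zero k x t).symm.trans (Joined.trans ?_ (joined_telMk_zero k' x' t'))
    exact (joined_telIter h₁ x).trans ((joined_telIter hM _).trans ((joined_telMk H).trans
      ((joined_telIter hM _).symm.trans (joined_telIter h₂ x').symm)))

end Telescope

/-! ### Path components and homotopy groups of `Ω`-spectra -/

theorem tail_mem_boundary {n : ℕ} {t : Fin (n + 1) → I}
    (ht : t ∈ Cube.boundary (Fin (n + 1))) :
    (t 0 = 0 ∨ t 0 = 1) ∨ (fun i : Fin n => t i.succ) ∈ Cube.boundary (Fin n) := by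
  obtain ⟨i, hi⟩ := ht
  refine Fin.cases (fun h => Or.inl h) (fun j h => Or.inr ⟨j, h⟩) i hi

theorem cons_mem_boundary {n : ℕ} {t : Fin n → I} (s : I) (ht : t ∈ Cube.boundary (Fin n)) :
    (Fin.cons s t : Fin (n + 1) → I) ∈ Cube.boundary (Fin (n + 1)) := by
  obtain ⟨i, hi⟩ := ht
  exact ⟨i.succ, by simpa using hi⟩

section LoopShift

variable {P : PtdSpace.{u}} {n : ℕ}

/-- A generalized loop of a loop space as a generalized loop of one dimension more, with the loop
coordinate as its first coordinate. -/
def uncurryLoop (g : GenLoop (Fin n) (loop P) (loop P).pt) : GenLoop (Fin (n + 1)) P P.pt :=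
  ⟨⟨fun t => loopTrack g.1 (fun i => t i.succ, t 0), by fun_prop⟩, fun t ht => by
    obtain (h | h) | h := tail_mem_boundary ht
    · exact (congrArg (fun s => loopTrack g.1 (_, s)) h).trans (loopTrack_zero g.1 _)
    · exact (congrArg (fun s => loopTrack g.1 (_, s)) h).trans (loopTrack_one g.1 _)
    · exact congrArg (fun γ => asPath γ (t 0)) (g.2 _ h)⟩

theorem uncurryLoop_surjective :
    Function.Surjective (uncurryLoop : GenLoop (Fin n) (loop P) (loop P).pt → _) := fun g =>
  ⟨⟨loopLift ⟨fun p => g.1 (Fin.cons p.2 p.1), g.1.continuous.comp (by fun_prop)⟩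
      (fun _ => g.2 _ ⟨0, Or.inl rfl⟩) (fun _ => g.2 _ ⟨0, Or.inr rfl⟩),
    fun _ ht => loop_ext fun s => g.2 _ (cons_mem_boundary s ht)⟩,
    GenLoop.ext _ _ fun t => congrArg g (Fin.cons_self_tail t)⟩

theorem uncurryLoop_homotopic_iff {g g' : GenLoop (Fin n) (loop P) (loop P).pt} :
    GenLoop.Homotopic (uncurryLoop g) (uncurryLoop g') ↔ GenLoop.Homotopic g g' := by
  simp only [genLoop_homotopic_iff]
  constructor
  · rintro ⟨H, h0, h1, hb⟩
    exact ⟨loopLift ⟨fun p => H (p.1.1, Fin.cons p.2 p.1.2), H.continuous.comp (by fun_prop)⟩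
        (fun p => hb p.1 _ ⟨0, Or.inl rfl⟩) (fun p => hb p.1 _ ⟨0, Or.inr rfl⟩),
      fun t => loop_ext fun s => h0 (Fin.cons s t), fun t => loop_ext fun s => h1 (Fin.cons s t),
      fun u t ht => loop_ext fun s => hb u _ (cons_mem_boundary s ht)⟩
  · rintro ⟨H, h0, h1, hb⟩
    refine ⟨⟨fun p => loopTrack H ((p.1, fun i => p.2 i.succ), p.2 0), by fun_prop⟩,
      fun t => congrArg (fun γ => asPath γ (t 0)) (h0 _),
      fun t => congrArg (fun γ => asPath γ (t 0)) (h1 _), fun u t ht => ?_⟩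
    obtain (h | h) | h := tail_mem_boundary ht
    · exact (congrArg (fun s => loopTrack H (_, s)) h).trans (loopTrack_zero H _)
    · exact (congrArg (fun s => loopTrack H (_, s)) h).trans (loopTrack_one H _)
    · exact congrArg (fun γ => asPath γ (t 0)) (hb u _ h)

variable (P n)

/-- The identification of `π_n (Ω P)` and `π_{n + 1} P`. -/
def loopShift :
    HomotopyGroup (Fin n) (loop P) (loop P).pt → HomotopyGroup (Fin (n + 1)) P P.pt :=
  Quotient.map uncurryLoop fun _ _ => uncurryLoop_homotopic_iff.2

theorem loopShift_bijective : Function.Bijective (loopShift P n) :=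
  ⟨fun a a' => Quotient.inductionOn₂ a a' fun _ _ h =>
      Quotient.sound (uncurryLoop_homotopic_iff.1 (Quotient.exact h)),
    Quotient.map_surjective _ uncurryLoop_surjective⟩

end LoopShift

namespace PreSpec

/-- The generalized loop `(t₀, t₁) ↦ σ(σ(z)(t₁))(t₀)` given by a point `z` of the `m`-th space
of a spectrum with structure maps `σ`. -/
def pointGenLoop (E : PreSpec.{u}) {m : ℤ} (z : E.level m) :
    GenLoop (Fin 2) (E.level (m + 1 + 1)) (E.level (m + 1 + 1)).pt :=
  uncurryLoop ((E.str (m + 1)).genLoop (uncurryLoop (n := 0)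
    ⟨ContinuousMap.const _ (E.str m z), fun _ ⟨i, _⟩ => i.elim0⟩))

/-- The map from path components of the `m`-th space to `π_{-m}`. -/
def componentsToPi (E : PreSpec.{u}) (m : ℤ) (e : ZerothHomotopy (E.level m)) : E.pi (-m) :=
  piTwoMap (E.levelCast (by omega : m + 1 + 1 = 2 - -m)) (Additive.ofMul
    (loopShift _ 1 (homotopyMap (Fin 1) (E.str (m + 1)).toMap (E.str (m + 1)).map_pt
      (loopShift _ 0 (homotopyMap (Fin 0) (E.str m).toMap (E.str m).map_pt
        (HomotopyGroup.pi0EquivZerothHomotopy.symm e))))))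

theorem componentsToPi_mk (E : PreSpec.{u}) (m : ℤ) (z : E.level m) :
    E.componentsToPi m (Quotient.mk _ z) =
      piTwoMap (E.levelCast (by omega : m + 1 + 1 = 2 - -m)) (PiTwo.mk (E.pointGenLoop z)) := rfl

theorem IsOmega.componentsToPi_bijective {E : PreSpec.{u}} (hE : E.IsOmega) (m : ℤ) :
    Function.Bijective (E.componentsToPi m) :=
  (piTwoMap_levelCast_bijective E _).comp ((loopShift_bijective _ 1).comp
    (((hE (m + 1)).homotopyMap_bijective 1 _).comp ((loopShift_bijective _ 0).comp
      (((hE m).homotopyMap_bijective 0 _).comp (Equiv.bijective _)))))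

theorem componentsToPi_natural {E F : PreSpec.{u}} (f : E ⟶ F) (m : ℤ) (z : E.level m) :
    F.componentsToPi m (Quotient.mk _ (f.app m z)) =
      piMap f (-m) (E.componentsToPi m (Quotient.mk _ z)) := by
  rw [componentsToPi_mk, componentsToPi_mk, piMap, ← piTwoMap_comp, ← levelCast_natural,
    piTwoMap_comp, piTwoMap_mk]
  refine congrArg (fun g => piTwoMap _ (PiTwo.mk g)) (GenLoop.ext _ _ fun t => ?_)
  change asPath (F.str (m + 1) (asPath (F.str m (f.app m z)) (t 1))) (t 0) =
    f.app (m + 1 + 1) (asPath (E.str (m + 1) (asPath (E.str m z) (t 1))) (t 0))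
  rw [comm_apply f m z]
  change asPath (F.str (m + 1) (f.app (m + 1) (asPath (E.str m z) (t 1)))) (t 0) = _
  rw [comm_apply f (m + 1)]
  rfl

theorem IsOmega.joined_iff {E : PreSpec.{u}} (hE : E.IsOmega) {m : ℤ} {z z' : E.level m} :
    Joined z z' ↔
      E.componentsToPi m (Quotient.mk _ z) = E.componentsToPi m (Quotient.mk _ z') :=
  zerothHomotopy_mk_eq.symm.trans (hE.componentsToPi_bijective m).1.eq_iff.symm

theorem IsOmega.exists_point {E : PreSpec.{u}} (hE : E.IsOmega) {m : ℤ} (a : E.pi (-m)) :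
    ∃ z : E.level m, E.componentsToPi m (Quotient.mk _ z) = a := by
  obtain ⟨e, rfl⟩ := (hE.componentsToPi_bijective m).2 a
  obtain ⟨z, rfl⟩ := Quotient.exists_rep e
  exact ⟨z, rfl⟩

end PreSpec

namespace Fil

open PreSpec

theorem trans_comp (X : Fil.{u}) {l m n : ℤ} (h : l ≤ m) (h' : m ≤ n) :
    X.trans h' ≫ X.trans h = X.trans (h.trans h') := by
  rw [← X.map_comp]
  rfl

theorem trans_refl (X : Fil.{u}) {n : ℤ} (h : n ≤ n) : X.trans h = 𝟙 _ := X.map_id _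

theorem trans_natural {X Y : Fil.{u}} (f : X ⟶ Y) {m n : ℤ} (h : m ≤ n) :
    X.trans h ≫ f.app (op m) = f.app (op n) ≫ Y.trans h := f.naturality _

theorem piMap_trans_trans (X : Fil.{u}) {l m n : ℤ} (h : l ≤ m) (h' : m ≤ n) (k : ℤ)
    (a : (X.obj (op n)).pi k) :
    piMap (X.trans h) k (piMap (X.trans h') k a) = piMap (X.trans (h.trans h')) k a := by
  rw [← piMap_comp, trans_comp]

theorem piMap_trans_self (X : Fil.{u}) {n : ℤ} (h : n ≤ n) (k : ℤ) (a : (X.obj (op n)).pi k) :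
    piMap (X.trans h) k a = a := by
  rw [trans_refl, piMap_id]

theorem piMap_trans_natural {X Y : Fil.{u}} (f : X ⟶ Y) {m n : ℤ} (h : m ≤ n) (k : ℤ)
    (a : (X.obj (op n)).pi k) :
    piMap (f.app (op m)) k (piMap (X.trans h) k a) =
      piMap (Y.trans h) k (piMap (f.app (op n)) k a) := by
  rw [← piMap_comp, ← piMap_comp, trans_natural]

theorem telIter_eq_trans (X : Fil.{u}) (m : ℤ) {n N : ℕ} (h : n ≤ N)
    (z : (X.obj (op (-(n : ℤ)))).level m) :
    telIter (P := fun n : ℕ => (X.obj (op (-(n : ℤ)))).level m)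
      (fun n => (X.trans (by push_cast; omega : -((n + 1 : ℕ) : ℤ) ≤ -(n : ℤ))).app m) h z =
      (X.trans (by omega : -(N : ℤ) ≤ -(n : ℤ))).app m z := by
  induction N, h using Nat.le_induction with
  | base =>
    rw [telIter_self, trans_refl]; rfl
  | succ N h ih =>
    rw [telIter_succ h, ih]
    exact congrArg (fun g : X.obj (op (-(n : ℤ))) ⟶ X.obj (op (-((N + 1 : ℕ) : ℤ))) => g.app m z)
      (trans_comp X (by push_cast; omega : -((N + 1 : ℕ) : ℤ) ≤ -(N : ℤ)) _)

theorem TauInvEquiv.exists_lift {X Y : Fil.{u}} {f : X ⟶ Y}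
    (hY : Y.IsSpectrum) (hf : TauInvEquiv f) {n k : ℤ} (b : (Y.obj (op n)).pi k) :
    ∃ (n' : ℤ) (h : n' ≤ n) (a : (X.obj (op n')).pi k),
      piMap (f.app (op n')) k a = piMap (Y.trans h) k b := by
  obtain ⟨m, rfl⟩ : ∃ m, k = -m := ⟨-k, by omega⟩
  have hN : -((-n).toNat : ℤ) ≤ n := by omega
  obtain ⟨z, hz⟩ := (hY _).exists_point (piMap (Y.trans hN) (-m) b)
  obtain ⟨N, h, x, hx⟩ := (surjective_pathComponentsMap_iff _ _).1 (hf m).2 _ z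
  rw [telIter_eq_trans, (hY _).joined_iff, componentsToPi_natural, componentsToPi_natural, hz,
    piMap_trans_trans] at hx
  exact ⟨_, _, _, hx⟩

theorem TauInvEquiv.exists_eq_zero {X Y : Fil.{u}} {f : X ⟶ Y} (hX : X.IsSpectrum)
    (hY : Y.IsSpectrum) (hf : TauInvEquiv f) {n k : ℤ} (a : (X.obj (op n)).pi k)
    (ha : piMap (f.app (op n)) k a = 0) :
    ∃ (n' : ℤ) (h : n' ≤ n), piMap (X.trans h) k a = 0 := by
  obtain ⟨m, rfl⟩ : ∃ m, k = -m := ⟨-k, by omega⟩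
  have hN : -((-n).toNat : ℤ) ≤ n := by omega
  obtain ⟨x, hx⟩ := (hX _).exists_point (piMap (X.trans hN) (-m) a)
  obtain ⟨x', hx'⟩ := (hX (-((-n).toNat : ℤ))).exists_point (m := m) 0
  obtain ⟨N, h, H⟩ := (injective_pathComponentsMap_iff _ _).1 (hf m).1 _ x x' (by
    rw [(hY _).joined_iff, componentsToPi_natural, componentsToPi_natural, hx, hx',
      piMap_trans_natural, ha, map_zero, map_zero])
  rw [telIter_eq_trans, telIter_eq_trans, (hX _).joined_iff, componentsToPi_natural,
    componentsToPi_natural, hx, hx', piMap_trans_trans, map_zero] at H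
  exact ⟨_, _, H⟩

theorem tauInvEquiv_of_bijective {X Y : Fil.{u}} {f : X ⟶ Y} (hX : X.IsSpectrum)
    (hY : Y.IsSpectrum)
    (hf : ∀ k, ∃ n₀, ∀ n ≤ n₀, Function.Bijective (piMap (f.app (op n)) k)) :
    TauInvEquiv f := by
  intro m
  obtain ⟨n₀, hn₀⟩ := hf (-m)
  constructor
  · refine (injective_pathComponentsMap_iff _ _).2 fun n x x' hj => ?_
    have hle : -((max n (-n₀).toNat : ℕ) : ℤ) ≤ -(n : ℤ) := by omega
    refine ⟨max n (-n₀).toNat, le_max_left _ _, ?_⟩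
    rw [(hY _).joined_iff, componentsToPi_natural, componentsToPi_natural] at hj
    rw [telIter_eq_trans, telIter_eq_trans, (hX _).joined_iff, componentsToPi_natural,
      componentsToPi_natural]
    refine (hn₀ _ (by omega)).1 ?_
    rw [piMap_trans_natural, piMap_trans_natural, hj]
  · refine (surjective_pathComponentsMap_iff _ _).2 fun n z => ?_
    have hle : -((max n (-n₀).toNat : ℕ) : ℤ) ≤ -(n : ℤ) := by omega
    obtain ⟨a, ha⟩ := (hn₀ _ (by omega : -((max n (-n₀).toNat : ℕ) : ℤ) ≤ n₀)).2
      (piMap (Y.trans hle) (-m) ((Y.obj _).componentsToPi m (Quotient.mk _ z)))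
    obtain ⟨x, rfl⟩ := (hX _).exists_point a
    refine ⟨max n (-n₀).toNat, le_max_left _ _, x, ?_⟩
    rw [telIter_eq_trans, (hY _).joined_iff, componentsToPi_natural, componentsToPi_natural, ha]

end Fil

/-! ### Homotopy groups of homotopy limits -/

section Holim

variable {P : ℕ → PtdSpace.{u}} {p : ∀ n, PMap (P (n + 1)) (P n)} {Z : Type*} [TopologicalSpace Z]

/-- The map to a homotopy limit with given components: maps `Z → holimSpace P p` correspond to
families of maps `g n : Z → P n` and homotopies from `g n` to `p n ∘ g (n + 1)`. -/
def holimLift (g : ∀ n, C(Z, P n)) (c : ∀ n, C(Z × I, P n)) (h0 : ∀ n z, c n (z, 0) = g n z)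
    (h1 : ∀ n z, c n (z, 1) = p n (g (n + 1) z)) : C(Z, holimSpace P p) where
  toFun z := ⟨(fun n => g n z, fun n => (c n).curry z), fun n => ⟨h0 n z, h1 n z⟩⟩
  continuous_toFun := Continuous.subtype_mk ((continuous_pi fun n => (g n).continuous).prodMk
    (continuous_pi fun n => (c n).curry.continuous)) _

/-- The projection of a homotopy limit to a term of the tower. -/
def holimProj (p : ∀ n, PMap (P (n + 1)) (P n)) (n : ℕ) : C(holimSpace P p, P n) where
  toFun w := w.1.1 n
  continuous_toFun :=
    (continuous_apply n).comp (continuous_fst.comp continuous_subtype_val)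

/-- The homotopy between consecutive projections of a homotopy limit. -/
def holimTrack (p : ∀ n, PMap (P (n + 1)) (P n)) (n : ℕ) : C(holimSpace P p × I, P n) where
  toFun q := q.1.1.2 n q.2
  continuous_toFun := ContinuousEval.continuous_eval.comp (((continuous_apply n).comp
    ((continuous_snd.comp continuous_subtype_val).comp continuous_fst)).prodMk continuous_snd)

theorem holimTrack_zero (n : ℕ) (w : holimSpace P p) :
    holimTrack p n (w, 0) = holimProj p n w := (w.2 n).1

theorem holimTrack_one (n : ℕ) (w : holimSpace P p) :
    holimTrack p n (w, 1) = p n (holimProj p (n + 1) w) := (w.2 n).2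

theorem holim_ext {w w' : holimSpace P p} (proj : ∀ n, holimProj p n w = holimProj p n w')
    (track : ∀ n s, holimTrack p n (w, s) = holimTrack p n (w', s)) : w = w' :=
  Subtype.ext (Prod.ext (funext proj) (funext fun n => ContinuousMap.ext (track n)))

theorem eq_zero_of_subsingleton_piTwo_holimSpace (hs : Subsingleton (PiTwo (holimSpace P p)))
    (a : ∀ n, PiTwo (P n)) (ha : ∀ n, piTwoMap (p n) (a (n + 1)) = a n) (n : ℕ) : a n = 0 := by
  choose g hg using fun n => PiTwo.mk_surjective (a n)
  have compatible (n : ℕ) : GenLoop.Homotopic (g n) ((p n).genLoop (g (n + 1))) := by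
    rw [← PiTwo.mk_eq_mk, ← piTwoMap_mk, hg, hg, ha]
  choose H h0 h1 hb using fun n => genLoop_homotopic_iff.1 (compatible n)
  let W : GenLoop (Fin 2) (holimSpace P p) (holimSpace P p).pt :=
    ⟨holimLift (fun n => (g n).1) (fun n => ⟨fun q => H n (q.2, q.1), by fun_prop⟩) h0 h1,
      fun t ht => holim_ext (fun n => (g n).2 t ht) fun n s => hb n s t ht⟩
  obtain ⟨K, k0, k1, kb⟩ :=
    genLoop_homotopic_iff.1 (PiTwo.mk_eq_zero.1 (hs.allEq (PiTwo.mk W) 0))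
  rw [← hg, PiTwo.mk_eq_zero]
  exact genLoop_homotopic_iff.2 ⟨(holimProj p n).comp K, fun t => congrArg (holimProj p n) (k0 t),
    fun t => congrArg (holimProj p n) (k1 t), fun s t ht => congrArg (holimProj p n) (kb s t ht)⟩

/-- The point of a homotopy limit with given components. -/
def holimPoint (x : ∀ n, P n) (γ : ∀ n, Path (x n) (p n (x (n + 1)))) : holimSpace P p :=
  ⟨(x, fun n => (γ n).toContinuousMap), fun n => ⟨(γ n).source, (γ n).target⟩⟩

theorem joined_holimPoint_of_homotopic {x : ∀ n, P n} {γ γ' : ∀ n, Path (x n) (p n (x (n + 1)))}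
    (h : ∀ n, (γ n).Homotopic (γ' n)) : Joined (holimPoint x γ) (holimPoint x γ') := by
  have K (n : ℕ) : (γ n).Homotopy (γ' n) := (h n).some
  exact ⟨{ toContinuousMap := holimLift (fun n => ContinuousMap.const I (x n))
             (fun n => (K n).toContinuousMap) (fun n u => (K n).source u) fun n u => (K n).target u
           source' := holim_ext (fun _ => rfl) fun n s => (K n).apply_zero s
           target' := holim_ext (fun _ => rfl) fun n s => (K n).apply_one s }⟩

/-- The image of a path to the base point under a pointed map. -/
def PMap.pathToPt {P Q : PtdSpace.{u}} (f : PMap P Q) {x : P} (γ : Path x P.pt) :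
    Path (f x) Q.pt :=
  (γ.map f.continuous).cast rfl f.map_pt.symm

/-- The contraction moves along the paths `G n`, and shrinks `G n · (p n ∘ G (n + 1))⁻¹` towards
its midpoint, the base point. -/
theorem joined_holimPoint_trans_symm {x : ∀ n, P n} (G : ∀ n, Path (x n) (P n).pt) :
    Joined (holimPoint x fun n => (G n).trans ((p n).pathToPt (G (n + 1))).symm)
      (holimSpace P p).pt := by
  let γ (n : ℕ) : Path (x n) (p n (x (n + 1))) := (G n).trans ((p n).pathToPt (G (n + 1))).symm
  let c (n : ℕ) : C(I × I, P n) :=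
    ⟨fun q => (γ n).extend (q.1 / 2 * (1 - q.2) + (1 - q.1 / 2) * q.2), by fun_prop⟩
  have c_zero (n : ℕ) (u : I) : c n (u, 0) = G n u := calc
    c n (u, 0) = (γ n).extend (u / 2) := by simp [c]
    _ = (G n).extend (2 * (u / 2)) :=
      Path.extend_trans_of_le_half _ _ (by linarith [u.2.2])
    _ = G n u := by rw [mul_div_cancel₀ _ two_ne_zero, Path.extend_apply _ u.2]
  have c_one (n : ℕ) (u : I) : c n (u, 1) = p n (G (n + 1) u) := calc
    c n (u, 1) = (γ n).extend (1 - u / 2) := by simp [c]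
    _ = ((p n).pathToPt (G (n + 1))).symm.extend (2 * (1 - u / 2) - 1) :=
      Path.extend_trans_of_half_le _ _ (by linarith [u.2.2])
    _ = ((p n).pathToPt (G (n + 1))).extend u := by
      rw [Path.extend_symm_apply]; ring_nf
    _ = p n (G (n + 1) u) := Path.extend_apply _ u.2
  have c_source (n : ℕ) (s : I) : c n (0, s) = γ n s := by
    simp only [c, ContinuousMap.coe_mk, Set.Icc.coe_zero, zero_div, zero_mul, zero_add, sub_zero,
      one_mul, Path.extend_apply _ s.2]
  have c_target (n : ℕ) (s : I) : c n (1, s) = (P n).pt := calc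
    c n (1, s) = (γ n).extend (1 / 2) := by
      simp only [c, ContinuousMap.coe_mk, Set.Icc.coe_one]; ring_nf
    _ = (G n).extend (2 * (1 / 2)) := Path.extend_trans_of_le_half _ _ le_rfl
    _ = (P n).pt := by rw [mul_one_div_cancel two_ne_zero, Path.extend_one]
  exact ⟨{ toContinuousMap := holimLift (fun n => (G n).toContinuousMap) c c_zero c_one
           source' := holim_ext (fun n => (G n).source) c_source
           target' := holim_ext (fun n => (G n).target) c_target }⟩

theorem path_homotopic_of_loops {X : Type*} [TopologicalSpace X] {x y : X}
    (h : ∀ γ : Path y y, γ.Homotopic (Path.refl y)) (a b : Path x y) : a.Homotopic b := by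
  have h := Path.Homotopic.Quotient.eq.2 (h (a.symm.trans b))
  rw [Path.Homotopic.Quotient.mk_trans, Path.Homotopic.Quotient.mk_symm,
    Path.Homotopic.Quotient.mk_refl] at h
  rw [← Path.Homotopic.Quotient.eq, ← Path.Homotopic.Quotient.trans_refl (.mk a), ← h,
    ← Path.Homotopic.Quotient.trans_assoc, Path.Homotopic.Quotient.trans_symm,
    Path.Homotopic.Quotient.refl_trans]

theorem path_homotopic_trans_symm_iff {X : Type*} [TopologicalSpace X] {x y z : X} {γ : Path x y}
    {a : Path x z} {b : Path y z} : γ.Homotopic (a.trans b.symm) ↔ a.Homotopic (γ.trans b) := by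
  simp only [← Path.Homotopic.Quotient.eq, Path.Homotopic.Quotient.mk_trans,
    Path.Homotopic.Quotient.mk_symm]
  constructor
  · intro h
    rw [h, Path.Homotopic.Quotient.trans_assoc, Path.Homotopic.Quotient.symm_trans,
      Path.Homotopic.Quotient.trans_refl]
  · intro h
    rw [h, Path.Homotopic.Quotient.trans_assoc, Path.Homotopic.Quotient.trans_symm,
      Path.Homotopic.Quotient.trans_refl]

theorem exists_coherent_sequence {α : ℕ → Type*} {R : ∀ n, α n → α (n + 1) → Prop} {N : ℕ}
    (hne : ∀ n, N ≤ n → Nonempty (α n)) (hN : ∀ n, N ≤ n → ∀ a b, R n a b)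
    (hR : ∀ n b, ∃ a, R n a b) : ∃ g : ∀ n, α n, ∀ n, R n (g n) (g (n + 1)) := by
  have nonempty (j : ℕ) : ∀ n, N ≤ n + j → Nonempty (α n) := by
    induction j with
    | zero => exact hne
    | succ j ih => exact fun n hn => (hR n (ih (n + 1) (by omega)).some).nonempty
  have extend (M : ℕ) : (∃ g : ∀ n, α n, ∀ n, M ≤ n → R n (g n) (g (n + 1))) →
      ∃ g : ∀ n, α n, ∀ n, R n (g n) (g (n + 1)) := by
    induction M with
    | zero => exact fun ⟨g, hg⟩ => ⟨g, fun n => hg n n.zero_le⟩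
    | succ M ih =>
      rintro ⟨g, hg⟩
      obtain ⟨a, ha⟩ := hR M (g (M + 1))
      refine ih ⟨Function.update g M a, fun n hn => ?_⟩
      rw [Function.update_of_ne (by omega : n + 1 ≠ M)]
      obtain rfl | hn := hn.eq_or_lt
      · rwa [Function.update_self]
      · rw [Function.update_of_ne hn.ne']
        exact hg n hn
  exact extend N ⟨fun n => (nonempty N n (by omega)).some, fun n hn => hN n hn _ _⟩

theorem joined_holimSpace_pt {N : ℕ} (hc : ∀ n, N ≤ n → ∀ x : P n, Joined x (P n).pt)
    (hl : ∀ n, N ≤ n → ∀ γ : Path (P n).pt (P n).pt, γ.Homotopic (Path.refl _))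
    (w : holimSpace P p) : Joined w (holimSpace P p).pt := by
  let x (n : ℕ) : P n := holimProj p n w
  let γ (n : ℕ) : Path (x n) (p n (x (n + 1))) := ⟨w.1.2 n, (w.2 n).1, (w.2 n).2⟩
  obtain ⟨G, hG⟩ : ∃ G : ∀ n, Path (x n) (P n).pt,
      ∀ n, (G n).Homotopic ((γ n).trans ((p n).pathToPt (G (n + 1)))) :=
    exists_coherent_sequence (R := fun n (a : Path (x n) (P n).pt) b =>
        a.Homotopic ((γ n).trans ((p n).pathToPt b))) (fun n hn => hc n hn (x n))
      (fun n hn _ _ => path_homotopic_of_loops (hl n hn) _ _) fun n _ => ⟨_, .refl _⟩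
  exact (joined_holimPoint_of_homotopic fun n => path_homotopic_trans_symm_iff.2 (hG n)).trans
    (joined_holimPoint_trans_symm G)

end Holim

section GenLoopSpace

variable {N : Type} {P Q : PtdSpace.{u}} {Z : Type*} [TopologicalSpace Z]

variable (N P) in
/-- The pointed space of generalized loops. -/
def genLoopSpace : PtdSpace.{u} where
  carrier := GenLoop N P P.pt
  pt := GenLoop.const

/-- A point of a space of generalized loops, as a generalized loop. -/
def asGenLoop (g : genLoopSpace N P) : GenLoop N P P.pt := g

/-- The map induced on spaces of generalized loops. -/
def genLoopSpaceMap (N : Type) (f : PMap P Q) : PMap (genLoopSpace N P) (genLoopSpace N Q) where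
  toMap := ⟨fun g => f.genLoop (asGenLoop g),
    ((ContinuousMap.continuous_postcomp f.toMap).comp continuous_subtype_val).subtype_mk _⟩
  map_pt := GenLoop.ext _ _ fun _ => f.map_pt

theorem genLoopSpace_ext {g g' : genLoopSpace N P} (h : ∀ t, asGenLoop g t = asGenLoop g' t) :
    g = g' :=
  GenLoop.ext _ _ h

/-- The map to a space of generalized loops adjoint to a map from a product. -/
def genLoopLift (c : C(Z × (N → I), P)) (hc : ∀ z, ∀ t ∈ Cube.boundary N, c (z, t) = P.pt) :
    C(Z, genLoopSpace N P) where
  toFun z := (⟨c.curry z, hc z⟩ : GenLoop N P P.pt)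
  continuous_toFun := c.curry.continuous.subtype_mk _

/-- The map from a product adjoint to a map to a space of generalized loops. -/
def genLoopTrack (w : C(Z, genLoopSpace N P)) : C(Z × (N → I), P) where
  toFun q := asGenLoop (w q.1) q.2
  continuous_toFun := (ContinuousEval.continuous_eval (F := GenLoop N P P.pt)).comp
    ((w.continuous.comp continuous_fst).prodMk continuous_snd)

theorem genLoopTrack_of_mem_boundary (w : C(Z, genLoopSpace N P)) (z : Z) {t : N → I}
    (ht : t ∈ Cube.boundary N) : genLoopTrack w (z, t) = P.pt :=
  (asGenLoop (w z)).2 t ht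

theorem joined_genLoopSpace_iff {g g' : genLoopSpace N P} :
    Joined g g' ↔ GenLoop.Homotopic (asGenLoop g) (asGenLoop g') := by
  rw [genLoop_homotopic_iff]
  constructor
  · rintro ⟨γ⟩
    exact ⟨genLoopTrack γ.toContinuousMap, fun t => congrArg (asGenLoop · t) γ.source,
      fun t => congrArg (asGenLoop · t) γ.target, fun s t => genLoopTrack_of_mem_boundary _ s⟩
  · rintro ⟨H, h0, h1, hb⟩
    exact ⟨{ toContinuousMap := genLoopLift H hb
             source' := genLoopSpace_ext h0
             target' := genLoopSpace_ext h1 }⟩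

theorem joined_genLoopSpace_pt (h : Subsingleton (PiTwo P)) (g : genLoopSpace (Fin 2) P) :
    Joined g (genLoopSpace (Fin 2) P).pt :=
  joined_genLoopSpace_iff.2 (PiTwo.mk_eq_zero.1 (h.allEq _ _))

/-- The null homotopies of a loop of generalized loops are those of a generalized loop of loops. -/
theorem genLoopSpace_path_homotopic_refl (h : Subsingleton (PiTwo (loop P)))
    (γ : Path (genLoopSpace (Fin 2) P).pt (genLoopSpace (Fin 2) P).pt) :
    γ.Homotopic (Path.refl _) := by
  let g : GenLoop (Fin 2) (loop P) (loop P).pt :=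
    ⟨loopLift ⟨fun q => genLoopTrack γ.toContinuousMap (q.2, q.1), by fun_prop⟩
      (fun t => congrArg (asGenLoop · t) γ.source) (fun t => congrArg (asGenLoop · t) γ.target),
      fun t ht => loop_ext fun s => genLoopTrack_of_mem_boundary _ s ht⟩
  obtain ⟨H, h0, h1, hb⟩ :=
    genLoop_homotopic_iff.1 (PiTwo.mk_eq_zero.1 (h.allEq (PiTwo.mk g) 0))
  let K : C(I × I, genLoopSpace (Fin 2) P) :=
    genLoopLift ⟨fun q => loopTrack H ((q.1.1, q.2), q.1.2), by fun_prop⟩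
      fun q t ht => congrArg (asPath · q.2) (hb q.1 t ht)
  have K_source (u : I) : K (u, 0) = (genLoopSpace (Fin 2) P).pt :=
    genLoopSpace_ext fun t => loopTrack_zero H (u, t)
  have K_target (u : I) : K (u, 1) = (genLoopSpace (Fin 2) P).pt :=
    genLoopSpace_ext fun t => loopTrack_one H (u, t)
  refine ⟨{ toContinuousMap := K
            map_zero_left := fun s => genLoopSpace_ext fun t => congrArg (asPath · s) (h0 t)
            map_one_left := fun s => genLoopSpace_ext fun t => congrArg (asPath · s) (h1 t)
            prop' := fun u s hs => ?_ }⟩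
  obtain rfl | rfl : s = 0 ∨ s = 1 := by simpa using hs
  · exact (K_source u).trans γ.source.symm
  · exact (K_target u).trans γ.target.symm

section Holim

variable {P : ℕ → PtdSpace.{u}} {p : ∀ n, PMap (P (n + 1)) (P n)}

/-- The tower of spaces of generalized loops in a tower of pointed spaces. -/
abbrev genLoopTower (N : Type) (P : ℕ → PtdSpace.{u}) (n : ℕ) : PtdSpace.{u} :=
  genLoopSpace N (P n)

variable (N p) in
/-- The maps of a tower of spaces of generalized loops. -/
abbrev genLoopTowerMap (n : ℕ) : PMap (genLoopTower N P (n + 1)) (genLoopTower N P n) :=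
  genLoopSpaceMap N (p n)

variable (N p) in
/-- The map that interchanges generalized loops with homotopy limits. -/
def holimGenLoop : C(holimSpace (genLoopTower N P) (genLoopTowerMap N p),
    genLoopSpace N (holimSpace P p)) :=
  let W := holimSpace (genLoopTower N P) (genLoopTowerMap N p)
  let g (n : ℕ) : C(W × (N → I), P n) := genLoopTrack (holimProj (genLoopTowerMap N p) n)
  let c (n : ℕ) : C((W × I) × (N → I), P n) := genLoopTrack (holimTrack (genLoopTowerMap N p) n)
  genLoopLift
    (holimLift g (fun n => ⟨fun v => c n ((v.1.1, v.2), v.1.2), by fun_prop⟩)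
      (fun n v => congrArg (fun w : genLoopTower N P n => asGenLoop w v.2)
        (holimTrack_zero (p := genLoopTowerMap N p) n v.1))
      (fun n v => congrArg (fun w : genLoopTower N P n => asGenLoop w v.2)
        (holimTrack_one (p := genLoopTowerMap N p) n v.1)))
    fun w t ht => holim_ext (fun n => genLoopTrack_of_mem_boundary _ w ht)
      fun n s => genLoopTrack_of_mem_boundary _ (w, s) ht

theorem holimGenLoop_pt : holimGenLoop N p (holimSpace _ _).pt = (genLoopSpace N _).pt := rfl

theorem holimGenLoop_surjective : Function.Surjective (holimGenLoop N p) := fun W =>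
  let W' : C(N → I, holimSpace P p) := (asGenLoop W).1
  have W'_boundary (t : N → I) (ht : t ∈ Cube.boundary N) : W' t = (holimSpace P p).pt :=
    (asGenLoop W).2 t ht
  ⟨holimLift (p := genLoopTowerMap N p) (Z := Unit)
      (fun n => genLoopLift ((holimProj p n).comp (W'.comp .snd))
        fun _ t ht => congrArg (holimProj p n) (W'_boundary t ht))
      (fun n => genLoopLift ⟨fun q => holimTrack p n (W' q.2, q.1.2), by fun_prop⟩
        fun q t ht => congrArg (fun w => holimTrack p n (w, q.2)) (W'_boundary t ht))
      (fun n _ => genLoopSpace_ext fun t => holimTrack_zero n (W' t))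
      (fun n _ => genLoopSpace_ext fun t => holimTrack_one n (W' t)) (),
    genLoopSpace_ext fun _ => holim_ext (fun _ => rfl) fun _ _ => rfl⟩

theorem subsingleton_piTwo_holimSpace {M : ℕ} (h₂ : ∀ n, M ≤ n → Subsingleton (PiTwo (P n)))
    (h₃ : ∀ n, M ≤ n → Subsingleton (PiTwo (loop (P n)))) :
    Subsingleton (PiTwo (holimSpace P p)) := by
  refine subsingleton_of_forall_eq 0 fun a => ?_
  obtain ⟨W, rfl⟩ := PiTwo.mk_surjective a
  obtain ⟨w, rfl⟩ := holimGenLoop_surjective (N := Fin 2) (p := p) W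
  have joined : Joined w (holimSpace _ _).pt :=
    joined_holimSpace_pt (fun n hn => joined_genLoopSpace_pt (h₂ n hn))
      (fun n hn => genLoopSpace_path_homotopic_refl (h₃ n hn)) w
  have joined' := joined.map (holimGenLoop (Fin 2) p).continuous
  rw [holimGenLoop_pt, joined_genLoopSpace_iff] at joined'
  exact PiTwo.mk_eq_zero.2 joined'

end Holim

end GenLoopSpace

theorem PreSpec.IsOmega.subsingleton_piTwo_loop {E : PreSpec.{u}} (hE : E.IsOmega) {k : ℤ}
    (h : Subsingleton (E.pi (k + 1))) : Subsingleton (PiTwo (loop (E.level (2 - k)))) := by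
  have key : Subsingleton (PiTwo (loop (E.level (2 - (k + 1) + 1)))) :=
    (hE (2 - (k + 1))).piTwoMap_bijective.2.subsingleton
  rwa [show 2 - (k + 1) + 1 = 2 - k by ring] at key

theorem PreSpec.subsingleton_pi_cofib_iff {E F : PreSpec.{u}} (f : E ⟶ F) (hE : E.IsOmega)
    (hF : F.IsOmega) {k k' : ℤ} (hk : k' + 1 = k) :
    Subsingleton ((cofib f).pi k) ↔
      Function.Surjective (piMap f k) ∧ Function.Injective (piMap f k') := by
  refine ⟨fun h => ⟨fun b => ?_, ?_⟩, fun ⟨surjective, injective⟩ => ?_⟩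
  · exact (toCofib_eq_zero_iff f hE hF k b).1 (h.allEq _ _)
  · refine (injective_iff_map_eq_zero _).2 fun a ha => ?_
    obtain ⟨w, rfl⟩ := (piMap_eq_zero_iff f hk a).1 ha
    rw [h.allEq w 0, map_zero]
  · refine subsingleton_of_forall_eq 0 fun w => ?_
    have boundary_eq_zero : boundary f hk w = 0 :=
      (injective_iff_map_eq_zero _).1 injective _ ((piMap_eq_zero_iff f hk _).2 ⟨w, rfl⟩)
    obtain ⟨b, rfl⟩ := (boundary_eq_zero_iff f hF hk w).1 boundary_eq_zero
    exact (toCofib_eq_zero_iff f hE hF k b).2 (surjective b)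

namespace Fil

open PreSpec

/-! ### Powers of `τ` and completeness -/

theorem tau_eq (X : Fil.{u}) {x y y' : ℤ} (h : y' ≤ y) (a : bi X x y) :
    tau X x y y' a = piMap (X.trans (by omega : x + y' ≤ x + y)) x a := by
  rw [tau, dif_pos h]

theorem tau_tau (X : Fil.{u}) {x y y' y'' : ℤ} (h : y' ≤ y) (h' : y'' ≤ y') (a : bi X x y) :
    tau X x y' y'' (tau X x y y' a) = tau X x y y'' a := by
  rw [tau_eq X h, tau_eq X h', tau_eq X (h'.trans h), piMap_trans_trans]

theorem tau_self (X : Fil.{u}) {x y : ℤ} (a : bi X x y) : tau X x y y a = a := by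
  rw [tau_eq X le_rfl, piMap_trans_self]

/-- A sequence of successive `τ`-divisions determines a point of the limit of the groups
`π_x (X n)` over the natural numbers `n`. -/
theorem IsComplete.eq_zero_of_compatible {X : Fil.{u}} (hX : IsComplete X) {x y : ℤ}
    (a : ∀ j : ℕ, bi X x (y + j))
    (ha : ∀ j : ℕ, tau X x (y + ((j + 1 : ℕ) : ℤ)) (y + j) (a (j + 1)) = a j) : a 0 = 0 := by
  have tau_eq_of_le {i j : ℕ} (h : i ≤ j) : tau X x (y + j) (y + i) (a j) = a i := by
    induction j, h using Nat.le_induction with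
    | base => exact tau_self X _
    | succ j h ih => rw [← tau_tau X (by push_cast; omega : y + (j : ℤ) ≤ _) (by omega), ha, ih]
  let J (n : ℕ) : ℕ := ((n : ℤ) - x - y).toNat
  let b (n : ℕ) : (X.obj (op (n : ℤ))).pi x :=
    piMap (X.trans (by simp only [J]; omega : (n : ℤ) ≤ x + (y + (J n : ℤ)))) x (a (J n))
  have compatible (n : ℕ) : piMap (X.trans (by push_cast; omega : (n : ℤ) ≤ ((n + 1 : ℕ) : ℤ))) x
      (b (n + 1)) = b n := by
    have le_succ : J n ≤ J (n + 1) := by simp only [J]; omega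
    simp only [b]
    rw [piMap_trans_trans, ← tau_eq_of_le le_succ, tau_eq X (by omega), piMap_trans_trans]
  have b_eq_zero : b (x + y).toNat = 0 :=
    eq_zero_of_subsingleton_piTwo_holimSpace (hX x) b compatible _
  have trans_b_eq_zero := congrArg (piMap (X.trans
    (by push_cast; omega : x + (y + ((0 : ℕ) : ℤ)) ≤ ((x + y).toNat : ℤ))) x) b_eq_zero
  simp only [b] at trans_b_eq_zero
  rwa [piMap_trans_trans, map_zero, ← tau_eq X (by omega), tau_eq_of_le (Nat.zero_le _)]
    at trans_b_eq_zero

theorem isComplete_of_subsingleton {X : Fil.{u}} (hX : X.IsSpectrum)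
    (h : ∀ k : ℤ, ∃ N : ℤ, ∀ n, N ≤ n → Subsingleton ((X.obj (op n)).pi k)) : IsComplete X := by
  intro k
  obtain ⟨N, hN⟩ := h k
  obtain ⟨M, hM⟩ := h (k + 1)
  exact subsingleton_piTwo_holimSpace (M := (max N M).toNat) (fun n hn => hN n (by omega))
    fun n hn => (hX n).subsingleton_piTwo_loop (hM n (by omega))

/-! ### The long exact sequences of powers of `τ` -/

theorem piMap_trans_bijective_of_eq (X : Fil.{u}) {m n : ℤ} (h : m ≤ n) (e : m = n) (k : ℤ) :
    Function.Bijective (piMap (X.trans h) k) := by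
  subst e
  exact ⟨fun a b hab => by rwa [piMap_trans_self, piMap_trans_self] at hab,
    fun a => ⟨a, piMap_trans_self X h k a⟩⟩

/-- The boundary map `π_{x,y} (X / τ ^ k) → π_{x-1,y+k+1} X`, which for `k = 1` is `δ`. -/
def modTauBoundary (X : Fil.{u}) (k : ℕ) {x y x' y' : ℤ} (hx : x' + 1 = x) (hy : y' = y + k + 1) :
    bi (modTau X k) x y →+ bi X x' y' :=
  (piMap (X.trans (by omega : x' + y' ≤ x + y + k)) x').comp
    (boundary ((tauPow X k).app (op (x + y))) hx)

theorem modTauBoundary_eq_zero_iff {X : Fil.{u}} (hX : X.IsSpectrum) {k : ℕ} {x y x' y' : ℤ}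
    (hx : x' + 1 = x) (hy : y' = y + k + 1) (z : bi (modTau X k) x y) :
    modTauBoundary X k hx hy z = 0 ↔
      ∃ a : bi X x y, toCofib ((tauPow X k).app (op (x + y))) x a = z := by
  have e : x' + y' = x + y + k := by omega
  exact (map_eq_zero_iff _ (piMap_trans_bijective_of_eq X e.le e x').1).trans
    (boundary_eq_zero_iff _ (hX _) hx z)

theorem tau_eq_zero_iff_exists_modTauBoundary {X : Fil.{u}} {k : ℕ} {x y x' y' y'' : ℤ}
    (hx : x' + 1 = x) (hy : y' = y + k + 1) (hy' : y'' = y + 1) (c : bi X x' y') :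
    tau X x' y' y'' c = 0 ↔ ∃ z, modTauBoundary X k hx hy z = c := by
  have e : x' + y' = x + y + k := by omega
  have e' : x' + y'' = x + y := by omega
  obtain ⟨c, rfl⟩ := (piMap_trans_bijective_of_eq X e.le e x').2 c
  have tau_trans : tau X x' y' y'' (piMap (X.trans e.le) x' c) =
      piMap (X.trans e'.le) x' (piMap ((tauPow X k).app (op (x + y))) x' c) := by
    rw [tau_eq X (by omega), piMap_trans_trans]
    exact (piMap_trans_trans X e'.le _ x' c).symm
  rw [tau_trans, map_eq_zero_iff _ (piMap_trans_bijective_of_eq X e'.le e' x').1]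
  exact (piMap_eq_zero_iff _ hx c).trans
    (exists_congr fun z => (piMap_trans_bijective_of_eq X e.le e x').1.eq_iff.symm)

theorem tau_modTauBoundary_succ {X : Fil.{u}} {k : ℕ} {x y x' y' y'' : ℤ} (hx : x' + 1 = x)
    (hy : y' = y + (k + 1 : ℕ) + 1) (hy' : y'' = y + k + 1) (z : bi (modTau X (k + 1)) x y) :
    tau X x' y' y'' (modTauBoundary X (k + 1) hx hy z) =
      modTauBoundary X k hx hy' (piMap (modTauProj X k (x + y)) x z) := by
  have h : x + y + (k : ℤ) ≤ x + y + ((k + 1 : ℕ) : ℤ) := by push_cast; omega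
  have h' : x' + y'' ≤ x + y + (k : ℤ) := by omega
  have natural : piMap (X.trans h) x' (boundary ((tauPow X (k + 1)).app (op (x + y))) hx z) =
      boundary ((tauPow X k).app (op (x + y))) hx (piMap (modTauProj X k (x + y)) x z) :=
    boundary_natural (f := (tauPow X (k + 1)).app (op (x + y)))
      (f' := (tauPow X k).app (op (x + y))) (X.trans h) (𝟙 _) _ hx z
  rw [tau_eq X (by omega)]
  exact (piMap_trans_trans X _ _ x' _).trans ((piMap_trans_trans X h' h x' _).symm.trans
    (congrArg (piMap (X.trans h') x') natural))

theorem red_eq_zero_iff {X : Fil.{u}} (hX : X.IsSpectrum) {x y y₁ : ℤ} (hy : y₁ = y + 1)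
    (a : bi X x y) : red X x y a = 0 ↔ ∃ c : bi X x y₁, tau X x y₁ y c = a := by
  have e : x + y₁ = x + y + ((1 : ℕ) : ℤ) := by push_cast; omega
  refine (toCofib_eq_zero_iff _ (hX _) (hX _) x a).trans ⟨?_, ?_⟩
  · rintro ⟨c, hc⟩
    refine ⟨piMap (X.trans e.le) x c, ?_⟩
    rw [tau_eq X (by omega)]
    exact (piMap_trans_trans X _ e.le x c).trans hc
  · rintro ⟨c, hc⟩
    refine ⟨piMap (X.trans e.ge) x c, ?_⟩
    rw [tau_eq X (by omega)] at hc
    exact (piMap_trans_trans X _ e.ge x c).trans hc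

theorem delta_eq_zero_iff {X : Fil.{u}} (hX : X.IsSpectrum) {x y x' y' : ℤ} (hx : x' + 1 = x)
    (hy : y' = y + 2) (z : gr X x y) : delta X hx hy z = 0 ↔ ∃ a, red X x y a = z :=
  modTauBoundary_eq_zero_iff hX hx (by push_cast; omega) z

theorem tau_eq_zero_iff {X : Fil.{u}} {x y x' y' y'' : ℤ} (hx : x' + 1 = x)
    (hy : y' = y + 2) (hy' : y'' = y + 1) (c : bi X x' y') :
    tau X x' y' y'' c = 0 ↔ ∃ z : gr X x y, delta X hx hy z = c :=
  tau_eq_zero_iff_exists_modTauBoundary hx (by push_cast; omega) hy' c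

theorem delta_red {X : Fil.{u}} (hX : X.IsSpectrum) {x y x' y' : ℤ} (hx : x' + 1 = x)
    (hy : y' = y + 2) (a : bi X x y) : delta X hx hy (red X x y a) = 0 :=
  (delta_eq_zero_iff hX hx hy _).2 ⟨a, rfl⟩

theorem red_tau {X : Fil.{u}} (hX : X.IsSpectrum) {x y y₁ : ℤ} (h : y < y₁) (c : bi X x y₁) :
    red X x y (tau X x y₁ y c) = 0 :=
  (red_eq_zero_iff hX rfl _).2 ⟨tau X x y₁ (y + 1) c, tau_tau X (by omega) (by omega) c⟩

theorem tau_delta {X : Fil.{u}} {x y x' y' y'' : ℤ} (hx : x' + 1 = x)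
    (hy : y' = y + 2) (h : y'' < y') (z : gr X x y) :
    tau X x' y' y'' (delta X hx hy z) = 0 := by
  rw [← tau_tau X (by omega : y + 1 ≤ y') (by omega), (tau_eq_zero_iff hx hy rfl _).2 ⟨z, rfl⟩,
    map_zero]

/-! ### Strong completeness -/

theorem limOneVanishes_of_surjective (R : ℕ) (A : ℕ → Type u) [∀ n, AddCommGroup (A n)]
    (p : ∀ n, A (n + 1) →+ A n) (h : ∀ n, R ≤ n → Function.Surjective (p n)) :
    LimOneVanishes A p := by
  intro w
  induction R generalizing A with
  | zero =>
    choose g hg using fun n => h n (Nat.zero_le n)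
    refine ⟨fun n => Nat.rec (motive := fun n => A n) 0 (fun n v => g n (v - w n)) n,
      funext fun n => ?_⟩
    change _ - p n (g n _) = w n
    rw [hg, sub_sub_cancel]
  | succ R ih =>
    obtain ⟨v, hv⟩ := ih (fun n => A (n + 1)) (fun n => p (n + 1)) (fun n hn => h _ (by omega))
      fun n => w (n + 1)
    refine ⟨fun n => Nat.casesOn (motive := fun n => A n) n (w 0 + p 0 (v 0)) v,
      funext fun n => ?_⟩
    cases n with
    | zero => exact add_sub_cancel_right _ _
    | succ n => exact congrFun hv n

/-- The differences of successive `τ`-divisions of `a` lift to the groups `π_{x+1,y-1} (X / τ ^ j)`,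
so that the vanishing of `lim¹` allows one to make the divisions compatible. -/
theorem IsStronglyComplete.eq_zero_of_divisible {X : Fil.{u}}
    (h : IsStronglyComplete X) {x y : ℤ} (a : bi X x y)
    (ha : ∀ j : ℕ, ∃ c : bi X x (y + j), tau X x (y + j) y c = a) : a = 0 := by
  choose c hc using ha
  have hy (j : ℕ) : y + j = y - 1 + j + 1 := by ring
  let bd (j : ℕ) : bi (modTau X j) (x + 1) (y - 1) →+ bi X x (y + j) :=
    modTauBoundary X j rfl (hy j)
  have exists_boundary (j : ℕ) :
      ∃ w, bd j w = c j - tau X x (y + ((j + 1 : ℕ) : ℤ)) (y + j) (c (j + 1)) := by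
    refine (tau_eq_zero_iff_exists_modTauBoundary rfl (hy j) (sub_add_cancel y 1).symm _).1 ?_
    rw [map_sub, tau_tau X (by push_cast; omega) (by omega), hc, hc, sub_self]
  choose w hw using exists_boundary
  obtain ⟨v, hv⟩ := h.2 (x + 1) (y - 1) w
  have boundary_sub (j : ℕ) :
      bd j (v j) - tau X x (y + ((j + 1 : ℕ) : ℤ)) (y + j) (bd (j + 1) (v (j + 1))) =
        c j - tau X x (y + ((j + 1 : ℕ) : ℤ)) (y + j) (c (j + 1)) := by
    rw [← hw, ← congrFun hv j, map_sub, tau_modTauBoundary_succ rfl (hy (j + 1)) (hy j)]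
  have compatible (j : ℕ) : tau X x (y + ((j + 1 : ℕ) : ℤ)) (y + j)
      (c (j + 1) - bd (j + 1) (v (j + 1))) = c j - bd j (v j) := by
    have add_comm_boundary := boundary_sub j
    rw [sub_eq_sub_iff_add_eq_add] at add_comm_boundary
    rw [map_sub, sub_eq_sub_iff_add_eq_add]
    exact (add_comm _ _).trans add_comm_boundary
  have c_sub_eq_zero := h.1.eq_zero_of_compatible (fun j => c j - bd j (v j)) compatible
  have tau_boundary : tau X x (y + (0 : ℕ)) y (bd 0 (v 0)) = 0 :=
    (tau_eq_zero_iff_exists_modTauBoundary rfl (hy 0) (sub_add_cancel y 1).symm _).2 ⟨v 0, rfl⟩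
  rw [← hc 0, sub_eq_zero.1 c_sub_eq_zero, tau_boundary]

theorem isStronglyComplete_of_subsingleton {X : Fil.{u}} (hX : X.IsSpectrum)
    (h : ∀ k : ℤ, ∃ N : ℤ, ∀ n, N ≤ n → Subsingleton ((X.obj (op n)).pi k)) :
    IsStronglyComplete X := by
  refine ⟨isComplete_of_subsingleton hX h, fun x y => ?_⟩
  obtain ⟨N, hN⟩ := h (x - 1)
  refine limOneVanishes_of_surjective (N - (x + y)).toNat _ _ fun r hr w => ?_
  have source_subsingleton : Subsingleton ((X.obj (op (x + y + (r : ℤ)))).pi (x - 1)) :=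
    hN _ (by omega)
  obtain ⟨z, rfl⟩ := (boundary_eq_zero_iff ((tauPow X r).app (op (x + y))) (hX _)
    (sub_add_cancel x 1) w).1 (source_subsingleton.allEq _ _)
  refine ⟨toCofib ((tauPow X (r + 1)).app (op (x + y))) x z, ?_⟩
  refine (toCofib_natural _ _ _ x z).trans ?_
  rw [piMap_id]

/-! ### Connective covers in terms of bigraded homotopy groups -/

theorem lt_ceil_iff {α : ℝ} (hα : -1 < α) (x y : ℤ) :
    x < ⌈((x + y : ℤ) : ℝ) / (α + 1)⌉ ↔ ⌊α * x⌋ < y := by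
  rw [Int.lt_ceil, lt_div_iff₀ (by linarith), Int.floor_lt]
  push_cast
  constructor <;> intro h <;> linarith

theorem floor_le_floor_add_one {α : ℝ} (hα : -1 < α) (x : ℤ) :
    ⌊α * (x - 1 : ℤ)⌋ ≤ ⌊α * x⌋ + 1 := by
  rw [← Int.floor_add_one]
  refine Int.floor_le_floor ?_
  push_cast
  linarith

theorem isConnective_iff {α : ℝ} (hα : -1 < α) (X : Fil.{u}) :
    IsConnective α X ↔ ∀ x y : ℤ, ⌊α * x⌋ < y → Subsingleton (bi X x y) := by
  constructor
  · exact fun h x y hy => h (x + y) x ((lt_ceil_iff hα x y).2 hy)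
  · intro h n k hk
    obtain ⟨y, rfl⟩ : ∃ y, n = k + y := ⟨n - k, by omega⟩
    exact h k y ((lt_ceil_iff hα k y).1 hk)

theorem isCoconnective_cofib_iff {α : ℝ} (hα : -1 < α) {X Y : Fil.{u}} (hX : X.IsSpectrum)
    (hY : Y.IsSpectrum) (f : X ⟶ Y) :
    IsCoconnective α (cofib f) ↔ ∀ x y : ℤ, y ≤ ⌊α * x⌋ →
      Function.Surjective (biMap f x y) ∧ Function.Injective (biMap f (x - 1) (y + 1)) := by
  have ceil_le_iff (x y : ℤ) : ⌈((x + y : ℤ) : ℝ) / (α + 1)⌉ ≤ x ↔ y ≤ ⌊α * x⌋ := by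
    rw [← not_lt, lt_ceil_iff hα, not_lt]
  have subsingleton_iff (x y : ℤ) : Subsingleton (bi (cofib f) x y) ↔
      Function.Surjective (biMap f x y) ∧ Function.Injective (biMap f (x - 1) (y + 1)) := by
    have injective_congr {m n : ℤ} (h : m = n) (k : ℤ) :
        Function.Injective (piMap (f.app (op m)) k) ↔
          Function.Injective (piMap (f.app (op n)) k) := by
      rw [h]
    exact (subsingleton_pi_cofib_iff (f.app (op (x + y))) (hX _) (hY _)
      (sub_add_cancel x 1)).trans
        (and_congr_right' (injective_congr (show x - 1 + (y + 1) = x + y by ring) _).symm)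
  constructor
  · exact fun h x y hy => (subsingleton_iff x y).1 (h (x + y) x ((ceil_le_iff x y).2 hy))
  · intro h n k hk
    obtain ⟨y, rfl⟩ : ∃ y, n = k + y := ⟨n - k, by omega⟩
    exact (subsingleton_iff k y).2 (h k y ((ceil_le_iff k y).1 hk))

theorem exhibitsCover_iff {α : ℝ} (hα : -1 < α) {X Y : Fil.{u}} (hX : X.IsSpectrum)
    (hY : Y.IsSpectrum) (f : X ⟶ Y) :
    ExhibitsCover α f ↔ (∀ x y : ℤ, ⌊α * x⌋ < y → Subsingleton (bi X x y)) ∧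
      ∀ x y : ℤ, y ≤ ⌊α * x⌋ → Function.Bijective (biMap f x y) := by
  rw [ExhibitsCover, isConnective_iff hα, isCoconnective_cofib_iff hα hX hY]
  refine and_congr_right fun connective => ⟨fun h x y hy => ⟨?_, (h x y hy).1⟩,
    fun h x y hy => ⟨(h x y hy).2, ?_⟩⟩
  · have floor_le := floor_le_floor_add_one hα (x + 1)
    have injective := (h (x + 1) (y - 1) (by rw [add_sub_cancel_right] at floor_le; omega)).2
    rwa [add_sub_cancel_right, sub_add_cancel] at injective
  · by_cases hy' : ⌊α * (x - 1 : ℤ)⌋ < y + 1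
    · exact fun a b _ => (connective _ _ hy').allEq a b
    · exact (h _ _ (not_lt.1 hy')).1

/-! ### Pages of the spectral sequence -/

theorem tau_delta_self {X : Fil.{u}} {x y x' y' y'' : ℤ} (hx : x' + 1 = x) (hy : y' = y + 2)
    (hy' : y'' = y + 2) (z : gr X x y) :
    tau X x' y' y'' (delta X hx hy z) = delta X hx hy' z := by
  subst hy hy'
  exact tau_self X _

theorem mem_cycles_iff {X : Fil.{u}} {r x y x' y' : ℤ} (hx : x' + 1 = x) (hy : y' = y + r)
    (z : gr X x y) : z ∈ cycles X r x y ↔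
      ∃ c : bi X x' y', delta X hx rfl z = tau X x' y' (y + 2) c := by
  obtain rfl : x' = x - 1 := by omega
  subst hy
  exact ⟨fun ⟨c, hc⟩ => ⟨c, hc.symm⟩, fun ⟨c, hc⟩ => ⟨c, hc.symm⟩⟩

theorem mem_cycles_of_delta_eq_zero {X : Fil.{u}} {r x y x' : ℤ} (hx : x' + 1 = x)
    {z : gr X x y} (hz : delta X hx rfl z = 0) : z ∈ cycles X r x y :=
  (mem_cycles_iff hx rfl z).2 ⟨0, by rw [hz, map_zero]⟩

theorem red_mem_cycles {X : Fil.{u}} (hX : X.IsSpectrum) (r : ℤ) {x y : ℤ} (a : bi X x y) :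
    red X x y a ∈ cycles X r x y :=
  mem_cycles_of_delta_eq_zero (sub_add_cancel x 1) (delta_red hX _ _ a)

theorem mem_boundaries_iff {X : Fil.{u}} {r x y y' : ℤ} (hy : y' = y - (r - 2))
    (z : gr X x y) : z ∈ boundaries X r x y ↔
      ∃ c : bi X x y, tau X x y y' c = 0 ∧ red X x y c = z := by
  subst hy
  exact Iff.rfl

theorem delta_eq_zero_of_mem_boundaries {X : Fil.{u}} (hX : X.IsSpectrum) {r x y x' y' : ℤ}
    (hx : x' + 1 = x) (hy : y' = y + 2) {z : gr X x y} (hz : z ∈ boundaries X r x y) :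
    delta X hx hy z = 0 := by
  obtain ⟨c, -, rfl⟩ := (mem_boundaries_iff rfl z).1 hz
  exact delta_red hX hx hy c

theorem exists_represents {X : Fil.{u}} {r x y : ℤ} (e : Page X r x y) :
    ∃ z : gr X x y, Represents z e := by
  obtain ⟨z, rfl⟩ := QuotientAddGroup.mk_surjective e
  exact ⟨z.1, z.2, rfl⟩

theorem exists_page {X : Fil.{u}} {r x y : ℤ} {z : gr X x y} (hz : z ∈ cycles X r x y) :
    ∃ e : Page X r x y, Represents z e := ⟨_, hz, rfl⟩

theorem Represents.eq_zero_iff {X : Fil.{u}} {r x y : ℤ} {z : gr X x y} {e : Page X r x y}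
    (h : Represents z e) : e = 0 ↔ z ∈ boundaries X r x y := by
  obtain ⟨hz, rfl⟩ := h
  exact QuotientAddGroup.eq_zero_iff _

theorem Represents.sub {X : Fil.{u}} {r x y : ℤ} {z z' : gr X x y} {e e' : Page X r x y}
    (h : Represents z e) (h' : Represents z' e') : Represents (z - z') (e - e') := by
  obtain ⟨hz, rfl⟩ := h
  obtain ⟨hz', rfl⟩ := h'
  exact ⟨sub_mem hz hz', rfl⟩

theorem Represents.eq_iff {X : Fil.{u}} {r x y : ℤ} {z z' : gr X x y} {e e' : Page X r x y}
    (h : Represents z e) (h' : Represents z' e') : e = e' ↔ z - z' ∈ boundaries X r x y := by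
  rw [← sub_eq_zero, (h.sub h').eq_zero_iff]

theorem Represents.map {X Y : Fil.{u}} (f : X ⟶ Y) {r x y : ℤ} {z : gr X x y}
    {e : Page X r x y} (h : Represents z e) :
    Represents (grMap f x y z) (pageMap f r x y e) := by
  obtain ⟨hz, rfl⟩ := h
  exact ⟨grMap_mem_cycles f r x y hz, rfl⟩

theorem Represents.congr {X : Fil.{u}} {r x y : ℤ} {z z' : gr X x y} {e : Page X r x y}
    (h : Represents z e) (hz' : z' ∈ cycles X r x y) (hb : z - z' ∈ boundaries X r x y) :
    Represents z' e := by
  obtain ⟨e', he'⟩ := exists_page hz'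
  rwa [(h.eq_iff he').2 hb]

theorem Represents.delta_eq {X : Fil.{u}} (hX : X.IsSpectrum) {r x y x' y' : ℤ}
    {z z' : gr X x y} {e : Page X r x y} (h : Represents z e) (h' : Represents z' e)
    (hx : x' + 1 = x) (hy : y' = y + 2) : delta X hx hy z = delta X hx hy z' := by
  rw [← sub_eq_zero, ← map_sub]
  exact delta_eq_zero_of_mem_boundaries hX hx hy ((h.eq_iff h').1 rfl)

theorem exists_tau_eq_of_red_mem_boundaries {X : Fil.{u}} (hX : X.IsSpectrum) {r x y y₁ y' : ℤ}
    (hr : 2 ≤ r) (hy₁ : y₁ = y + 1) (hy' : y' = y - (r - 2)) {c : bi X x y}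
    (hc : red X x y c ∈ boundaries X r x y) :
    ∃ d : bi X x y₁, tau X x y₁ y' d = tau X x y y' c := by
  obtain ⟨c', torsion, red_eq⟩ := (mem_boundaries_iff hy' _).1 hc
  obtain ⟨d, hd⟩ := (red_eq_zero_iff hX hy₁ (c - c')).1 (by rw [map_sub, red_eq, sub_self])
  exact ⟨d, by rw [← tau_tau X (by omega : y ≤ y₁) (by omega), hd, map_sub, torsion, sub_zero]⟩

theorem exists_tau_eq_of_step {X : Fil.{u}} {x y y₀ y₁ : ℤ} {a : bi X x y₀} (hy : y ≤ y₁)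
    (h : ∃ c : bi X x y, tau X x y y₀ c = a)
    (step : ∀ z, y ≤ z → z < y₁ → ∀ c : bi X x z, tau X x z y₀ c = a →
      ∃ d : bi X x (z + 1), tau X x (z + 1) y₀ d = a) :
    ∃ c : bi X x y₁, tau X x y₁ y₀ c = a := by
  have exists_tau_eq (z : ℤ) (hz : y ≤ z) : z ≤ y₁ → ∃ c : bi X x z, tau X x z y₀ c = a := by
    induction z, hz using Int.leInduction with
    | base => exact fun _ => h
    | succ z hz ih =>
      intro hz₁
      obtain ⟨c, hc⟩ := ih (by omega)
      exact step z hz (by omega) c hc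
  exact exists_tau_eq y₁ hy le_rfl

/-! ### The criterion -/

/-- The description of connective covers in terms of bigraded homotopy groups; `L x` is the
height of the line over `x`. -/
structure IsBiCover (L : ℤ → ℤ) {X Y : Fil.{u}} (f : X ⟶ Y) : Prop where
  eq_zero : ∀ {x y : ℤ}, L x < y → ∀ a : bi X x y, a = 0
  bijective : ∀ {x y : ℤ}, y ≤ L x → Function.Bijective (biMap f x y)

/-- The conditions on the maps of pages that recognise a connective cover; `L x` is the height of
the line over `x`. -/
structure PageComparison (L : ℤ → ℤ) {X Y : Fil.{u}} (f : X ⟶ Y) : Prop where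
  bijective : ∀ {r x y : ℤ}, 2 ≤ r → y + r ≤ L (x - 1) → Function.Bijective (pageMap f r x y)
  injective : ∀ {r x y : ℤ}, 2 ≤ r → y ≠ L x → Function.Injective (pageMap f r x y)

section Sufficiency

variable {X Y : Fil.{u}} {f : X ⟶ Y} {L : ℤ → ℤ}

theorem IsComplete.eq_zero_of_gr (hXs : X.IsSpectrum) (hX : IsComplete X)
    (hgr : ∀ x y : ℤ, L x < y → Subsingleton (gr X x y)) {x y : ℤ} (hy : L x < y)
    (a : bi X x y) : a = 0 := by
  have exists_division (j : ℕ) (c : bi X x (y + j)) : ∃ c' : bi X x (y + ((j + 1 : ℕ) : ℤ)),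
      tau X x (y + ((j + 1 : ℕ) : ℤ)) (y + j) c' = c :=
    (red_eq_zero_iff hXs (by push_cast; ring) c).1 ((hgr x (y + j) (by omega)).allEq _ _)
  choose division tau_division using exists_division
  have hy₀ : y + ((0 : ℕ) : ℤ) = y := by simp
  have tau_eq_zero := hX.eq_zero_of_compatible
    (fun j => Nat.rec (motive := fun j : ℕ => bi X x (y + j)) (tau X x y _ a) division j)
    fun j => tau_division j _
  rw [← tau_self X a, ← tau_tau X hy₀.le hy₀.ge]
  exact (congrArg _ tau_eq_zero).trans (map_zero _)

theorem red_eq_zero_of_grMap_eq_zero (hX : X.IsSpectrum) {x y : ℤ}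
    (injective : Function.Injective (pageMap f 2 x y)) {a : bi X x y}
    (ha : grMap f x y (red X x y a) = 0) : red X x y a = 0 := by
  obtain ⟨e, he⟩ := exists_page (red_mem_cycles hX 2 a)
  have map_e_eq_zero : pageMap f 2 x y e = 0 := by
    rw [(he.map f).eq_zero_iff, ha]
    exact zero_mem _
  obtain ⟨c, hc, red_c⟩ := (mem_boundaries_iff (show y = y - (2 - 2) by ring) _).1
    (he.eq_zero_iff.1 ((map_eq_zero_iff _ injective).1 map_e_eq_zero))
  rw [tau_self] at hc
  rw [← red_c, hc, map_zero]

theorem exists_grMap_eq_of_delta_eq_zero (hX : X.IsSpectrum) (hY : Y.IsSpectrum) {x y x' y' : ℤ}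
    (surjective : Function.Surjective (biMap f x y)) (hx : x' + 1 = x) (hy : y' = y + 2)
    {w : gr Y x y} (hw : delta Y hx hy w = 0) :
    ∃ z : gr X x y, delta X hx hy z = 0 ∧ grMap f x y z = w := by
  obtain ⟨b, rfl⟩ := (delta_eq_zero_iff hY hx hy w).1 hw
  obtain ⟨a, rfl⟩ := surjective b
  exact ⟨red X x y a, delta_red hX hx hy a, red_natural f x y a⟩

namespace PageComparison

theorem exists_lift_of_lift_tau (hp : PageComparison L f) (hX : X.IsSpectrum)
    (hY : Y.IsSpectrum) {x y y₁ : ℤ} (hy : y < L x) (hy₁ : y₁ = y + 1) {b : bi Y x y₁}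
    {a : bi X x y} (h : biMap f x y a = tau Y x y₁ y b) : ∃ a', biMap f x y₁ a' = b := by
  have red_eq_zero : red X x y a = 0 := by
    refine red_eq_zero_of_grMap_eq_zero hX (hp.injective le_rfl hy.ne) ?_
    rw [red_natural, h, red_tau hY (by omega)]
  obtain ⟨a', rfl⟩ := (red_eq_zero_iff hX hy₁ a).1 red_eq_zero
  have tau_sub_eq_zero : tau Y x y₁ y (b - biMap f x y₁ a') = 0 := by
    rw [map_sub, ← tau_natural, h, sub_self]
  obtain ⟨z, hz⟩ := (tau_eq_zero_iff (x := x + 1) (y := y - 1) rfl (by omega) (by ring) _).1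
    tau_sub_eq_zero
  obtain ⟨e, he⟩ := exists_page ((mem_cycles_iff rfl rfl z).2
    ⟨delta Y rfl rfl z, (tau_self Y _).symm⟩ : z ∈ cycles Y 2 (x + 1) (y - 1))
  obtain ⟨e₀, rfl⟩ := (hp.bijective le_rfl (by rw [add_sub_cancel_right]; omega)).2 e
  obtain ⟨z₀, hz₀⟩ := exists_represents e₀
  refine ⟨a' + delta X (x := x + 1) (y := y - 1) rfl (by omega) z₀, ?_⟩
  rw [map_add, delta_natural, (hz₀.map f).delta_eq hY he, hz, add_sub_cancel]

theorem exists_lift (hp : PageComparison L f) (hX : X.IsSpectrum) (hY : Y.IsSpectrum)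
    (hf : TauInvEquiv f) {x y : ℤ} (hy : y ≤ L x) (b : bi Y x y) : ∃ a, biMap f x y a = b := by
  obtain ⟨n, hn, a, ha⟩ := hf.exists_lift hY b
  obtain ⟨y₀, rfl⟩ : ∃ y₀, n = x + y₀ := ⟨n - x, by omega⟩
  have exists_lift_tau (z : ℤ) (hz : y₀ ≤ z) :
      z ≤ y → ∃ a, biMap f x z a = tau Y x y z b := by
    induction z, hz using Int.leInduction with
    | base => exact fun hy₀ => ⟨a, ha.trans (tau_eq Y hy₀ b).symm⟩
    | succ z _ ih =>
      intro hzy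
      obtain ⟨a, ha⟩ := ih (by omega)
      refine hp.exists_lift_of_lift_tau hX hY (by omega) rfl (ha.trans ?_)
      rw [tau_tau Y hzy (by omega)]
  obtain ⟨a, ha⟩ := exists_lift_tau y (by omega) le_rfl
  exact ⟨a, ha.trans (tau_self Y b)⟩

theorem exists_division_to_line (hp : PageComparison L f) (hX : X.IsSpectrum) {x y : ℤ}
    (hy : y ≤ L x) {a : bi X x y} (ha : biMap f x y a = 0) :
    ∃ c : bi X x (L x), tau X x (L x) y c = a := by
  refine exists_tau_eq_of_step hy ⟨a, tau_self X a⟩ fun z hyz hz c hc => ?_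
  obtain ⟨e, he⟩ := exists_page (red_mem_cycles hX (z - y + 2) c)
  have map_e_eq_zero : pageMap f (z - y + 2) x z e = 0 := by
    rw [(he.map f).eq_zero_iff, red_natural]
    refine (mem_boundaries_iff (show y = _ by ring) _).2 ⟨_, ?_, rfl⟩
    rw [← tau_natural, hc, ha]
  have injective := hp.injective (show 2 ≤ z - y + 2 by omega) hz.ne
  obtain ⟨d, hd⟩ := exists_tau_eq_of_red_mem_boundaries hX (by omega) rfl (show y = _ by ring)
    (he.eq_zero_iff.1 ((map_eq_zero_iff _ injective).1 map_e_eq_zero))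
  exact ⟨d, hd.trans hc⟩

/-- If `δ z = τ ^ i c`, then `z` lives to a page on which `f` is injective; subtracting a lift of
the permanent cycle `f z` moves it into the kernel of `f`. -/
theorem tau_eq_zero_of_tau_sub_one_eq_zero (hp : PageComparison L f)
    (hL : ∀ x, L (x - 1) ≤ L x + 1) (hX : X.IsSpectrum) (hY : Y.IsSpectrum) (hf : TauInvEquiv f)
    {x y : ℤ} (hy : y ≤ L x) (c : bi X x (L x)) (map_tau : biMap f x y (tau X x (L x) y c) = 0)
    (tau_eq_zero : tau X x (L x) (y - 1) c = 0) : tau X x (L x) y c = 0 := by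
  have hLx := hL (x + 1)
  rw [add_sub_cancel_right] at hLx
  have hy₂ : y = y - 2 + 2 := by ring
  obtain ⟨z, hz⟩ := (tau_eq_zero_iff (x := x + 1) rfl hy₂ (show y - 1 = y - 2 + 1 by ring)
    (tau X x (L x) y c)).1 (by rw [tau_tau X hy (by omega), tau_eq_zero])
  have map_z_permanent : delta Y rfl hy₂ (grMap f (x + 1) (y - 2) z) = 0 := by
    rw [← delta_natural, hz, map_tau]
  obtain ⟨z₀, delta_z₀, map_z₀⟩ := exists_grMap_eq_of_delta_eq_zero hX hY
    (fun b => hp.exists_lift hX hY hf (by omega) b) rfl hy₂ map_z_permanent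
  have delta_sub : delta X rfl hy₂ (z - z₀) = tau X x (L x) y c := by
    rw [map_sub, hz, delta_z₀, sub_zero]
  have sub_mem_cycles : z - z₀ ∈ cycles X (L x - y + 2) (x + 1) (y - 2) :=
    (mem_cycles_iff rfl (show L x = _ by ring) _).2 ⟨c, by
      rw [← tau_delta_self rfl hy₂ rfl, delta_sub, tau_tau X hy (by omega)]⟩
  obtain ⟨e, he⟩ := exists_page sub_mem_cycles
  have map_e_eq_zero : pageMap f (L x - y + 2) (x + 1) (y - 2) e = 0 := by
    rw [(he.map f).eq_zero_iff, map_sub, map_z₀, sub_self]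
    exact zero_mem _
  have injective := (hp.bijective (show 2 ≤ L x - y + 2 by omega)
    (show y - 2 + _ ≤ L (x + 1 - 1) by rw [add_sub_cancel_right]; omega)).1
  rw [← delta_sub]
  exact delta_eq_zero_of_mem_boundaries hX rfl hy₂
    (he.eq_zero_iff.1 ((map_eq_zero_iff _ injective).1 map_e_eq_zero))

theorem eq_zero (hp : PageComparison L f) (hL : ∀ x, L (x - 1) ≤ L x + 1)
    (hX : X.IsSpectrum) (hY : Y.IsSpectrum) (hf : TauInvEquiv f) {x y : ℤ} (hy : y ≤ L x)
    (a : bi X x y) (ha : biMap f x y a = 0) : a = 0 := by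
  obtain ⟨c, rfl⟩ := hp.exists_division_to_line hX hy ha
  obtain ⟨n, hn, torsion⟩ := hf.exists_eq_zero hX hY _ ha
  obtain ⟨y₀, rfl⟩ : ∃ y₀, n = x + y₀ := ⟨n - x, by omega⟩
  rw [← tau_eq X (by omega), tau_tau X hy (by omega)] at torsion
  have tau_eq_zero (z : ℤ) (hz : y₀ ≤ z) : z ≤ y → tau X x (L x) z c = 0 := by
    induction z, hz using Int.leInduction with
    | base => exact fun _ => torsion
    | succ z _ ih =>
      intro hzy
      refine hp.tau_eq_zero_of_tau_sub_one_eq_zero hL hX hY hf (by omega) c ?_ ?_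
      · rw [← tau_tau X hy hzy, tau_natural, ha, map_zero]
      · rw [add_sub_cancel_right, ih (by omega)]
  exact tau_eq_zero y (by omega) le_rfl

theorem isBiCover (hp : PageComparison L f) (hL : ∀ x, L (x - 1) ≤ L x + 1)
    (hXs : X.IsSpectrum) (hYs : Y.IsSpectrum) (hX : IsComplete X)
    (hgr : ∀ x y : ℤ, L x < y → Subsingleton (gr X x y)) (hf : TauInvEquiv f) :
    IsBiCover L f where
  eq_zero := hX.eq_zero_of_gr hXs hgr
  bijective hy := ⟨(injective_iff_map_eq_zero _).2 (hp.eq_zero hL hXs hYs hf hy),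
    hp.exists_lift hXs hYs hf hy⟩

end PageComparison

end Sufficiency

/-! ### Pages of a connective cover -/

theorem IsDiff.map {X Y : Fil.{u}} (f : X ⟶ Y) {r x y x' y' : ℤ} {z : Page X r x y}
    {w : Page X r x' y'} (h : IsDiff z w) :
    IsDiff (pageMap f r x y z) (pageMap f r x' y' w) := by
  obtain ⟨hx, hy, a, c, ha, hc, hw⟩ := h
  refine ⟨hx, hy, grMap f x y a, biMap f x' y' c, ha.map f, ?_, ?_⟩
  · rw [← delta_natural, hc, tau_natural]
  · rw [← red_natural]
    exact hw.map f

namespace IsBiCover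

variable {X Y : Fil.{u}} {f : X ⟶ Y} {L : ℤ → ℤ}

theorem injective (hf : IsBiCover L f) (x y : ℤ) : Function.Injective (biMap f x y) := by
  by_cases hy : y ≤ L x
  · exact (hf.bijective hy).1
  · exact fun a b _ => (hf.eq_zero (not_le.1 hy) a).trans (hf.eq_zero (not_le.1 hy) b).symm

theorem map_eq_zero_iff (hf : IsBiCover L f) {x y : ℤ} {a : bi X x y} :
    biMap f x y a = 0 ↔ a = 0 :=
  _root_.map_eq_zero_iff _ (hf.injective x y)

theorem subsingleton_gr (hf : IsBiCover L f) (hL : ∀ x, L (x - 1) ≤ L x + 1)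
    (hX : X.IsSpectrum) {x y : ℤ} (hy : L x < y) : Subsingleton (gr X x y) := by
  refine subsingleton_of_forall_eq 0 fun z => ?_
  have hLx := hL x
  obtain ⟨a, rfl⟩ := (delta_eq_zero_iff hX (sub_add_cancel x 1) rfl z).1
    (hf.eq_zero (by omega) _)
  rw [hf.eq_zero hy a, map_zero]

theorem exists_red_of_pageMap_eq_zero (hf : IsBiCover L f) (hX : X.IsSpectrum)
    (hY : Y.IsSpectrum) {r x y : ℤ} (hy : y ≤ L x) {e : Page X r x y}
    (he : pageMap f r x y e = 0) :
    ∃ (a : bi X x y) (b : bi Y x (y + 1)), Represents (red X x y a) e ∧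
      biMap f x y a = tau Y x (y + 1) y b := by
  obtain ⟨z, hz⟩ := exists_represents e
  obtain ⟨c, torsion, red_c⟩ := (mem_boundaries_iff rfl _).1 ((hz.map f).eq_zero_iff.1 he)
  obtain ⟨c, rfl⟩ := (hf.bijective hy).2 c
  rw [← tau_natural, hf.map_eq_zero_iff] at torsion
  have map_sub_eq_zero : grMap f x y (z - red X x y c) = 0 := by
    rw [map_sub, red_natural, red_c, sub_self]
  have delta_sub_eq_zero : delta X (sub_add_cancel x 1) rfl (z - red X x y c) = 0 := by
    rw [← hf.map_eq_zero_iff, delta_natural, map_sub_eq_zero, map_zero]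
  obtain ⟨a, ha⟩ := (delta_eq_zero_iff hX _ _ _).1 delta_sub_eq_zero
  obtain ⟨b, hb⟩ := (Fil.red_eq_zero_iff hY rfl (biMap f x y a)).1 (by
    rw [← red_natural, ha, map_sub_eq_zero])
  refine ⟨a, b, hz.congr (red_mem_cycles hX r a) ?_, hb.symm⟩
  rw [ha, sub_sub_cancel]
  exact (mem_boundaries_iff rfl _).2 ⟨c, torsion, rfl⟩

theorem pageMap_injective (hf : IsBiCover L f) (hL : ∀ x, L (x - 1) ≤ L x + 1)
    (hX : X.IsSpectrum) (hY : Y.IsSpectrum) {r x y : ℤ} (hy : y ≠ L x) :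
    Function.Injective (pageMap f r x y) := by
  rw [injective_iff_map_eq_zero]
  intro e he
  by_cases hy' : y ≤ L x
  · obtain ⟨a, b, ha, hab⟩ := hf.exists_red_of_pageMap_eq_zero hX hY hy' he
    obtain ⟨c, rfl⟩ := (hf.bijective (by omega)).2 b
    rw [← tau_natural] at hab
    rw [ha.eq_zero_iff, hf.injective _ _ hab, red_tau hX (by omega)]
    exact zero_mem _
  · obtain ⟨z, hz⟩ := exists_represents e
    have z_eq_zero : z = 0 := (hf.subsingleton_gr hL hX (not_le.1 hy')).allEq z 0
    rw [hz.eq_zero_iff, z_eq_zero]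
    exact zero_mem _

theorem pageMap_surjective (hf : IsBiCover L f) (hL : ∀ x, L (x - 1) ≤ L x + 1)
    (hX : X.IsSpectrum) (hY : Y.IsSpectrum) {r x y : ℤ} (hr : 2 ≤ r) (hy : y + r ≤ L (x - 1)) :
    Function.Surjective (pageMap f r x y) := by
  intro e
  have hLx := hL x
  have hx := sub_add_cancel x 1
  obtain ⟨w, hw⟩ := exists_represents e
  obtain ⟨c, delta_w⟩ := (mem_cycles_iff hx rfl w).1 hw.1
  obtain ⟨c, rfl⟩ := (hf.bijective hy).2 c
  have torsion : tau X (x - 1) (y + 2) (y + 1) (tau X (x - 1) (y + r) (y + 2) c) = 0 := by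
    rw [← hf.map_eq_zero_iff, tau_natural, tau_natural, ← delta_w, tau_delta _ _ (by omega)]
  obtain ⟨z, hz⟩ := (tau_eq_zero_iff hx rfl rfl _).1 torsion
  obtain ⟨b, hb⟩ := (delta_eq_zero_iff hY hx rfl (w - grMap f x y z)).1 (by
    rw [map_sub, ← delta_natural, hz, tau_natural, delta_w, sub_self])
  obtain ⟨a, rfl⟩ := (hf.bijective (by omega)).2 b
  obtain ⟨e₀, he₀⟩ := exists_page
    (add_mem ((mem_cycles_iff hx rfl z).2 ⟨c, hz⟩) (red_mem_cycles hX r a))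
  refine ⟨e₀, ((he₀.map f).eq_iff hw).2 ?_⟩
  rw [map_add, red_natural, hb, add_sub_cancel, sub_self]
  exact zero_mem _

theorem pageComparison (hf : IsBiCover L f) (hL : ∀ x, L (x - 1) ≤ L x + 1)
    (hX : X.IsSpectrum) (hY : Y.IsSpectrum) : PageComparison L f where
  bijective {_ x _} hr hy := by
    have hLx := hL x
    exact ⟨hf.pageMap_injective hL hX hY (by omega), hf.pageMap_surjective hL hX hY hr hy⟩
  injective _ hy := hf.pageMap_injective hL hX hY hy

theorem mem_range_pageMap_iff (hf : IsBiCover L f) (hX : X.IsSpectrum) (hY : Y.IsSpectrum)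
    {r x y : ℤ} (hr : L (x - 1) < y + r) (hy : y ≤ L x) (e : Page Y r x y) :
    (∃ e₀, pageMap f r x y e₀ = e) ↔ IsPermanentCycle e := by
  constructor
  · rintro ⟨e₀, rfl⟩
    obtain ⟨z, hz⟩ := exists_represents e₀
    obtain ⟨c, delta_z⟩ := (mem_cycles_iff (sub_add_cancel x 1) rfl z).1 hz.1
    refine ⟨_, hz.map f, ?_⟩
    rw [← delta_natural, delta_z, hf.eq_zero hr c, map_zero, map_zero]
  · rintro ⟨w, hw, delta_w⟩
    obtain ⟨z, delta_z, rfl⟩ := exists_grMap_eq_of_delta_eq_zero hX hY (hf.bijective hy).2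
      (sub_add_cancel x 1) rfl delta_w
    obtain ⟨e₀, he₀⟩ := exists_page (mem_cycles_of_delta_eq_zero (sub_add_cancel x 1) delta_z)
    refine ⟨e₀, ((he₀.map f).eq_iff hw).2 ?_⟩
    rw [sub_self]
    exact zero_mem _

theorem red_eq_zero_iff (hf : IsBiCover L f) (hX : X.IsSpectrum) {x : ℤ} (a : bi X x (L x)) :
    red X x (L x) a = 0 ↔ a = 0 := by
  refine ⟨fun h => ?_, fun h => by rw [h, map_zero]⟩
  obtain ⟨c, rfl⟩ := (Fil.red_eq_zero_iff hX rfl a).1 h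
  rw [hf.eq_zero (by omega) c, map_zero]

theorem red_mem_boundaries_iff (hf : IsBiCover L f) (hX : X.IsSpectrum) {r x : ℤ}
    (a : bi X x (L x)) :
    red X x (L x) a ∈ boundaries X r x (L x) ↔ tau X x (L x) (L x - (r - 2)) a = 0 := by
  rw [mem_boundaries_iff rfl]
  refine ⟨?_, fun h => ⟨a, h, rfl⟩⟩
  rintro ⟨c, hc, hca⟩
  rw [← sub_eq_zero, ← map_sub, hf.red_eq_zero_iff hX, sub_eq_zero] at hca
  rwa [← hca]

end IsBiCover

/-! ### Strongly complete targets -/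

namespace IsStronglyComplete

theorem eq_zero_of_step {Y : Fil.{u}} (hY : IsStronglyComplete Y) {x y y₀ : ℤ} (hy : y₀ ≤ y)
    {a : bi Y x y₀} (h : ∃ c : bi Y x y, tau Y x y y₀ c = a)
    (step : ∀ z, y ≤ z → ∀ c : bi Y x z, tau Y x z y₀ c = a →
      ∃ d : bi Y x (z + 1), tau Y x (z + 1) y₀ d = a) : a = 0 := by
  refine hY.eq_zero_of_divisible a fun j => ?_
  obtain ⟨c, hc⟩ := exists_tau_eq_of_step (by omega : y ≤ y + j) h fun z hz _ => step z hz
  exact ⟨tau Y x _ (y₀ + j) c, by rw [tau_tau Y (by omega) (by omega), hc]⟩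

theorem exists_division {Y : Fil.{u}} (hYs : Y.IsSpectrum) (hY : IsStronglyComplete Y)
    {x y y₀ : ℤ} (hy : y₀ ≤ y) (b : bi Y x y) (hb : tau Y x y y₀ b ≠ 0) :
    ∃ (y' : ℤ) (_ : y ≤ y') (b' : bi Y x y'), tau Y x y' y₀ b' = tau Y x y y₀ b ∧
      ∀ r, y₀ = y' - (r - 2) → red Y x y' b' ∉ boundaries Y r x y' := by
  by_contra! divisible
  refine hb (hY.eq_zero_of_step hy ⟨b, rfl⟩ fun z hz c hc => ?_)
  obtain ⟨r, hr, red_mem⟩ := divisible z hz c hc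
  obtain ⟨d, hd⟩ := exists_tau_eq_of_red_mem_boundaries hYs (by omega) rfl hr red_mem
  exact ⟨d, hd.trans hc⟩

end IsStronglyComplete

theorem not_supportsLineCrossing {α : ℝ} {X : Fil.{u}} (hX : X.IsSpectrum) {r x y : ℤ}
    {e : Page X r x y} (he : IsPermanentCycle e) :
    ¬ SupportsLineCrossing α e := by
  rintro ⟨s, e', w, -, ⟨z, hz, hz'⟩, ⟨hx, -, z₁, c, hz₁, delta_z₁, hw⟩, w_ne_zero, -⟩
  obtain ⟨z₀, hz₀, delta_z₀⟩ := he
  have torsion : tau X (x - 1) (y + s) (y + 2) c = 0 := by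
    rw [← delta_z₁, hz₁.delta_eq hX hz' hx rfl, hz.delta_eq hX hz₀ hx rfl, delta_z₀]
  exact w_ne_zero (hw.eq_zero_iff.2 ((mem_boundaries_iff (by ring) _).2 ⟨c, torsion, rfl⟩))

theorem red_mem_boundaries_of_not_supportsLineCrossing {α : ℝ} {Y : Fil.{u}} (hY : Y.IsSpectrum)
    {r s x y y' : ℤ} {e : Page Y r x y} (he : ¬ SupportsLineCrossing α e)
    (hy : (y : ℝ) ≤ α * x) (hr : α * (x - 1) < y + r) (hs : r ≤ s) (hy' : y' = y + s)
    {z : gr Y x y} (hz : Represents z e) {c : bi Y (x - 1) y'}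
    (delta_z : delta Y (sub_add_cancel x 1) rfl z = tau Y (x - 1) y' (y + 2) c) :
    red Y (x - 1) y' c ∈ boundaries Y s (x - 1) y' := by
  subst hy'
  obtain ⟨e', he'⟩ := exists_page ((mem_cycles_iff (r := s) (sub_add_cancel x 1) rfl z).2
    ⟨c, delta_z⟩)
  obtain ⟨w, hw⟩ := exists_page (red_mem_cycles hY s c)
  rw [← hw.eq_zero_iff]
  by_contra w_ne_zero
  have hs' : (r : ℝ) ≤ s := by exact_mod_cast hs
  exact he ⟨s, e', w, hs, ⟨z, hz, he'⟩,
    ⟨sub_add_cancel x 1, rfl, z, c, he', delta_z, hw⟩, w_ne_zero, hy, by linarith⟩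

theorem IsStronglyComplete.isPermanentCycle {α : ℝ} {Y : Fil.{u}} (hYs : Y.IsSpectrum)
    (hY : IsStronglyComplete Y) {r x y : ℤ} (hr : 2 ≤ r) (hr' : α * (x - 1) < y + r)
    (hy : (y : ℝ) ≤ α * x) {e : Page Y r x y} (he : ¬ SupportsLineCrossing α e) :
    IsPermanentCycle e := by
  obtain ⟨z, hz⟩ := exists_represents e
  obtain ⟨c, delta_z⟩ := (mem_cycles_iff (sub_add_cancel x 1) rfl z).1 hz.1
  refine ⟨z, hz, hY.eq_zero_of_step (by omega) ⟨c, delta_z.symm⟩ fun y' hy' d hd => ?_⟩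
  obtain ⟨d', tau_d'⟩ := exists_tau_eq_of_red_mem_boundaries hYs (by omega) rfl
    (show y + 2 = _ by ring) (red_mem_boundaries_of_not_supportsLineCrossing hYs he hy hr'
      (show r ≤ y' - y by omega) (by ring) hz hd.symm)
  exact ⟨d', tau_d'.trans hd⟩

/-! ### Dropped lifts and differentials -/

theorem isTorsionOrder_of_delta {α : ℝ} {Y : Fil.{u}} {r x₁ y₁ x y : ℤ} (hr : 2 ≤ r)
    (hx : x + 1 = x₁) (hy₁ : ⌊α * x⌋ = y₁ + r) (hy : ⌊α * x⌋ < y) {b : bi Y x y}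
    {w : gr Y x₁ y₁} (hw : delta Y hx rfl w = tau Y x y (y₁ + 2) b)
    (hw0 : delta Y hx rfl w ≠ 0) : IsTorsionOrder α b r := by
  refine ⟨by omega, ?_, fun s hs hsr torsion => hw0 ?_⟩
  · rw [← tau_tau Y (by omega : y₁ + 2 ≤ y) (by omega), ← hw, tau_delta _ _ (by omega)]
  · rw [hw, ← tau_tau Y (by omega : ⌊α * x⌋ - (s - 1) ≤ y) (by omega), torsion, map_zero]

theorem IsTorsionOrder.tau_ne_zero {α : ℝ} {Y : Fil.{u}} {r x y : ℤ} {b : bi Y x y}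
    (hr : IsTorsionOrder α b r) (hb : Drops α b) : tau Y x y (⌊α * x⌋ - (r - 2)) b ≠ 0 := by
  obtain ⟨one_lt, -, minimal⟩ := hr
  obtain rfl | two_lt : r = 2 ∨ 2 < r := by omega
  · rw [sub_self, sub_zero]
    exact hb.2.2
  · rw [show r - 2 = r - 1 - 1 by ring]
    exact minimal (r - 1) (by omega) (by omega)

theorem hitsDropping_of_delta {α : ℝ} (hα : -1 < α) {Y : Fil.{u}} (hY : Y.IsSpectrum)
    {r x₁ y₁ x y : ℤ} (hr : 2 ≤ r) (hx : x + 1 = x₁) (hy₁ : ⌊α * x⌋ = y₁ + r)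
    (hy : ⌊α * x⌋ < y) {b : bi Y x y} {w : gr Y x₁ y₁}
    (hw : delta Y hx rfl w = tau Y x y (y₁ + 2) b) {e : Page Y r x₁ y₁} (he : Represents w e) :
    HitsDropping α e b := by
  have hyr : y = y₁ + (y - ⌊α * x⌋ + r) := by omega
  obtain ⟨z', hz'⟩ := exists_page ((mem_cycles_iff hx hyr w).2 ⟨b, hw⟩)
  obtain ⟨v, hv⟩ := exists_page (red_mem_cycles hY (y - ⌊α * x⌋ + r) b)
  have isDiff : IsDiff z' v := ⟨hx, hyr, w, b, hz', hw, hv⟩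
  refine ⟨z', v, ⟨w, he, hz'⟩, hv, isDiff, fun hv0 => ⟨isDiff, hv0, ?_, ?_⟩⟩
  · have floor_le := floor_le_floor_add_one hα x₁
    rw [show x₁ - 1 = x by omega] at floor_le
    exact Int.le_floor.1 (by omega)
  · have target_eq : (y₁ : ℝ) + ((y - ⌊α * x⌋ + r : ℤ) : ℝ) = y := by
      exact_mod_cast hyr.symm
    rw [target_eq, ← hx]
    push_cast
    rw [add_sub_cancel_right]
    exact Int.floor_lt.1 hy

section Line

variable {α : ℝ} {X Y : Fil.{u}} {f : X ⟶ Y}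

theorem exhibitsCover_iff_isBiCover (hα : -1 < α) (hX : X.IsSpectrum) (hY : Y.IsSpectrum) :
    ExhibitsCover α f ↔ IsBiCover (fun x => ⌊α * x⌋) f := by
  rw [exhibitsCover_iff hα hX hY]
  exact ⟨fun h => ⟨fun hy a => (h.1 _ _ hy).allEq _ _, fun hy => h.2 _ _ hy⟩,
    fun h => ⟨fun x y hy => subsingleton_of_forall_eq 0 (h.eq_zero hy), fun x y => h.bijective⟩⟩

theorem le_mul_sub_one_iff (x y r : ℤ) :
    (y + r : ℝ) ≤ α * (x - 1) ↔ y + r ≤ ⌊α * (x - 1 : ℤ)⌋ := by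
  rw [Int.le_floor]
  push_cast
  rfl

theorem PageConditions.pageComparison {S : ∀ {r x y : ℤ}, Page Y r x y → Prop}
    (h : PageConditions α f S) : PageComparison (fun x => ⌊α * x⌋) f where
  bijective {r x y} hr hy := h.bijective r x y hr ((le_mul_sub_one_iff x y r).2 hy)
  injective {r x y} hr hy := h.injective r x y hr hy

theorem PageConditions.exhibitsCover {S : ∀ {r x y : ℤ}, Page Y r x y → Prop}
    (h : PageConditions α f S) (hα : -1 < α) (hXs : X.IsSpectrum) (hYs : Y.IsSpectrum)
    (hX : IsComplete X) (hconn : IsConnective α (modTau X 1)) (hf : TauInvEquiv f) :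
    ExhibitsCover α f :=
  (exhibitsCover_iff_isBiCover hα hXs hYs).2 (h.pageComparison.isBiCover
    (floor_le_floor_add_one hα) hXs hYs hX ((isConnective_iff hα _).1 hconn) hf)

namespace IsBiCover

theorem pageConditions (hα : -1 < α) (hX : X.IsSpectrum) (hY : Y.IsSpectrum)
    (hf : IsBiCover (fun x => ⌊α * x⌋) f) {S : ∀ {r x y : ℤ}, Page Y r x y → Prop}
    (hS : ∀ {r x y : ℤ}, 2 ≤ r → α * (x - 1) < y + r → (y : ℝ) ≤ α * x →
      ∀ e : Page Y r x y, IsPermanentCycle e ↔ S e) : PageConditions α f S where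
  bijective r x y hr hy := (hf.pageComparison (floor_le_floor_add_one hα) hX hY).bijective hr
    ((le_mul_sub_one_iff x y r).1 hy)
  image r x y hr hy hy' e := by
    rw [← hS hr hy hy' e]
    rw [← not_le, le_mul_sub_one_iff, not_le] at hy
    exact hf.mem_range_pageMap_iff hX hY hy (Int.le_floor.2 hy') e
  injective r x y _ hy := hf.pageMap_injective (floor_le_floor_add_one hα) hX hY hy

theorem isStronglyComplete (hX : X.IsSpectrum)
    (hf : IsBiCover (fun x => ⌊α * x⌋) f) : IsStronglyComplete X := by
  refine isStronglyComplete_of_subsingleton hX fun k => ⟨k + ⌊α * k⌋ + 1, fun n hn => ?_⟩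
  obtain ⟨y, rfl⟩ : ∃ y, n = k + y := ⟨n - k, by omega⟩
  exact subsingleton_of_forall_eq 0 (hf.eq_zero (by omega))

theorem tauInvEquiv (hX : X.IsSpectrum) (hY : Y.IsSpectrum)
    (hf : IsBiCover (fun x => ⌊α * x⌋) f) : TauInvEquiv f := by
  refine tauInvEquiv_of_bijective hX hY fun k => ⟨k + ⌊α * k⌋, fun n hn => ?_⟩
  obtain ⟨y, rfl⟩ : ∃ y, n = k + y := ⟨n - k, by omega⟩
  exact hf.bijective (by omega)

theorem isConnective_modTau (hα : -1 < α) (hX : X.IsSpectrum)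
    (hf : IsBiCover (fun x => ⌊α * x⌋) f) : IsConnective α (modTau X 1) :=
  (isConnective_iff hα _).2 fun _ _ hy => hf.subsingleton_gr (floor_le_floor_add_one hα) hX hy

theorem existsUnique_isDroppedLift (hf : IsBiCover (fun x => ⌊α * x⌋) f) {x y : ℤ}
    {b : bi Y x y} (hb : Drops α b) : ∃! a : bi X x ⌊α * x⌋, IsDroppedLift α f b a := by
  obtain ⟨a, ha⟩ := (hf.bijective (le_refl ⌊α * x⌋)).2 (tau Y x y ⌊α * x⌋ b)
  exact ⟨a, ⟨hb, rfl, ha⟩, fun a' ha' => hf.injective _ _ (ha'.2.2.trans ha.symm)⟩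

theorem map_tau_droppedLift {x y y' : ℤ} {b : bi Y x y} {a : bi X x ⌊α * x⌋}
    (h : IsDroppedLift α f b a) (hy' : y' ≤ ⌊α * x⌋) :
    biMap f x y' (tau X x ⌊α * x⌋ y' a) = tau Y x y y' b := by
  rw [tau_natural, h.2.2, tau_tau Y (Int.floor_lt.2 h.1.1).le hy']

theorem tau_droppedLift_eq_zero_iff (hf : IsBiCover (fun x => ⌊α * x⌋) f) {x y y' : ℤ}
    {b : bi Y x y} {a : bi X x ⌊α * x⌋} (h : IsDroppedLift α f b a) (hy' : y' ≤ ⌊α * x⌋) :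
    tau X x ⌊α * x⌋ y' a = 0 ↔ tau Y x y y' b = 0 := by
  rw [← map_tau_droppedLift h hy', hf.map_eq_zero_iff]

theorem represents_droppedLift_eq_zero_iff (hX : X.IsSpectrum)
    (hf : IsBiCover (fun x => ⌊α * x⌋) f) {r x y : ℤ} (hr : 2 ≤ r)
    {b : bi Y x y} {a : bi X x ⌊α * x⌋} (h : IsDroppedLift α f b a) {e : Page X r x ⌊α * x⌋}
    (he : Represents (red X x ⌊α * x⌋ a) e) :
    e = 0 ↔ tau Y x y (⌊α * x⌋ - (r - 2)) b = 0 := by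
  rw [he.eq_zero_iff, ← hf.tau_droppedLift_eq_zero_iff h (by omega)]
  exact hf.red_mem_boundaries_iff hX a

theorem kernel_iff (hX : X.IsSpectrum) (hY : Y.IsSpectrum) (hYc : IsStronglyComplete Y)
    (hf : IsBiCover (fun x => ⌊α * x⌋) f) {r x : ℤ} (hr : 2 ≤ r) (e : Page X r x ⌊α * x⌋) :
    (e ≠ 0 ∧ pageMap f r x ⌊α * x⌋ e = 0) ↔
      ∃ (y : ℤ) (b : bi Y x y) (a : bi X x ⌊α * x⌋), IsDroppedLift α f b a ∧
        Represents (red X x ⌊α * x⌋ a) e ∧ tau Y x y (⌊α * x⌋ - (r - 2)) b ≠ 0 := by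
  constructor
  · rintro ⟨e_ne_zero, he⟩
    obtain ⟨a, b₁, ha, map_a⟩ := hf.exists_red_of_pageMap_eq_zero hX hY le_rfl he
    have map_a_ne_zero : tau Y x (⌊α * x⌋ + 1) ⌊α * x⌋ b₁ ≠ 0 := fun h => by
      rw [h, hf.map_eq_zero_iff] at map_a
      exact e_ne_zero (ha.eq_zero_iff.2 (by rw [map_a, map_zero]; exact zero_mem _))
    obtain ⟨y, hy, b, hb, maximal⟩ := hYc.exists_division hY (by omega) b₁ map_a_ne_zero
    have drops : Drops α b := by
      refine ⟨Int.floor_lt.1 (by omega), fun h => ?_, hb ▸ map_a_ne_zero⟩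
      exact maximal (y - ⌊α * x⌋ + 2) (by ring) (by rw [h]; exact zero_mem _)
    have lift : IsDroppedLift α f b a := ⟨drops, rfl, by rw [map_a, hb]⟩
    exact ⟨y, b, a, lift, ha, fun h =>
      e_ne_zero ((hf.represents_droppedLift_eq_zero_iff hX hr lift ha).2 h)⟩
  · rintro ⟨y, b, a, lift, ha, hb⟩
    refine ⟨fun h => hb ((hf.represents_droppedLift_eq_zero_iff hX hr lift ha).1 h), ?_⟩
    rw [(ha.map f).eq_zero_iff, red_natural, lift.2.2, red_tau hY (Int.floor_lt.2 lift.1.1)]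
    exact zero_mem _

theorem exists_differential (hα : -1 < α) (hX : X.IsSpectrum) (hY : Y.IsSpectrum)
    (hf : IsBiCover (fun x => ⌊α * x⌋) f) {x y r : ℤ} {b : bi Y x y} {a : bi X x ⌊α * x⌋}
    (h : IsDroppedLift α f b a) (hr : IsTorsionOrder α b r) :
    ∃ z : Page Y r (x + 1) (⌊α * x⌋ - r), HitsDropping α z b ∧
      ∃ zt : Page X r (x + 1) (⌊α * x⌋ - r),
        pageMap f r (x + 1) (⌊α * x⌋ - r) zt = z ∧
        (∀ zt', pageMap f r (x + 1) (⌊α * x⌋ - r) zt' = z → zt' = zt) ∧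
        ∃ v : Page X r x ⌊α * x⌋, Represents (red X x ⌊α * x⌋ a) v ∧ v ≠ 0 ∧ IsDiff zt v := by
  have hr₂ : 2 ≤ r := hr.1
  have hy : ⌊α * x⌋ < y := Int.floor_lt.2 h.1.1
  have hy₁ := (sub_add_cancel ⌊α * x⌋ r).symm
  have torsion : tau X x _ (⌊α * x⌋ - r + 1) (tau X x ⌊α * x⌋ (⌊α * x⌋ - r + 2) a) = 0 := by
    rw [tau_tau X (by omega) (by omega), hf.tau_droppedLift_eq_zero_iff h (by omega),
      show ⌊α * x⌋ - r + 1 = ⌊α * x⌋ - (r - 1) by ring, hr.2.1]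
  obtain ⟨u, hu⟩ := (tau_eq_zero_iff (x := x + 1) rfl rfl rfl _).1 torsion
  have delta_map : delta Y rfl rfl (grMap f (x + 1) (⌊α * x⌋ - r) u) =
      tau Y x y (⌊α * x⌋ - r + 2) b := by
    rw [← delta_natural, hu, map_tau_droppedLift h (by omega)]
  obtain ⟨zt, hzt⟩ := exists_page ((mem_cycles_iff rfl hy₁ u).2 ⟨a, hu⟩)
  obtain ⟨v, hv⟩ := exists_page (red_mem_cycles hX r a)
  have v_ne_zero : v ≠ 0 := by
    rw [Ne, hf.represents_droppedLift_eq_zero_iff hX hr₂ h hv]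
    exact hr.tau_ne_zero h.1
  have injective : Function.Injective (pageMap f r (x + 1) (⌊α * x⌋ - r)) := by
    have floor_le := floor_le_floor_add_one hα (x + 1)
    rw [add_sub_cancel_right] at floor_le
    exact hf.pageMap_injective (floor_le_floor_add_one hα) hX hY (by omega)
  exact ⟨_, hitsDropping_of_delta hα hY hr₂ rfl hy₁ hy delta_map (hzt.map f), zt, rfl,
    fun zt' hzt' => injective hzt', v, hv, v_ne_zero, rfl, hy₁, u, a, hzt, hu, hv⟩

theorem exists_delta_grMap_eq (hX : X.IsSpectrum) (hf : IsBiCover (fun x => ⌊α * x⌋) f)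
    {r x₁ y₁ x y : ℤ} {b : bi Y x y} {a : bi X x ⌊α * x⌋} {zt : Page X r x₁ y₁}
    {v : Page X r x ⌊α * x⌋} (hr : 2 ≤ r) (h : IsDroppedLift α f b a)
    (hv : Represents (red X x ⌊α * x⌋ a) v) (hd : IsDiff zt v) :
    ∃ (hx : x + 1 = x₁) (u : gr X x₁ y₁), Represents u zt ∧
      delta Y hx rfl (grMap f x₁ y₁ u) = tau Y x y (y₁ + 2) b := by
  obtain ⟨hx, hy₁, u, c, hu, delta_u, hc⟩ := hd
  have tau_sub_eq_zero : tau X x ⌊α * x⌋ (⌊α * x⌋ - (r - 2)) (c - a) = 0 :=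
    (hf.red_mem_boundaries_iff hX _).1 (by rw [map_sub]; exact (hc.eq_iff hv).1 rfl)
  rw [show ⌊α * x⌋ - (r - 2) = y₁ + 2 by omega, map_sub, sub_eq_zero] at tau_sub_eq_zero
  refine ⟨hx, u, hu, ?_⟩
  rw [← delta_natural, delta_u, tau_sub_eq_zero, map_tau_droppedLift h (by omega)]

/-- Dividing `b` by a maximal power of `τ` makes `[b]` nonzero on the page of the differential. -/
theorem isDroppedDiff (hα : -1 < α) (hX : X.IsSpectrum) (hY : Y.IsSpectrum)
    (hYc : IsStronglyComplete Y) (hf : IsBiCover (fun x => ⌊α * x⌋) f) {r x₁ y₁ x y : ℤ}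
    {b : bi Y x y} {a : bi X x ⌊α * x⌋} {zt : Page X r x₁ y₁} {v : Page X r x ⌊α * x⌋}
    (hr : 2 ≤ r) (h : IsDroppedLift α f b a) (hv : Represents (red X x ⌊α * x⌋ a) v)
    (hv0 : v ≠ 0) (hd : IsDiff zt v) : IsDroppedDiff α f zt v := by
  obtain ⟨hx, u, hu, delta_map⟩ := hf.exists_delta_grMap_eq hX hr h hv hd
  have hy₁ : ⌊α * x⌋ = y₁ + r := hd.2.1
  have hy : ⌊α * x⌋ < y := Int.floor_lt.2 h.1.1
  have height_eq : ⌊α * x⌋ - (r - 2) = y₁ + 2 := by omega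
  have tau_b_ne_zero : tau Y x y (y₁ + 2) b ≠ 0 := by
    rwa [Ne, hf.represents_droppedLift_eq_zero_iff hX hr h hv, height_eq] at hv0
  obtain ⟨y', hy', b', hb', maximal⟩ := hYc.exists_division hY (by omega) b tau_b_ne_zero
  have delta_map' := delta_map.trans hb'.symm
  have drops : Drops α b' := by
    refine ⟨Int.floor_lt.1 (by omega), fun h₀ => ?_, fun h₀ => tau_b_ne_zero ?_⟩
    · exact maximal (y' - y₁) (by ring) (by rw [h₀]; exact zero_mem _)
    · rw [← hb', ← tau_tau Y (by omega : ⌊α * x⌋ ≤ y') (by omega), h₀, map_zero]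
  obtain ⟨a', ha', -⟩ := hf.existsUnique_isDroppedLift drops
  have represents : Represents (red X x ⌊α * x⌋ a') v := by
    refine hv.congr (red_mem_cycles hX r a') ?_
    rw [← map_sub]
    refine (hf.red_mem_boundaries_iff hX (a - a')).2 ?_
    rw [← hf.map_eq_zero_iff, map_sub, map_sub, map_tau_droppedLift h (by omega),
      map_tau_droppedLift ha' (by omega), height_eq, hb', sub_self]
  obtain ⟨z', w, hz', hw, -, crossing⟩ :=
    hitsDropping_of_delta hα hY hr hx hy₁ (by omega) delta_map' (hu.map f)
  exact ⟨hd, y', b', a', ha', isTorsionOrder_of_delta hr hx hy₁ (by omega) delta_map'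
    (delta_map ▸ tau_b_ne_zero), represents, z', w, hz', hw,
    crossing fun hw0 => maximal _ (by omega) (hw.eq_zero_iff.1 hw0)⟩

theorem differential_of_droppedLift (hα : -1 < α) (hX : X.IsSpectrum) (hY : Y.IsSpectrum)
    (hYc : IsStronglyComplete Y) (hf : IsBiCover (fun x => ⌊α * x⌋) f) {r x₁ y₁ x y : ℤ}
    {b : bi Y x y} {a : bi X x ⌊α * x⌋} {zt : Page X r x₁ y₁} {v : Page X r x ⌊α * x⌋}
    (hr : 2 ≤ r) (h : IsDroppedLift α f b a) (hv : Represents (red X x ⌊α * x⌋ a) v)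
    (hv0 : v ≠ 0) (hd : IsDiff zt v) :
    IsTorsionOrder α b r ∧ HitsDropping α (pageMap f r x₁ y₁ zt) b ∧ IsDroppedDiff α f zt v := by
  obtain ⟨hx, u, hu, delta_map⟩ := hf.exists_delta_grMap_eq hX hr h hv hd
  have hy₁ : ⌊α * x⌋ = y₁ + r := hd.2.1
  have hy : ⌊α * x⌋ < y := Int.floor_lt.2 h.1.1
  have delta_map_ne_zero : delta Y hx rfl (grMap f x₁ y₁ u) ≠ 0 := by
    rwa [Ne, hf.represents_droppedLift_eq_zero_iff hX hr h hv,
      show ⌊α * x⌋ - (r - 2) = y₁ + 2 by omega, ← delta_map] at hv0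
  exact ⟨isTorsionOrder_of_delta hr hx hy₁ hy delta_map delta_map_ne_zero,
    hitsDropping_of_delta hα hY hr hx hy₁ hy delta_map (hu.map f),
    hf.isDroppedDiff hα hX hY hYc hr h hv hv0 hd⟩

theorem differential_cases (hα : -1 < α) (hX : X.IsSpectrum) (hY : Y.IsSpectrum)
    (hYc : IsStronglyComplete Y) (hf : IsBiCover (fun x => ⌊α * x⌋) f) {r x₁ y₁ x y : ℤ}
    {zt : Page X r x₁ y₁} {v : Page X r x y} (hr : 2 ≤ r) (hv0 : v ≠ 0) (hd : IsDiff zt v) :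
    (IsDiff (pageMap f r x₁ y₁ zt) (pageMap f r x y v) ∧ pageMap f r x y v ≠ 0) ∨
      IsDroppedDiff α f zt v := by
  by_cases hfv : pageMap f r x y v = 0
  · right
    obtain rfl : y = ⌊α * x⌋ := by
      by_contra hy
      exact hv0 ((_root_.map_eq_zero_iff _ (hf.pageMap_injective (floor_le_floor_add_one hα)
        hX hY hy)).1 hfv)
    obtain ⟨y, b, a, lift, ha, -⟩ := (hf.kernel_iff hX hY hYc hr v).1 ⟨hv0, hfv⟩
    exact hf.isDroppedDiff hα hX hY hYc hr lift ha hv0 hd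
  · exact Or.inl ⟨hd.map f, hfv⟩

end IsBiCover

end Line

end Fil

end LinearT

end

theorem theorem5p7 (α : ℝ) (hα : -1 < α) (X Y : Fil.{u}) (hX : X.IsSpectrum)
    (hY : Y.IsSpectrum) (f : X ⟶ Y) :
    -- the criterion, with the image described by permanent cycles
    (ExhibitsCover α f ↔
      IsStronglyComplete X ∧ IsConnective α (modTau X 1) ∧ TauInvEquiv f ∧
        PageConditions α f IsPermanentCycle) ∧
    -- sufficiency, with the image described by line-crossing differentials
    (IsStronglyComplete X → IsConnective α (modTau X 1) → TauInvEquiv f →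
      PageConditions α f (fun e => ¬ SupportsLineCrossing α e) → ExhibitsCover α f) ∧
    -- consequences for strongly complete `Y`
    (IsStronglyComplete Y → ExhibitsCover α f →
      -- necessity, with the image described by line-crossing differentials
      PageConditions α f (fun e => ¬ SupportsLineCrossing α e) ∧
      -- (5) dropped lifts exist and are unique, and `τ ^ k a = 0 ↔ τ ^ (k + l) b = 0`
      (∀ (x y : ℤ) (b : bi Y x y), Drops α b →
        (∃! a : bi X x ⌊α * x⌋, IsDroppedLift α f b a) ∧
        ∀ a : bi X x ⌊α * x⌋, IsDroppedLift α f b a → ∀ k : ℤ, 0 ≤ k →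
          (tau X x ⌊α * x⌋ (⌊α * x⌋ - k) a = 0 ↔ tau Y x y (⌊α * x⌋ - k) b = 0)) ∧
      -- (6) the nonzero elements of the kernel on the line; the last condition is
      -- `τ ^ (l + r - 2) b ≠ 0`
      (∀ r x : ℤ, 2 ≤ r → ∀ e : Page X r x ⌊α * x⌋,
        (e ≠ 0 ∧ pageMap f r x ⌊α * x⌋ e = 0) ↔
          ∃ (y : ℤ) (b : bi Y x y) (a : bi X x ⌊α * x⌋), IsDroppedLift α f b a ∧
            Represents (red X x ⌊α * x⌋ a) e ∧ tau Y x y (⌊α * x⌋ - (r - 2)) b ≠ 0) ∧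
      -- (7) differentials onto dropped lifts
      (∀ (x y r : ℤ) (b : bi Y x y) (a : bi X x ⌊α * x⌋), IsDroppedLift α f b a →
        IsTorsionOrder α b r →
        ∃ z : Page Y r (x + 1) (⌊α * x⌋ - r), HitsDropping α z b ∧
          ∃ zt : Page X r (x + 1) (⌊α * x⌋ - r),
            pageMap f r (x + 1) (⌊α * x⌋ - r) zt = z ∧
            (∀ zt', pageMap f r (x + 1) (⌊α * x⌋ - r) zt' = z → zt' = zt) ∧
            ∃ v : Page X r x ⌊α * x⌋, Represents (red X x ⌊α * x⌋ a) v ∧ v ≠ 0 ∧ IsDiff zt v) ∧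
      -- (7), converse
      (∀ (r x₁ y₁ x y : ℤ) (b : bi Y x y) (a : bi X x ⌊α * x⌋) (zt : Page X r x₁ y₁)
        (v : Page X r x ⌊α * x⌋), 2 ≤ r → IsDroppedLift α f b a →
        Represents (red X x ⌊α * x⌋ a) v → v ≠ 0 → IsDiff zt v →
          IsTorsionOrder α b r ∧ HitsDropping α (pageMap f r x₁ y₁ zt) b ∧
          IsDroppedDiff α f zt v) ∧
      -- (8) all differentials of `X`
      (∀ (r x₁ y₁ x y : ℤ) (zt : Page X r x₁ y₁) (v : Page X r x y), 2 ≤ r → v ≠ 0 →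
        IsDiff zt v →
          (IsDiff (pageMap f r x₁ y₁ zt) (pageMap f r x y v) ∧ pageMap f r x y v ≠ 0) ∨
          IsDroppedDiff α f zt v)) := by
  refine ⟨⟨fun h => ?_, fun ⟨h1, h2, h3, h4⟩ => h4.exhibitsCover hα hX hY h1.1 h2 h3⟩,
    fun h1 h2 h3 h4 => h4.exhibitsCover hα hX hY h1.1 h2 h3, fun hYc h => ?_⟩
  · have hf := (exhibitsCover_iff_isBiCover hα hX hY).1 h
    exact ⟨hf.isStronglyComplete hX, hf.isConnective_modTau hα hX, hf.tauInvEquiv hX hY,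
      hf.pageConditions hα hX hY fun _ _ _ _ => Iff.rfl⟩
  · have hf := (exhibitsCover_iff_isBiCover hα hX hY).1 h
    have image : PageConditions α f fun e => ¬ SupportsLineCrossing α e :=
      hf.pageConditions hα hX hY fun hr hr' hy e =>
        ⟨not_supportsLineCrossing hY, fun he => hYc.isPermanentCycle hY hr hr' hy he⟩
    exact ⟨image,
      fun x y b hb => ⟨hf.existsUnique_isDroppedLift hb,
        fun a ha k _ => hf.tau_droppedLift_eq_zero_iff ha (by omega)⟩,
      fun r x hr e => hf.kernel_iff hX hY hYc hr e,
      fun x y r b a ha hr => hf.exists_differential hα hX hY ha hr,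
      fun r x₁ y₁ x y b a zt v hr ha hv hv0 hd =>
        hf.differential_of_droppedLift hα hX hY hYc hr ha hv hv0 hd,
      fun r x₁ y₁ x y zt v hr hv0 hd => hf.differential_cases hα hX hY hYc hr hv0 hd⟩
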